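/- Let $K$ be a global function field with finite field of constants $\mathbb F=\mathbb F_q$, let $\infty$ be a place of $K$ with residue field of cardinality $q_\infty$, let $\pi\in K$ be a uniformizer at $\infty$, and let $|\cdot|$ be the absolute value at $\infty$ with $|\pi|^{-1}=q_\infty$. Let $A\subset K$ be the ring of elements regular away from $\infty$, $K_\infty$ the completion of $K$ at $\infty$, and $C_\infty$ the completed algebraic closure of $K_\infty$. Fix an integer $r\ge 1$ and put $V=K^r$, $w_r=q_\infty^r-1$. An $A$-lattice in $V$ is a finitely generated $A$-submodule that spans $V$ over $K$. Let $\mathfrak Y$ be the set of pairs $(\mathbf u,Y)$ with $\mathbf u\in V$ and $Y$ an $A$-lattice in $V$. Let $\Psi\subset C_\infty^r$ be the Drinfeld space of all $\boldsymbol\omega=(\omega_1,\dots,\omega_r)$ with $K_\infty$-linearly independent entries, and for $\mathbf x\in K_\infty^r$ write $\mathbf x\boldsymbol\omega=\sum_i x_i\omega_i$. Let $\mathcal O(\Psi)^*$ be the group of invertible holomorphic functions on $\Psi$, with the topology of uniform convergence of functions and of their inverses on each of the affinoids $\Psi_n=\{\boldsymbol\omega : |\omega_i|\le q_\infty^n \text{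 for all } i,\ |\mathbf x\boldsymbol\omega|\ge q_\infty^{-n}\text{ for all }\mathbf x\in K_\infty^r\text{ with }\max_i|x_i|=1\}$; a function is holomorphic if on each $\Psi_n$ it is a uniform limit of rational functions without poles on $\Psi_n$. For an $A$-lattice $Y$ in $V$ and $\boldsymbol\omega\in\Psi$ put $Y_{\boldsymbol\omega}=\{\mathbf y\boldsymbol\omega:\mathbf y\in Y\}$. For $\Lambda=Y_{\boldsymbol\omega}$ let $e^\Lambda(z)=z\prod_{0\ne\lambda\in\Lambda}(1-z/\lambda)$, and let $d_{\mathbf u}^Y(\boldsymbol\omega)=e^{Y_{\boldsymbol\omega}}(\mathbf u\boldsymbol\omega)$. For $0\neq a\in A$ of degree $d$ (i.e. $|a|=q^d$), let $\phi_a^\Lambda\in C_\infty[X]$ be the polynomial with $\phi_a^\Lambda(e^\Lambda(z))=e^\Lambda(az)$ for all $z$, and let $\Delta_a(\Lambda)$ be its coefficient at $X^{q^{rd}}$. The canonical discriminant $\Delta(\Lambda)\in C_\infty$ is characterized by $$\Delta_a(\Lambda)=\Delta(\Lambda)^{(q^{rd}-1)/w_r}\quad\text{for all } a\in A \text{ with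 } \operatorname{sgn}(a)=1 \text{ and degree } d,$$ where $\operatorname{sgn}(a)=1$ means that $|a\pi^n-1|<1$ for some $n\in\mathbb Z$. Put $\Delta^Y(\boldsymbol\omega)=\Delta(Y_{\boldsymbol\omega})$. Let $M$ be a multiplicatively written abelian group. A distribution on $\mathfrak Y$ with values in $M$ is a map $f:\mathfrak Y\to M$ such that $f(\mathbf u,Y)$ depends only on the class of $\mathbf u$ modulo $Y$, and such that for all lattices $Y\subset Y'$ and all $\mathbf v\in V$ $$\prod_{\mathbf u\in V/Y,\ \mathbf u\equiv\mathbf v\,(\mathrm{mod}\,Y')} f(\mathbf u,Y)=f(\mathbf v,Y').$$ Its derivative is $(\mathbf u,Y)\mapsto f(\mathbf u,Y)/f(0,Y)$. A derived distribution is a map $g$ that is trivial at all $(\mathbf u,Y)$ with $\mathbf u\in Y$, depends only on $\mathbf u$ modulo $Y$, and satisfies $$\prod_{\mathbf u\in V/Y,\ \mathbf u\equiv\mathbf v\,(\mathrm{mod}\,Y')} g(\mathbf u,Y)\cdot\Big(\prod_{0\ne\mathbf u\in Y'/Y}g(\mathbf u,Y)\Big)^{-1}=g(\mathbf v,Y')$$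 for all $Y\subset Y'$ and $\mathbf v\in V$. If $M$ is a topological group, $g$ is motivated by $m:V\setminus\{0\}\to M$ if there is a nonarchimedean norm $\|\cdot\|$ on $K_\infty^r$ such that for all $(\mathbf u,Y)$ with $\mathbf u\notin Y$ $$g(\mathbf u,Y)=\lim_{N\to\infty}\ \prod_{\substack{0\ne\mathbf x\in V,\ \mathbf x\equiv\mathbf u\,(\mathrm{mod}\,Y)\\ \log_q\|\mathbf x\|\le N}} m(\mathbf x)\ \Big/ \prod_{\substack{0\ne\mathbf y\in Y\\ \log_q\|\mathbf y\|\le N}} m(\mathbf y),$$ where the products are finite. **Corollary.** For every $A$-lattice $Y$ in $V$ and every $\boldsymbol\omega\in\Psi$ there is exactly one canonical discriminant $\Delta(Y_{\boldsymbol\omega})$. The rule $$F(\mathbf u,Y)=\begin{cases}(d_{\mathbf u}^Y)^{w_r}\,\Delta^Y,&\mathbf u\notin Y,\\ \Delta^Y,&\mathbf u\in Y,\end{cases}$$ defines a map $F:\mathfrak Y\to\mathcal O(\Psi)^*$, and $F$ is a distribution on $\mathfrak Y$. Its derivative is the derived distribution $G$ with $G(\mathbf u,Y)=(d_{\mathbf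 u}^Y)^{w_r}$ for $\mathbf u\notin Y$, and $G$ is motivated by $m:V\setminus\{0\}\to\mathcal O(\Psi)^*$, $m(\mathbf x)(\boldsymbol\omega)=(\mathbf x\boldsymbol\omega)^{w_r}$. -/

import Mathlib

open scoped Topology

noncomputable section

namespace DrinfeldDist

/-- `K` is a global function field whose field of constants is the (finite) field `F`. -/
def IsGlobalFunctionField (F K : Type*) [Field F] [Field K] [Algebra F K] : Prop :=
  Finite F ∧
  (∃ t : K, Transcendental F t ∧ FiniteDimensional (IntermediateField.adjoin F {t}) K) ∧
  algebraicClosure F K = ⊥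

/-- A place `∞` of `K` (given by its valuation ring), a uniformizer `π ∈ K` at `∞`, and the
associated absolute value of `K`, normalized by `|π|⁻¹ = q_∞`, where `q_∞` is the number of
elements of the residue field.  The absolute value is determined by the other two data. -/
structure Place (K : Type*) [Field K] where
  /-- the valuation ring of `∞` -/
  ring : ValuationSubring K
  /-- the uniformizer -/
  π : K
  /-- the normalized absolute value -/
  abv : AbsoluteValue K ℝ
  mem_ring_iff : ∀ x : K, x ∈ ring ↔ abv x ≤ 1
  π_ne_zero : π ≠ 0
  abv_π_lt_one : abv π < 1
  abv_le_abv_π : ∀ x : K, abv x < 1 → abv x ≤ abv π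
  abv_π_inv : (abv π)⁻¹ = Nat.card (IsLocalRing.ResidueField ring)

namespace Place

variable {K : Type*} [Field K] (v : Place K)

/-- `q_∞`, the number of elements of the residue field at `∞`. -/
def qInf : ℕ := Nat.card (IsLocalRing.ResidueField v.ring)

/-- The Drinfeld coefficient ring `A` of elements of `K` that are regular at all places different
from `∞`.  (All valuation rings of a global function field other than the field itself
are the valuation rings of its places.) -/
def A : Subring K := ⨅ (R : ValuationSubring K) (_ : R ≠ v.ring), R.toSubring

theorem abv_add_le_max (x y : K) : v.abv (x + y) ≤ max (v.abv x) (v.abv y) := by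
  wlog h : v.abv x ≤ v.abv y generalizing x y
  · rw [add_comm, max_comm]
    exact this y x (le_of_not_ge h)
  rw [max_eq_right h]
  by_cases hy : y = 0
  · subst hy
    have hx : v.abv x = 0 := le_antisymm (by simpa using h) (v.abv.nonneg x)
    simp [hx]
  have hpos : 0 < v.abv y := v.abv.pos hy
  have hxy : x / y ∈ v.ring := by
    rw [v.mem_ring_iff, map_div₀]
    exact (div_le_one hpos).2 h
  have h1 : x / y + 1 ∈ v.ring := add_mem hxy (one_mem _)
  rw [v.mem_ring_iff] at h1
  have h2 : x + y = (x / y + 1) * y := by field_simp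
  rw [h2, map_mul]
  exact mul_le_of_le_one_left hpos.le h1

/-- `K_∞`, the completion of `K` at `∞`. -/
abbrev Kinf := v.abv.Completion

/-- The embedding of `K` into `K_∞`. -/
def toKinf : K →+* v.Kinf :=
  (UniformSpace.Completion.coeRingHom (α := WithAbs v.abv)).comp
    (WithAbs.equiv v.abv).symm.toRingHom

theorem norm_toKinf (x : K) : ‖v.toKinf x‖ = v.abv x := by
  change ‖((WithAbs.toAbs v.abv x : WithAbs v.abv) : v.Kinf)‖ = v.abv x
  rw [UniformSpace.Completion.norm_coe]
  rfl

instance ultrametricKinf : IsUltrametricDist v.Kinf := by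
  refine IsUltrametricDist.isUltrametricDist_of_forall_norm_add_le_max_norm fun x y => ?_
  refine UniformSpace.Completion.induction_on₂ x y ?_ ?_
  · exact isClosed_le (by fun_prop) (by fun_prop)
  · intro a b
    rw [← UniformSpace.Completion.coe_add, UniformSpace.Completion.norm_coe,
      UniformSpace.Completion.norm_coe, UniformSpace.Completion.norm_coe]
    exact v.abv_add_le_max a.ofAbs b.ofAbs

instance nontriviallyNormedKinf : NontriviallyNormedField v.Kinf :=
  { (inferInstance : NormedField v.Kinf) with
    non_trivial := by
      refine ⟨v.toKinf v.π⁻¹, ?_⟩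
      change 1 < ‖v.toKinf v.π⁻¹‖
      rw [v.norm_toKinf, map_inv₀]
      exact (one_lt_inv₀ (v.abv.pos v.π_ne_zero)).2 v.abv_π_lt_one }

/-- The algebraic closure of `K_∞`, which carries the unique extension of the absolute value. -/
abbrev KinfAlg := AlgebraicClosure v.Kinf

instance normedFieldKinfAlg : NormedField v.KinfAlg := spectralNorm.normedField v.Kinf v.KinfAlg

instance normedAlgebraKinfAlg : NormedAlgebra v.Kinf v.KinfAlg := spectralNorm.normedAlgebra _ _

/-- `C_∞`, the completed algebraic closure of `K_∞`. -/
abbrev Cinf := UniformSpace.Completion v.KinfAlg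

/-- The embedding of `K_∞` into `C_∞`. -/
def KinfToCinf : v.Kinf →+* v.Cinf :=
  (UniformSpace.Completion.coeRingHom (α := v.KinfAlg)).comp (algebraMap v.Kinf v.KinfAlg)

/-- The embedding of `K` into `C_∞`. -/
def toCinf : K →+* v.Cinf := v.KinfToCinf.comp v.toKinf

/-- `x · ω = ∑ x_i ω_i` for `x ∈ K_∞ ^ r` and `ω ∈ C_∞ ^ r`. -/
def pairInf {r : ℕ} (x : Fin r → v.Kinf) (ω : Fin r → v.Cinf) : v.Cinf :=
  ∑ i, v.KinfToCinf (x i) * ω i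

/-- `x · ω = ∑ x_i ω_i` for `x ∈ V = K ^ r` and `ω ∈ C_∞ ^ r`. -/
def pair {r : ℕ} (x : Fin r → K) (ω : Fin r → v.Cinf) : v.Cinf :=
  ∑ i, v.toCinf (x i) * ω i

/-- The Drinfeld space `Ψ` of all `ω ∈ C_∞ ^ r` with `K_∞`-linearly independent entries. -/
def Psi (r : ℕ) : Type _ :=
  {ω : Fin r → v.Cinf // ∀ x : Fin r → v.Kinf, v.pairInf x ω = 0 → x = 0}

/-- The standard admissible covering of `Ψ` by the affinoids `Ψ_n`, given by `|ω_i| ≤ q_∞ ^ n` and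
`|x · ω| ≥ q_∞ ^ (-n)` for all `x ∈ K_∞ ^ r` of maximum norm `1`. -/
def PsiAff (r n : ℕ) : Set (v.Psi r) :=
  {ω | (∀ i, ‖ω.1 i‖ ≤ (v.qInf : ℝ) ^ n) ∧
    ∀ x : Fin r → v.Kinf, ‖x‖ = 1 → ((v.qInf : ℝ) ^ n)⁻¹ ≤ ‖v.pairInf x ω.1‖}

/-- A function on `Ψ` is holomorphic if on each affinoid `Ψ_n` it is a uniform limit of
rational functions without poles on `Ψ_n`.  (By the maximum modulus principle, a polynomial without
zeroes on the affinoid `Ψ_n` is bounded away from `0` there.) -/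
def IsHolomorphic {r : ℕ} (f : v.Psi r → v.Cinf) : Prop :=
  ∀ n : ℕ, ∀ ε : ℝ, 0 < ε → ∃ P Q : MvPolynomial (Fin r) v.Cinf,
    (∃ c : ℝ, 0 < c ∧ ∀ ω ∈ v.PsiAff r n, c ≤ ‖MvPolynomial.eval ω.1 Q‖) ∧
    ∀ ω ∈ v.PsiAff r n,
      ‖f ω - MvPolynomial.eval ω.1 P / MvPolynomial.eval ω.1 Q‖ ≤ ε

theorem poly_bounded {r : ℕ} (n : ℕ) (P : MvPolynomial (Fin r) v.Cinf) :
    ∃ B : ℝ, 0 ≤ B ∧ ∀ ω ∈ v.PsiAff r n, ‖MvPolynomial.eval ω.1 P‖ ≤ B := by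
  induction P using MvPolynomial.induction_on with
  | C a => exact ⟨‖a‖, norm_nonneg _, fun ω _ => by simp⟩
  | add p q hp hq =>
    obtain ⟨B, hB, h⟩ := hp
    obtain ⟨B', hB', h'⟩ := hq
    refine ⟨B + B', by positivity, fun ω hω => ?_⟩
    rw [map_add]
    exact (norm_add_le _ _).trans (add_le_add (h ω hω) (h' ω hω))
  | mul_X p i hp =>
    obtain ⟨B, hB, h⟩ := hp
    refine ⟨B * (v.qInf : ℝ) ^ n, by positivity, fun ω hω => ?_⟩
    rw [map_mul, MvPolynomial.eval_X, norm_mul]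
    exact mul_le_mul (h ω hω) (hω.1 i) (norm_nonneg _) hB

theorem IsHolomorphic.bounded {r : ℕ} {f : v.Psi r → v.Cinf} (hf : v.IsHolomorphic f) (n : ℕ) :
    ∃ B : ℝ, 0 ≤ B ∧ ∀ ω ∈ v.PsiAff r n, ‖f ω‖ ≤ B := by
  obtain ⟨P, Q, ⟨c, hc, hQ⟩, h⟩ := hf n 1 one_pos
  obtain ⟨B, hB, hP⟩ := v.poly_bounded n P
  refine ⟨1 + B / c, by positivity, fun ω hω => ?_⟩
  have h1 : ‖MvPolynomial.eval ω.1 P / MvPolynomial.eval ω.1 Q‖ ≤ B / c := by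
    rw [norm_div]
    exact div_le_div₀ hB (hP ω hω) hc (hQ ω hω)
  calc ‖f ω‖ = ‖(f ω - MvPolynomial.eval ω.1 P / MvPolynomial.eval ω.1 Q)
        + MvPolynomial.eval ω.1 P / MvPolynomial.eval ω.1 Q‖ := by rw [sub_add_cancel]
    _ ≤ _ := norm_add_le _ _
    _ ≤ 1 + B / c := add_le_add (h ω hω) h1

theorem isHolomorphic_const {r : ℕ} (a : v.Cinf) :
    v.IsHolomorphic (fun _ : v.Psi r => a) := fun n ε hε =>
  ⟨MvPolynomial.C a, 1, ⟨1, one_pos, fun ω _ => by simp⟩, fun ω _ => by simpa using hε.le⟩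

theorem IsHolomorphic.add {r : ℕ} {f g : v.Psi r → v.Cinf} (hf : v.IsHolomorphic f)
    (hg : v.IsHolomorphic g) : v.IsHolomorphic (f + g) := by
  intro n ε hε
  obtain ⟨P, Q, ⟨c, hc, hQ⟩, h⟩ := hf n (ε / 2) (half_pos hε)
  obtain ⟨P', Q', ⟨c', hc', hQ'⟩, h'⟩ := hg n (ε / 2) (half_pos hε)
  refine ⟨P * Q' + P' * Q, Q * Q', ⟨c * c', by positivity, fun ω hω => ?_⟩, fun ω hω => ?_⟩
  · rw [map_mul, norm_mul]
    exact mul_le_mul (hQ ω hω) (hQ' ω hω) hc'.le (norm_nonneg _)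
  · have n1 : MvPolynomial.eval ω.1 Q ≠ 0 := norm_pos_iff.1 (hc.trans_le (hQ ω hω))
    have n2 : MvPolynomial.eval ω.1 Q' ≠ 0 := norm_pos_iff.1 (hc'.trans_le (hQ' ω hω))
    have e : (f + g) ω - MvPolynomial.eval ω.1 (P * Q' + P' * Q) / MvPolynomial.eval ω.1 (Q * Q')
        = (f ω - MvPolynomial.eval ω.1 P / MvPolynomial.eval ω.1 Q)
          + (g ω - MvPolynomial.eval ω.1 P' / MvPolynomial.eval ω.1 Q') := by
      simp only [Pi.add_apply, map_add, map_mul]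
      field_simp
      ring
    rw [e]
    exact (norm_add_le _ _).trans (by linarith [h ω hω, h' ω hω])

theorem IsHolomorphic.mul {r : ℕ} {f g : v.Psi r → v.Cinf} (hf : v.IsHolomorphic f)
    (hg : v.IsHolomorphic g) : v.IsHolomorphic (f * g) := by
  intro n ε hε
  obtain ⟨B, hB, hfB⟩ := hf.bounded v n
  obtain ⟨B', hB', hgB⟩ := hg.bounded v n
  obtain ⟨P, Q, ⟨c, hc, hQ⟩, h⟩ := hf n (min 1 (ε / (2 * (B' + 1)))) (by positivity)
  obtain ⟨P', Q', ⟨c', hc', hQ'⟩, h'⟩ := hg n (ε / (2 * (B + 1))) (by positivity)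
  refine ⟨P * P', Q * Q', ⟨c * c', by positivity, fun ω hω => ?_⟩, fun ω hω => ?_⟩
  · rw [map_mul, norm_mul]
    exact mul_le_mul (hQ ω hω) (hQ' ω hω) hc'.le (norm_nonneg _)
  · have k := h ω hω
    have k' := h' ω hω
    rw [map_mul, map_mul, mul_div_mul_comm]
    generalize MvPolynomial.eval ω.1 P / MvPolynomial.eval ω.1 Q = s at *
    generalize MvPolynomial.eval ω.1 P' / MvPolynomial.eval ω.1 Q' = s' at *
    have hs : ‖s‖ ≤ B + 1 := by
      have : s = f ω - (f ω - s) := by ring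
      rw [this]
      exact (norm_sub_le _ _).trans (add_le_add (hfB ω hω) (k.trans (min_le_left _ _)))
    have e : (f * g) ω - s * s' = (f ω - s) * g ω + s * (g ω - s') := by
      simp only [Pi.mul_apply]
      ring
    rw [e]
    refine (norm_add_le _ _).trans ?_
    rw [norm_mul, norm_mul]
    have a1 : ‖f ω - s‖ * ‖g ω‖ ≤ ε / (2 * (B' + 1)) * (B' + 1) :=
      mul_le_mul (k.trans (min_le_right _ _)) ((hgB ω hω).trans (by linarith))
        (norm_nonneg _) (by positivity)
    have a2 : ‖s‖ * ‖g ω - s'‖ ≤ (B + 1) * (ε / (2 * (B + 1))) :=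
      mul_le_mul hs k' (norm_nonneg _) (by positivity)
    have b1 : ε / (2 * (B' + 1)) * (B' + 1) = ε / 2 := by field_simp
    have b2 : (B + 1) * (ε / (2 * (B + 1))) = ε / 2 := by field_simp
    linarith

/-- The `C_∞`-algebra `O(Ψ)` of holomorphic functions on `Ψ`. -/
def Hol (r : ℕ) : Subalgebra v.Cinf (v.Psi r → v.Cinf) where
  carrier := {f | v.IsHolomorphic f}
  mul_mem' hf hg := hf.mul v hg
  add_mem' hf hg := hf.add v hg
  algebraMap_mem' a := v.isHolomorphic_const a

/-- The value at `ω ∈ Ψ` of an invertible holomorphic function. -/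
def value {r : ℕ} (h : (v.Hol r)ˣ) (ω : v.Psi r) : v.Cinf :=
  ((h : v.Hol r) : v.Psi r → v.Cinf) ω

/-- `O(Ψ)` carries the topology of uniform convergence on each of the affinoids `Ψ_n`.  The group
`O(Ψ)ˣ` gets the topology of the units of a topological ring: convergence of
a function and of its inverse. -/
instance topologyHol (r : ℕ) : TopologicalSpace (v.Hol r) :=
  TopologicalSpace.induced
    (fun f => UniformOnFun.ofFun (Set.range (v.PsiAff r)) (f : v.Psi r → v.Cinf)) inferInstance

/-- The set of `A`-lattices in `V = K ^ r`: the finitely generated `A`-submodules that span `V` over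
`K`. -/
abbrev Lattice (r : ℕ) : Type _ :=
  {Y : Submodule v.A (Fin r → K) // Y.FG ∧ Submodule.span K (Y : Set (Fin r → K)) = ⊤}

/-- The distribution domain `𝔜` of all pairs `(u, Y)` with `u ∈ V` and an `A`-lattice `Y` in `V`. -/
abbrev Domain (r : ℕ) : Type _ := (Fin r → K) × v.Lattice r

/-- The lattice `Y_ω = {y · ω | y ∈ Y}` in `C_∞`. -/
def latticeImage {r : ℕ} (Y : v.Lattice r) (ω : v.Psi r) : Set v.Cinf :=
  (fun y => v.pair y ω.1) '' (Y.1 : Set (Fin r → K))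

/-- The exponential function `e^Λ(z) = z ∏' (1 - z / λ)` (product over `0 ≠ λ ∈ Λ`). -/
def expFun (Λ : Set v.Cinf) (z : v.Cinf) : v.Cinf :=
  z * ∏' l : {l : v.Cinf // l ∈ Λ ∧ l ≠ 0}, (1 - z / l.1)

/-- The division function `d_u^Y(ω) = e^{Y_ω}(u · ω)`. -/
def divFun {r : ℕ} (u : Fin r → K) (Y : v.Lattice r) (ω : v.Psi r) : v.Cinf :=
  v.expFun (v.latticeImage Y ω) (v.pair u ω.1)

/-- `φ_a^Λ`: the polynomial `φ` with `φ ∘ e^Λ = e^Λ ∘ a`. -/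
def IsDrinfeldPoly (Λ : Set v.Cinf) (a : K) (φ : Polynomial v.Cinf) : Prop :=
  ∀ z : v.Cinf, φ.eval (v.expFun Λ z) = v.expFun Λ (v.toCinf a * z)

/-- `sgn(a) = 1` for `a ∈ K`: up to a power of `π`, the element `a` is a 1-unit. -/
def SgnEqOne (a : K) : Prop := ∃ n : ℤ, v.abv (a * v.π ^ n - 1) < 1

/-- `w_r = q_∞ ^ r - 1`. -/
def w (r : ℕ) : ℕ := v.qInf ^ r - 1

/-- `δ` is the canonical discriminant of the lattice `Λ` of rank `r` in `C_∞`: for all `a ∈ A`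
with `sgn(a) = 1` and degree `d` (that is, `|a| = q ^ d`), the discriminant `Δ_a(Λ)`, which is the
coefficient of `φ_a^Λ` at `X ^ (q ^ (r d))`, equals `δ ^ ((q ^ (r d) - 1) / w_r)`.
Here `q` is the number of elements of `F`. -/
def IsCanonicalDiscriminant (F : Type*) (r : ℕ) (Λ : Set v.Cinf) (δ : v.Cinf) : Prop :=
  ∀ a ∈ v.A, v.SgnEqOne a → ∀ d : ℕ, v.abv a = (Nat.card F : ℝ) ^ d →
    ∃ φ : Polynomial v.Cinf, v.IsDrinfeldPoly Λ a φ ∧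
      φ.coeff (Nat.card F ^ (r * d)) = δ ^ ((Nat.card F ^ (r * d) - 1) / v.w r)

/-- The canonical discriminant function `Δ^Y(ω) = Δ(Y_ω)`. -/
def discriminant (F : Type*) {r : ℕ} (Y : v.Lattice r) (ω : v.Psi r) : v.Cinf :=
  Classical.epsilon (v.IsCanonicalDiscriminant F r (v.latticeImage Y ω))

section Distributions

variable {r : ℕ} {M : Type*} [CommGroup M]

/-- `f(u, Y)` depends only on the class of `u` modulo `Y`. -/
def DependsOnClass (f : v.Domain r → M) : Prop :=
  ∀ (u u' : Fin r → K) (Y : v.Lattice r), u - u' ∈ Y.1 → f (u, Y) = f (u', Y)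

/-- The product of the `f(u, Y)` over all classes `u ∈ V / Y` with `u ≡ x` modulo `Y'`. -/
def fibreProd (f : v.Domain r → M) (Y Y' : v.Lattice r) (x : Fin r → K) : M :=
  ∏ᶠ (c : (Fin r → K) ⧸ Y.1) (_ : Quotient.out c - x ∈ Y'.1), f (Quotient.out c, Y)

/-- Distributions on `𝔜` with values in the (multiplicatively written) abelian group `M`. -/
def IsDistribution (f : v.Domain r → M) : Prop :=
  v.DependsOnClass f ∧
  ∀ (Y Y' : v.Lattice r), Y.1 ≤ Y'.1 → ∀ x : Fin r → K, v.fibreProd f Y Y' x = f (x, Y')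

/-- The derivative `Df(u, Y) = f(u, Y) / f(0, Y)`. -/
def derivative (f : v.Domain r → M) : v.Domain r → M := fun p => f p / f (0, p.2)

/-- The discriminant of the lattice pair `Y' | Y` with respect to `g`: the inverse of the product of
the `g(u, Y)` over `0 ≠ u ∈ Y' / Y`. -/
def disc (g : v.Domain r → M) (Y Y' : v.Lattice r) : M :=
  (∏ᶠ (c : (Fin r → K) ⧸ Y.1) (_ : c ≠ 0 ∧ Quotient.out c ∈ Y'.1), g (Quotient.out c, Y))⁻¹

/-- Derived distributions on `𝔜`, regarded as functions on `𝔜` that are trivial at the `(u, Y)` with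
`u ∈ Y`. -/
def IsDerivedDistribution (g : v.Domain r → M) : Prop :=
  (∀ (u : Fin r → K) (Y : v.Lattice r), u ∈ Y.1 → g (u, Y) = 1) ∧
  v.DependsOnClass g ∧
  ∀ (Y Y' : v.Lattice r), Y.1 ≤ Y'.1 →
    ∀ x : Fin r → K, v.fibreProd g Y Y' x * v.disc g Y Y' = g (x, Y')

/-- The index set of all `0 ≠ x ∈ V` with `x ≡ u` modulo `Y` and `log_q ‖x‖ ≤ N`, for a norm on
`V_∞ = K_∞ ^ r`. -/
def ballCoset (q : ℕ) (nrm : Seminorm v.Kinf (Fin r → v.Kinf)) (u : Fin r → K) (Y : v.Lattice r)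
    (N : ℝ) : Set {x : Fin r → K // x ≠ 0} :=
  {x | x.1 - u ∈ Y.1 ∧ Real.logb q (nrm fun i => v.toKinf (x.1 i)) ≤ N}

/-- The derived distribution `g` is motivated by `m : V ∖ {0} → M`: for some (nonarchimedean) norm
on `V_∞` and all `(u, Y)` with `u ∉ Y`, the value `g(u, Y)` is the limit for `N → ∞` of the quotients
of the (finite) products of `m` over the `x ≡ u` and over the `0 ≠ y ∈ Y` of logarithmic norm at
most `N`. -/
def IsMotivatedBy [TopologicalSpace M] (q : ℕ) (g : v.Domain r → M)
    (m : {x : Fin r → K // x ≠ 0} → M) : Prop :=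
  ∃ nrm : Seminorm v.Kinf (Fin r → v.Kinf),
    (∀ x, nrm x = 0 → x = 0) ∧ (∀ x y, nrm (x + y) ≤ max (nrm x) (nrm y)) ∧
    (∀ u Y N, (v.ballCoset q nrm u Y N).Finite) ∧
    ∀ (u : Fin r → K) (Y : v.Lattice r), u ∉ Y.1 →
      Filter.Tendsto
        (fun N : ℝ => (∏ᶠ x ∈ v.ballCoset q nrm u Y N, m x) /
          ∏ᶠ y ∈ v.ballCoset q nrm 0 Y N, m y)
        Filter.atTop (𝓝 (g (u, Y)))

end Distributions

end Place

end DrinfeldDist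

end

noncomputable section

namespace DrinfeldDist

/-! ### Valuation rings of a function field in one variable. -/

section FunctionField

open IntermediateField

variable {F K : Type*} [Field F] [Field K] [Algebra F K]

/-! Everything rests on `A` being discrete and cocompact in `K_∞`. This is extracted from valuation
rings alone: `exists_finite_decomposition` is a weak finiteness of cohomology, and with
`exists_only_pole` and a pigeonhole argument it yields an element of `A` with a pole at `∞`. The
result is collected in `isDiscreteCocompact`.

Discreteness makes every ball of a lattice `Y` a finite group, and cocompactness makes the number
`c_j` of `y ∈ Y` of norm at most `q_∞^j` grow exactly by the factor `Q = q_∞^r` once `j` is large.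
The exponential of `Y_ω` is the limit of the additive polynomials of these balls, divided by the
products `X_j` of their nonzero elements. For `Y ⊆ Y'` of index `n`, splitting the balls of `Y'`
into cosets gives, in the limit, `e^{Y'}(z) Z = ∏ e^Y(z + c)`, where `Z = ∏_{c ≠ 0} e^Y(c)` is also
the limit of `X'_j / X_j^n` (`exp_mul_divProd`, `tendsto_divProd`).

For `Y' = a⁻¹Y` this produces `φ_a` and `Δ_a = a / Z`. If `|a| = q_∞^k`, scaling rewrites `Δ_a` as
the limit of `a^{c_{j+k}} X_j^{Q^k} / X_{j+k}`. If also `sgn(a) = 1`, then `aπ^k` is a 1-unit. The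
`c_j` are eventually a constant times powers of `Q`, a power of the characteristic, so
`(aπ^k)^{c_{j+k}} → 1` and `a` may be replaced by `π^{-k}`. The resulting quotients `D_k(j) =
X_j^{Q^k} / (π^{k c_{j+k}} X_{j+k})` satisfy `D_{k+1}(j) = D_k(j)^Q D_1(j+k)`. Since sign-one
elements exist in all large degrees, two consecutive degrees show that `D_1` converges to some `δ`;
then `D_k → δ^{1+Q+⋯+Q^{k-1}}`, which is the canonical discriminant property. The same two degrees
give uniqueness.

Comparing `D_1` for `Y` and `Y'` gives `Δ^{Y'} = (Δ^Y)^n Z^{Q-1}` (`discriminant_eq_mul_divProd`).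
Together with the product formula for exponentials this is the distribution relation. Finally,
truncations of `d_u^Y` converge with small relative error uniformly on each `Ψ_n`, which yields at
once that `d_u^Y` is an invertible holomorphic function and that the derivative is motivated by the
powers of linear forms (`exists_unit_divFun`). -/

theorem IsGlobalFunctionField.essFiniteType (hK : IsGlobalFunctionField F K) :
    Algebra.EssFiniteType F K := by
  obtain ⟨-, ⟨t, -, hfin⟩, -⟩ := hK
  have h1 : Algebra.EssFiniteType F (adjoin F {t}) :=
    essFiniteType_iff.2 (fg_adjoin_of_finite (Set.finite_singleton t))
  exact .comp F (adjoin F {t}) K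

theorem IsGlobalFunctionField.trdeg_eq_one (hK : IsGlobalFunctionField F K) :
    Algebra.trdeg F K = 1 := by
  obtain ⟨-, ⟨t, ht, hfin⟩, -⟩ := hK
  have hb : IsTranscendenceBasis F (fun _ : Unit => t) := by
    rw [isTranscendenceBasis_iff_algebraicIndependent_isAlgebraic]
    · refine ⟨algebraicIndependent_unique_type_iff.2 ht, ?_⟩
      rw [Set.range_const]
      rw [← isAlgebraic_adjoin_iff_top]
      infer_instance
  have := hb.lift_cardinalMk_eq_trdeg
  simpa using this.symm

/-- Transcendence degree one makes any transcendental `z` a basis, so the generator can be changed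
to one adapted to the place `∞`. -/
theorem IsGlobalFunctionField.finiteDimensional_adjoin (hK : IsGlobalFunctionField F K) {z : K}
    (hz : Transcendental F z) : FiniteDimensional (adjoin F {z}) K := by
  have := hK.essFiniteType
  have hb : IsTranscendenceBasis F (fun _ : Unit => z) :=
    AlgebraicIndependent.isTranscendenceBasis_of_lift_trdeg_le_of_finite
      (algebraicIndependent_unique_type_iff.2 hz) (by simp [hK.trdeg_eq_one])
  have halg := hb.isAlgebraic_field
  rw [Set.range_const] at halg
  have : Algebra.EssFiniteType (adjoin F {z}) K := .of_comp F _ K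
  exact Algebra.finite_of_essFiniteType_of_isAlgebraic

/-- A finite field is perfect. Separability is what makes the integral closure of `F[t]` a Dedekind
domain in `exists_only_pole`. -/
theorem IsGlobalFunctionField.exists_separating (hK : IsGlobalFunctionField F K) :
    ∃ t : K, Transcendental F t ∧ Algebra.IsSeparable (adjoin F {t}) K := by
  have := hK.1
  have := hK.essFiniteType
  obtain ⟨s, hs, hsep⟩ := exists_isTranscendenceBasis_and_isSeparable_of_perfectField F K
  have hcard := hs.lift_cardinalMk_eq_trdeg
  rw [hK.trdeg_eq_one] at hcard
  simp only [Cardinal.lift_id] at hcard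
  have hcard' : s.card = 1 := by
    simpa [Cardinal.mk_coe_finset] using hcard
  obtain ⟨t, rfl⟩ := Finset.card_eq_one.1 hcard'
  refine ⟨t, ?_, by rwa [Finset.coe_singleton] at hsep⟩
  exact hs.1.transcendental ⟨t, by simp⟩

theorem adjoin_simple_inv (t : K) : adjoin F {t⁻¹} = adjoin F {t} := by
  apply le_antisymm
  · exact adjoin_simple_le_iff.2 (inv_mem (mem_adjoin_simple_self F t))
  · refine adjoin_simple_le_iff.2 ?_
    have := inv_mem (mem_adjoin_simple_self F t⁻¹)
    rwa [inv_inv] at this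

theorem transcendental_inv {t : K} (ht : Transcendental F t) : Transcendental F t⁻¹ := fun h => by
  have := h.inv
  rw [inv_inv] at this
  exact ht this

/-- Nonzero constants are roots of unity, and a value group has no torsion. -/
theorem algebraMap_mem_valuationSubring [Finite F] (R : ValuationSubring K) (c : F) :
    algebraMap F K c ∈ R := by
  by_cases hc : c = 0
  · simp [hc]
  obtain ⟨n, hn, h⟩ := (isOfFinOrder_of_finite (Units.mk0 c hc)).exists_pow_eq_one
  have h1 : algebraMap F K c ^ n = 1 := by
    rw [← map_pow]
    have := congrArg Units.val h
    simp only [Units.val_pow_eq_pow_val, Units.val_mk0, Units.val_one] at this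
    rw [this, map_one]
  rw [← R.valuation_le_one_iff]
  have h2 : R.valuation (algebraMap F K c) ^ n = 1 := by rw [← map_pow, h1, map_one]
  exact ((pow_eq_one_iff_of_nonneg zero_le hn.ne').1 h2).le

theorem adjoin_le_valuationSubring [Finite F] (R : ValuationSubring K) {t : K} (ht : t ∈ R)
    {x : K} (hx : x ∈ Algebra.adjoin F {t}) : x ∈ R := by
  induction hx using Algebra.adjoin_induction with
  | mem x h => rw [Set.mem_singleton_iff.1 h]; exact ht
  | algebraMap c => exact algebraMap_mem_valuationSubring R c
  | add _ _ _ _ h1 h2 => exact add_mem h1 h2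
  | mul _ _ _ _ h1 h2 => exact mul_mem h1 h2

theorem integral_mem_valuationSubring [Finite F] (R : ValuationSubring K) {t : K} (ht : t ∈ R)
    {x : K} (hx : IsIntegral (Algebra.adjoin F {t}) x) : x ∈ R := by
  have h1 : IsIntegral R x := by
    let f : Algebra.adjoin F {t} →+* R :=
      { toFun := fun a => ⟨a, adjoin_le_valuationSubring R ht a.2⟩
        map_one' := rfl
        map_mul' := fun _ _ => rfl
        map_zero' := rfl
        map_add' := fun _ _ => rfl }
    obtain ⟨p, hp, h⟩ := hx
    refine ⟨p.map f, hp.map f, ?_⟩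
    rw [Polynomial.eval₂_map]
    exact h
  obtain ⟨y, hy⟩ := (IsIntegrallyClosed.isIntegral_iff (R := R) (K := K)).1 h1
  rw [← hy]
  exact y.2

/-- Polynomial division: up to polynomials in `t`, a rational function of `t` is regular at the
poles of `t`. -/
theorem exists_poly_sub_mem [Finite F] {t : K} (ht : Transcendental F t) {x : K}
    (hx : x ∈ adjoin F {t}) :
    ∃ p : Polynomial F, ∀ R : ValuationSubring K, t ∉ R → x - Polynomial.aeval t p ∈ R := by
  obtain ⟨g, h, rfl⟩ := (mem_adjoin_simple_iff F x).1 hx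
  by_cases h0 : h = 0
  · exact ⟨0, fun R _ => by simp [h0]⟩
  refine ⟨g / h, fun R hR => ?_⟩
  have hh : Polynomial.aeval t h ≠ 0 := fun e => h0 ((transcendental_iff.1 ht) h e)
  have e : Polynomial.aeval t g / Polynomial.aeval t h - Polynomial.aeval t (g / h)
      = Polynomial.aeval t (g % h) / Polynomial.aeval t h := by
    rw [eq_div_iff hh, sub_mul, div_mul_cancel₀ _ hh, sub_eq_iff_eq_add, ← map_mul, ← map_add,
      mul_comm (g / h), add_comm, EuclideanDomain.div_add_mod]
  rw [e, ← R.valuation_le_one_iff, map_div₀]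
  have : R.valuation.IsTrivialOn F := ⟨fun c hc => by
    have hc' : algebraMap F K c ≠ 0 := by simpa using hc
    refine le_antisymm ((R.valuation_le_one_iff _).2 (algebraMap_mem_valuationSubring R c)) ?_
    have h2 := (R.valuation_le_one_iff _).2 (algebraMap_mem_valuationSubring R c⁻¹)
    rw [map_inv₀, map_inv₀] at h2
    exact (inv_le_one₀ (zero_lt_iff.2 (R.valuation.ne_zero_iff.2 hc'))).1 h2⟩
  have h1 : 1 < R.valuation t := by
    rw [← not_le, R.valuation_le_one_iff]
    exact hR
  by_cases hm : g % h = 0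
  · simp [hm]
  -- As `t` has value greater than one, a polynomial in `t` has the value of its leading power, so
  -- only degrees are compared.
  rw [Polynomial.valuation_aeval_eq_valuation_X_pow_natDegree_of_one_lt_valuation_X t h1 hm,
    Polynomial.valuation_aeval_eq_valuation_X_pow_natDegree_of_one_lt_valuation_X t h1 h0]
  refine div_le_one_of_le₀ (pow_le_pow_right₀ h1.le ?_) zero_le
  exact Polynomial.natDegree_le_natDegree (Polynomial.degree_mod_lt g h0).le

open scoped algebraAdjoinAdjoin in
/-- A weak form of the finiteness of `H¹`: up to a finite set, each element of `K` is
the sum of an element regular away from the poles of `t` and an element regular at the poles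
of `t`. -/
theorem exists_finite_decomposition [Finite F] {t : K} (ht : Transcendental F t)
    (hfin : FiniteDimensional (adjoin F {t}) K) :
    ∃ Φ : Set K, Φ.Finite ∧ ∀ x : K, ∃ b φ y : K, x = b + φ + y ∧ φ ∈ Φ ∧
      (∀ R : ValuationSubring K, t ∈ R → b ∈ R) ∧ ∀ R : ValuationSubring K, t ∉ R → y ∈ R := by
  classical
  have hfin' : FiniteDimensional (adjoin F {t⁻¹}) K := by rw [adjoin_simple_inv]; exact hfin
  have ht0 : t ≠ 0 := fun h => ht (h ▸ isAlgebraic_zero)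
  -- Take a basis `c` of `K` over `F(t)` integral over `F[1/t]`, and `f ∈ F[t]` with all `f c_i`
  -- integral over `F[t]`. A coordinate is a polynomial plus a part regular at the poles of `t`.
  -- Dividing that polynomial by `f`, the quotient goes into `b` and the remainder, of degree below
  -- `deg f` and hence from a finite set, into `φ`.
  obtain ⟨s, c, hc⟩ := FiniteDimensional.exists_is_basis_integral
    (Algebra.adjoin F {t⁻¹}) (adjoin F {t⁻¹}) K
  obtain ⟨⟨f', hf'⟩, hf0, hf⟩ := exists_integral_multiples (Algebra.adjoin F {t}) (adjoin F {t})
    (Finset.univ.image c)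
  have hff := hf'
  rw [Algebra.adjoin_singleton_eq_range_aeval] at hff
  obtain ⟨f, rfl⟩ := hff
  have hf00 : f ≠ 0 := by
    rintro rfl
    exact hf0 (Subtype.ext (by simp))
  have : Finite (Polynomial.degreeLT F f.natDegree) :=
    Finite.of_equiv _ (Polynomial.degreeLTEquiv F f.natDegree).symm.toEquiv
  refine ⟨Set.range fun g : s → Polynomial.degreeLT F f.natDegree =>
    ∑ i, Polynomial.aeval t (g i : Polynomial F) * c i, Set.finite_range _, fun x => ?_⟩
  have hx : ∀ i, ((c.repr x i : adjoin F {t⁻¹}) : K) ∈ adjoin F {t} := fun i => by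
    rw [← adjoin_simple_inv t]
    exact (c.repr x i).2
  choose p hp using fun i => exists_poly_sub_mem ht (hx i)
  refine ⟨∑ i, Polynomial.aeval t (p i / f) * (Polynomial.aeval t f * c i),
    ∑ i, Polynomial.aeval t (p i % f) * c i,
    ∑ i, (((c.repr x i : adjoin F {t⁻¹}) : K) - Polynomial.aeval t (p i)) * c i, ?_, ?_, ?_, ?_⟩
  · conv_lhs => rw [← c.sum_repr x]
    rw [← Finset.sum_add_distrib, ← Finset.sum_add_distrib]
    refine Finset.sum_congr rfl fun i _ => ?_
    have e : Polynomial.aeval t (p i) = Polynomial.aeval t f * Polynomial.aeval t (p i / f)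
        + Polynomial.aeval t (p i % f) := by
      rw [← map_mul, ← map_add, EuclideanDomain.div_add_mod]
    rw [e, Algebra.smul_def, IntermediateField.algebraMap_apply]
    ring
  · exact ⟨fun i => ⟨p i % f, Polynomial.mem_degreeLT.2 (by
      rw [← Polynomial.degree_eq_natDegree hf00]
      exact Polynomial.degree_mod_lt _ hf00)⟩, rfl⟩
  · intro R hR
    refine sum_mem fun i _ => mul_mem ?_ ?_
    · refine adjoin_le_valuationSubring (F := F) R hR ?_
      rw [Algebra.adjoin_singleton_eq_range_aeval]
      exact ⟨_, rfl⟩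
    · exact integral_mem_valuationSubring (F := F) R hR
        (hf (c i) (Finset.mem_image_of_mem _ (Finset.mem_univ _)))
  · intro R hR
    refine sum_mem fun i _ => mul_mem (hp i R hR) ?_
    exact integral_mem_valuationSubring (F := F) R ((R.mem_or_inv_mem t).resolve_left hR) (hc i)

open scoped algebraAdjoinAdjoin in
/-- At a place `W` at which `t` is regular there is an element whose only pole among the places at
which `t` is regular is `W`. -/
theorem exists_only_pole [Finite F] {t : K} (ht : Transcendental F t)
    (hfin : FiniteDimensional (adjoin F {t}) K) (hsep : Algebra.IsSeparable (adjoin F {t}) K)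
    (W : ValuationSubring K) (hW : W ≠ ⊤) (htW : t ∈ W) :
    ∃ x : K, x ∉ W ∧ ∀ R : ValuationSubring K, t ∈ R → R ≠ W → x ∈ R := by
  let A := Algebra.adjoin F {t}
  have hA : IsPrincipalIdealRing A :=
    IsPrincipalIdealRing.of_surjective
      (Polynomial.algEquivOfTranscendental F t ht).toAlgHom.toRingHom
      (Polynomial.algEquivOfTranscendental F t ht).surjective
  let B := integralClosure A K
  have hB : IsDedekindDomain B := integralClosure.isDedekindDomain A (adjoin F {t}) K
  have hBK : IsFractionRing B K :=
    IsIntegralClosure.isFractionRing_of_finite_extension A (adjoin F {t}) K B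
  have hBR : ∀ R : ValuationSubring K, t ∈ R → ∀ b : B, (b : K) ∈ R := fun R hR b =>
    integral_mem_valuationSubring (F := F) R hR b.2
  let ι : ∀ R : ValuationSubring K, t ∈ R → B →+* R := fun R hR =>
    { toFun := fun b => ⟨b, hBR R hR b⟩
      map_one' := rfl
      map_mul' := fun _ _ => rfl
      map_zero' := rfl
      map_add' := fun _ _ => rfl }
  let pr : ∀ R : ValuationSubring K, t ∈ R → Ideal B := fun R hR =>
    (IsLocalRing.maximalIdeal R).comap (ι R hR)
  have hprime : ∀ R hR, (pr R hR).IsPrime := fun R hR => Ideal.IsPrime.comap _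
  have hmem : ∀ R hR (b : B), b ∈ pr R hR ↔ R.valuation (b : K) < 1 := fun R hR b =>
    R.valuation_lt_one_iff ⟨b, hBR R hR b⟩
  have hunit : ∀ R (hR : t ∈ R) (b : B), b ∉ pr R hR → (b : K)⁻¹ ∈ R := fun R hR b hb => by
    rw [hmem R hR, not_lt] at hb
    rw [← R.valuation_le_one_iff, map_inv₀]
    exact inv_le_one_of_one_le₀ hb
  have hfrac : ∀ x : K, ∃ a b : B, (b : K) ≠ 0 ∧ x = a / b := fun x => by
    obtain ⟨a, b, hb, h⟩ := IsFractionRing.div_surjective (A := B) x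
    refine ⟨a, b, ?_, h.symm⟩
    have := nonZeroDivisors.ne_zero hb
    exact fun h => this (Subtype.ext h)
  have hbot : pr W htW ≠ ⊥ := by
    intro hbot
    apply hW
    rw [eq_top_iff]
    intro x _
    obtain ⟨a, b, hb, rfl⟩ := hfrac x
    rw [div_eq_mul_inv]
    refine mul_mem (hBR W htW a) (hunit W htW b ?_)
    rw [hbot, Ideal.mem_bot]
    exact fun h => hb (congrArg Subtype.val h)
  -- The localization of `B` at the prime of `W` is a discrete valuation ring; clearing
  -- denominators, one of `a`, `b` divides the other up to a factor outside the prime.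
  have hcmp : ∀ a b : B, ∃ r s : B, s ∉ pr W htW ∧ (a * s = b * r ∨ b * s = a * r) := by
    have := hprime W htW
    have hdvr : IsDiscreteValuationRing (Localization.AtPrime (pr W htW)) :=
      IsLocalization.AtPrime.isDiscreteValuationRing_of_dedekind_domain B hbot _
    have hval : PreValuationRing (Localization.AtPrime (pr W htW)) :=
      (inferInstance : ValuationRing (Localization.AtPrime (pr W htW))).toPreValuationRing
    have key : ∀ a b : B, algebraMap B (Localization.AtPrime (pr W htW)) b ∣
        algebraMap B (Localization.AtPrime (pr W htW)) a →
        ∃ r s : B, s ∉ pr W htW ∧ a * s = b * r := by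
      rintro a b ⟨c, hc⟩
      obtain ⟨r, s, rfl⟩ := IsLocalization.exists_mk'_eq (pr W htW).primeCompl c
      refine ⟨r, s, s.2, ?_⟩
      apply IsLocalization.injective (Localization.AtPrime (pr W htW))
        (pr W htW).primeCompl_le_nonZeroDivisors
      rw [map_mul, map_mul, hc, mul_assoc, IsLocalization.mk'_spec]
    intro a b
    rcases ValuationRing.dvd_total (algebraMap B (Localization.AtPrime (pr W htW)) b)
      (algebraMap B (Localization.AtPrime (pr W htW)) a) with h | h
    · obtain ⟨r, s, hs, h⟩ := key a b h
      exact ⟨r, s, hs, .inl h⟩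
    · obtain ⟨r, s, hs, h⟩ := key b a h
      exact ⟨r, s, hs, .inr h⟩
  -- By `hcmp`, every element of a valuation ring over this prime is a fraction with denominator
  -- outside the prime, so the ring is determined by the prime.
  have huniq : ∀ R hR, pr R hR = pr W htW → R = W := by
    have key : ∀ R R' (hR : t ∈ R) (hR' : t ∈ R'), pr R hR = pr W htW → pr R' hR' = pr W htW →
        ∀ x ∈ R, x ∈ R' := by
      intro R R' hR hR' h h' x hx
      obtain ⟨a, b, hb, rfl⟩ := hfrac x
      obtain ⟨r, s, hs, e⟩ := hcmp a b
      have hs0 : (s : K) ≠ 0 := fun h0 => hs (by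
        rw [show s = 0 from Subtype.ext h0]
        exact zero_mem _)
      rcases e with e | e
      · have e' : (a : K) * s = b * r := congrArg Subtype.val e
        have : (a : K) / b = r * (s : K)⁻¹ := by field_simp; exact e'
        rw [this]
        exact mul_mem (hBR R' hR' r) (hunit R' hR' s (h' ▸ hs))
      · have e' : (b : K) * s = a * r := congrArg Subtype.val e
        have hr0 : (r : K) ≠ 0 := fun h0 => (mul_ne_zero hb hs0) (by rw [e', h0, mul_zero])
        have e2 : (a : K) / b = s * (r : K)⁻¹ := by field_simp; exact e'.symm
        have hr : r ∉ pr W htW := by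
          intro hr
          rw [← h, hmem R hR] at hr
          rw [← h, hmem R hR, not_lt] at hs
          rw [e2, ← R.valuation_le_one_iff, map_mul, map_inv₀, ← div_eq_mul_inv,
            div_le_one₀ (zero_lt_iff.2 (R.valuation.ne_zero_iff.2 hr0))] at hx
          exact absurd (hs.trans hx) (not_le.2 hr)
        rw [e2]
        exact mul_mem (hBR R' hR' s) (hunit R' hR' r (h' ▸ hr))
    intro R hR h
    exact le_antisymm (key R W hR htW h rfl) (key W R htW hR rfl h)
  -- Choose `x` in the inverse of the prime `P` of `W` but not in `B`. At a ring `R ≠ W`, some `c ∈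
  -- P` is a unit and `xc ∈ B`, so `x` is regular there.
  obtain ⟨x, hx, hx1⟩ := FractionalIdeal.exists_notMem_one_of_ne_bot (K := K) hbot
    (hprime W htW).ne_top
  have hother : ∀ R : ValuationSubring K, t ∈ R → R ≠ W → x ∈ R := by
    intro R hR hRW
    by_contra hxR
    apply hRW
    apply huniq R hR
    have hmax : (pr W htW).IsMaximal := Ring.DimensionLEOne.maximalOfPrime hbot (hprime W htW)
    refine (hmax.eq_of_le (hprime R hR).ne_top fun c hc => ?_).symm
    by_contra hcR
    rw [FractionalIdeal.mem_inv_iff (FractionalIdeal.coeIdeal_ne_zero.2 hbot)] at hx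
    have h1 := hx (c : K) ((FractionalIdeal.mem_coeIdeal _).2 ⟨c, hc, rfl⟩)
    obtain ⟨d, hd⟩ := (FractionalIdeal.mem_one_iff _).1 h1
    have hc0 : (c : K) ≠ 0 := fun h0 => hcR (by
      rw [show c = 0 from Subtype.ext h0]
      exact zero_mem _)
    have : x = d * (c : K)⁻¹ := by
      rw [eq_mul_inv_iff_mul_eq₀ hc0]
      exact hd.symm
    apply hxR
    rw [this]
    exact mul_mem (hBR R hR d) (hunit R hR c hcR)
  -- If `x` were regular at `W` too, it would lie in all valuation rings above the integrally closed
  -- ring `B`, hence in `B`.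
  refine ⟨x, fun hxW => hx1 ?_, hother⟩
  have hint : IsIntegrallyClosedIn B.toSubring K := inferInstanceAs (IsIntegrallyClosedIn B K)
  by_contra hxB
  obtain ⟨R, hR, hxR⟩ := Subring.exists_le_valuationSubring_of_isIntegrallyClosedIn
    (R := B.toSubring) (x := x) fun h => hxB ((FractionalIdeal.mem_one_iff _).2 ⟨⟨x, h⟩, rfl⟩)
  have hR' : t ∈ R := hR (algebraMap_mem B
    (⟨t, Algebra.self_mem_adjoin_singleton F t⟩ : Algebra.adjoin F {t}))
  by_cases hRW : R = W
  · exact hxR (hRW ▸ hxW)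
  · exact hxR (hother R hR' hRW)

end FunctionField

/-! ### The discrete absolute value at `∞` and its residue field. -/

namespace Place

variable {K : Type*} [Field K] (v : Place K)

theorem mem_A_iff (x : K) : x ∈ v.A ↔ ∀ R : ValuationSubring K, R ≠ v.ring → x ∈ R := by
  simp [A, Subring.mem_iInf]

theorem abv_π_pos : 0 < v.abv v.π := v.abv.pos v.π_ne_zero

theorem inv_abv_π : (v.abv v.π)⁻¹ = v.qInf := v.abv_π_inv

theorem abv_π : v.abv v.π = (v.qInf : ℝ)⁻¹ := by rw [← inv_abv_π, inv_inv]

theorem one_lt_qInf_real : (1 : ℝ) < v.qInf := by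
  rw [← inv_abv_π]
  exact (one_lt_inv₀ v.abv_π_pos).2 v.abv_π_lt_one

theorem one_lt_qInf : 1 < v.qInf := by exact_mod_cast v.one_lt_qInf_real

theorem qInf_pos_real : (0 : ℝ) < v.qInf := zero_lt_one.trans v.one_lt_qInf_real

instance finite_residueField : Finite (IsLocalRing.ResidueField v.ring) :=
  Nat.finite_of_card_ne_zero (zero_lt_one.trans v.one_lt_qInf).ne'

theorem abv_zpow_π (n : ℤ) : v.abv (v.π ^ n) = (v.qInf : ℝ) ^ (-n) := by
  rw [map_zpow₀, abv_π, inv_zpow, zpow_neg]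

theorem exists_abv_eq_zpow {x : K} (hx : x ≠ 0) : ∃ n : ℤ, v.abv x = (v.qInf : ℝ) ^ n := by
  obtain ⟨n, h1, h2⟩ := exists_mem_Ioc_zpow (v.abv.pos hx) v.one_lt_qInf_real
  refine ⟨n + 1, le_antisymm h2 ?_⟩
  by_contra hlt
  rw [not_le] at hlt
  have hq := v.qInf_pos_real
  have e : v.abv (x * v.π ^ (n + 1)) = v.abv x * ((v.qInf : ℝ) ^ (n + 1))⁻¹ := by
    rw [map_mul, abv_zpow_π, zpow_neg]
  have h3 := v.abv_le_abv_π (x * v.π ^ (n + 1)) (by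
    rw [e, mul_inv_lt_iff₀ (zpow_pos hq _), one_mul]
    exact hlt)
  rw [e, mul_inv_le_iff₀ (zpow_pos hq _), abv_π, zpow_add_one₀ hq.ne', mul_comm,
    mul_inv_cancel_right₀ hq.ne'] at h3
  exact absurd h1 (not_lt.2 h3)

theorem abv_lt_zpow_succ_iff {x : K} (n : ℤ) :
    v.abv x < (v.qInf : ℝ) ^ (n + 1) ↔ v.abv x ≤ (v.qInf : ℝ) ^ n := by
  by_cases hx : x = 0
  · subst hx
    simp only [map_zero]
    exact ⟨fun _ => (zpow_pos v.qInf_pos_real _).le, fun _ => zpow_pos v.qInf_pos_real _⟩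
  obtain ⟨m, hm⟩ := v.exists_abv_eq_zpow hx
  rw [hm, zpow_lt_zpow_iff_right₀ v.one_lt_qInf_real, zpow_le_zpow_iff_right₀ v.one_lt_qInf_real,
    Int.lt_add_one_iff]

theorem ring_ne_top : v.ring ≠ ⊤ := fun h => by
  have h1 : v.π⁻¹ ∈ v.ring := h ▸ ValuationSubring.mem_top _
  rw [v.mem_ring_iff, map_inv₀, inv_abv_π] at h1
  exact absurd v.one_lt_qInf_real (not_lt.2 h1)

theorem abv_sub_le_max (x y : K) : v.abv (x - y) ≤ max (v.abv x) (v.abv y) := by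
  rw [sub_eq_add_neg, ← v.abv.map_neg y]
  exact v.abv_add_le_max x (-y)

theorem abv_eq_of_abv_sub_lt {x y : K} (h : v.abv (x - y) < v.abv y) : v.abv x = v.abv y := by
  apply le_antisymm
  · have := v.abv_add_le_max (x - y) y
    rw [sub_add_cancel, max_eq_right h.le] at this
    exact this
  · have := v.abv_sub_le_max x (x - y)
    rw [sub_sub_cancel] at this
    rcases le_max_iff.1 this with h1 | h1
    · exact h1
    · exact absurd h (not_lt.2 h1)

theorem residue_eq_zero_iff (x : v.ring) :
    IsLocalRing.residue v.ring x = 0 ↔ v.abv (x : K) < 1 := by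
  rw [IsLocalRing.residue_eq_zero_iff, ValuationSubring.valuation_lt_one_iff, ← not_iff_not,
    not_lt, not_lt]
  by_cases h0 : (x : K) = 0
  · simp [h0]
  have h1 : 0 < v.ring.valuation (x : K) := zero_lt_iff.2 ((Valuation.ne_zero_iff _).2 h0)
  rw [← inv_le_one₀ h1, ← inv_le_one₀ (v.abv.pos h0), ← map_inv₀, ← map_inv₀,
    ValuationSubring.valuation_le_one_iff, v.mem_ring_iff]

/-- The properties of the Drinfeld coefficient ring `A` that make it a discrete cocompact subring
of `K_∞` with quotient field `K`. -/
structure IsDiscreteCocompact : Prop where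
  finite_ball : ∀ R : ℝ, {a : K | a ∈ v.A ∧ v.abv a ≤ R}.Finite
  one_le_abv : ∀ a ∈ v.A, a ≠ 0 → 1 ≤ v.abv a
  exists_abv_sub_le : ∃ ρ : ℝ, ∀ x : K, ∃ a ∈ v.A, v.abv (x - a) ≤ ρ
  exists_mul_mem : ∀ x : K, ∃ a ∈ v.A, a ≠ 0 ∧ a * x ∈ v.A

/-! ### The ring `A` is discrete and cocompact. -/

section GlobalField

variable {F : Type*} [Field F] [Algebra F K]

theorem abv_algebraMap [Finite F] {c : F} (hc : c ≠ 0) : v.abv (algebraMap F K c) = 1 := by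
  have h1 := (v.mem_ring_iff _).1 (algebraMap_mem_valuationSubring v.ring c)
  have h2 := (v.mem_ring_iff _).1 (algebraMap_mem_valuationSubring v.ring c⁻¹)
  rw [map_inv₀, map_inv₀] at h2
  have h3 : 0 < v.abv (algebraMap F K c) := v.abv.pos (by simpa using hc)
  exact le_antisymm h1 ((inv_le_one₀ h3).1 h2)

theorem transcendental_of_abv_ne_one (hK : IsGlobalFunctionField F K) {x : K} (hx : x ≠ 0)
    (h : v.abv x ≠ 1) : Transcendental F x := fun halg => by
  have := hK.1
  have h1 : x ∈ algebraicClosure F K := mem_algebraicClosure_iff.2 halg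
  rw [hK.2.2, IntermediateField.mem_bot] at h1
  obtain ⟨c, rfl⟩ := h1
  exact h (v.abv_algebraMap fun hc => hx (by rw [hc, map_zero]))

/-- A pigeonhole substitute for Riemann–Roch. Decompose the powers of an `x` whose only pole among
the places regular at `t` is `∞`. Two powers share the same finite part `φ`; the difference of their
`y` parts is regular away from `∞` and inherits the pole of the higher power there. -/
theorem exists_one_lt_abv (hK : IsGlobalFunctionField F K) : ∃ z ∈ v.A, 1 < v.abv z := by
  have := hK.1
  obtain ⟨t, ht, hsep, htW⟩ : ∃ t : K, Transcendental F t ∧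
      Algebra.IsSeparable (IntermediateField.adjoin F {t}) K ∧ t ∈ v.ring := by
    obtain ⟨t, ht, hsep⟩ := hK.exists_separating
    rcases v.ring.mem_or_inv_mem t with h | h
    · exact ⟨t, ht, hsep, h⟩
    · exact ⟨t⁻¹, transcendental_inv ht, by rwa [adjoin_simple_inv], h⟩
  have hfin := hK.finiteDimensional_adjoin ht
  obtain ⟨x, hxW, hx⟩ := exists_only_pole ht hfin hsep v.ring v.ring_ne_top htW
  obtain ⟨Φ, hΦ, hdec⟩ := exists_finite_decomposition ht hfin
  choose b φ y e hφ hb hy using fun i : ℕ => hdec (x ^ (i + 1))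
  have := hΦ.to_subtype
  obtain ⟨i, j, hij, hφij⟩ : ∃ i j : ℕ, i < j ∧ φ i = φ j := by
    obtain ⟨i, j, hne, h⟩ := Finite.exists_ne_map_eq_of_infinite fun i => (⟨φ i, hφ i⟩ : Φ)
    have h' : φ i = φ j := congrArg Subtype.val h
    rcases lt_or_gt_of_ne hne with hlt | hlt
    · exact ⟨i, j, hlt, h'⟩
    · exact ⟨j, i, hlt, h'.symm⟩
  have e1 : y j - y i = x ^ (j + 1) - x ^ (i + 1) - (b j - b i) := by
    rw [e j, e i, hφij]
    ring
  refine ⟨y j - y i, (v.mem_A_iff _).2 fun R hR => ?_, ?_⟩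
  · by_cases htR : t ∈ R
    · rw [e1]
      exact sub_mem (sub_mem (pow_mem (hx R htR hR) _) (pow_mem (hx R htR hR) _))
        (sub_mem (hb j R htR) (hb i R htR))
    · exact sub_mem (hy j R htR) (hy i R htR)
  · have hx1 : 1 < v.abv x := by
      rw [v.mem_ring_iff, not_le] at hxW
      exact hxW
    by_contra hz
    rw [not_lt] at hz
    have hbW : v.abv (b j - b i) ≤ 1 :=
      (v.mem_ring_iff _).1 (sub_mem (hb j _ htW) (hb i _ htW))
    have h1 : v.abv (y j - y i + (b j - b i)) ≤ 1 := (v.abv_add_le_max _ _).trans (max_le hz hbW)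
    have e2 : x ^ (j + 1) = x ^ (i + 1) + (y j - y i + (b j - b i)) := by rw [e1]; ring
    have h2 := v.abv_add_le_max (x ^ (i + 1)) (y j - y i + (b j - b i))
    rw [← e2, map_pow, map_pow, max_eq_left (h1.trans (one_le_pow₀ hx1.le))] at h2
    exact absurd (pow_lt_pow_right₀ hx1 (Nat.succ_lt_succ hij)) (not_lt.2 h2)

/-- A nonconstant element has a pole. If `|a| < 1`, then `a⁻¹` is transcendental and generates a
proper ideal of `F[a⁻¹]`; a valuation ring dominating this ideal omits `a`, so it must be that of
`∞`, where `a` is regular. -/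
theorem one_le_abv_of_mem_A (hK : IsGlobalFunctionField F K) {a : K} (ha : a ∈ v.A)
    (ha0 : a ≠ 0) : 1 ≤ v.abv a := by
  by_contra hlt
  rw [not_le] at hlt
  have ht := transcendental_inv (v.transcendental_of_abv_ne_one hK ha0 hlt.ne)
  let S := (Algebra.adjoin F {a⁻¹}).toSubring
  let s : S := ⟨a⁻¹, Algebra.self_mem_adjoin_singleton F a⁻¹⟩
  have hI : Ideal.span {s} ≠ ⊤ := by
    intro h
    obtain ⟨⟨y, hy⟩, hys⟩ := Ideal.mem_span_singleton'.1 (h ▸ Submodule.mem_top : (1 : S) ∈ _)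
    have hy' : y ∈ Algebra.adjoin F {a⁻¹} := hy
    rw [Algebra.adjoin_singleton_eq_range_aeval] at hy'
    obtain ⟨p, rfl⟩ := hy'
    have h1 : Polynomial.aeval a⁻¹ (p * Polynomial.X - 1) = 0 := by
      have h2 : Polynomial.aeval a⁻¹ p * a⁻¹ = 1 := congrArg Subtype.val hys
      rw [map_sub, map_mul, Polynomial.aeval_X, map_one, h2, sub_self]
    have h3 := (transcendental_iff.1 ht) _ h1
    have h4 := congrArg (Polynomial.eval 0) h3
    simp at h4
  obtain ⟨R, hR, hRI⟩ := Ideal.image_subset_nonunits_valuationSubring (Ideal.span {s}) hI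
  have h1 : a⁻¹ ∈ R.nonunits := hRI ⟨s, Ideal.subset_span rfl, rfl⟩
  have haR : a ∉ R := by
    rcases R.inv_mem_nonunits_iff.1 h1 with h | h
    · exact absurd h ha0
    · exact h
  have h2 : R = v.ring := by
    by_contra hne
    exact haR ((v.mem_A_iff a).1 ha R hne)
  rw [h2, v.mem_ring_iff] at haR
  exact haR hlt.le

/-- Scale by `π^k` and reduce to the finite residue field: each fibre is a translate of part of the
next smaller ball. At radius one, two elements of the same fibre differ by less than one in absolute
value, hence coincide. -/
theorem finite_ball_A (hK : IsGlobalFunctionField F K) (R : ℝ) :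
    {a : K | a ∈ v.A ∧ v.abv a ≤ R}.Finite := by
  obtain ⟨k, hk⟩ := pow_unbounded_of_one_lt R v.one_lt_qInf_real
  refine Set.Finite.subset ?_ (fun a ha => ⟨ha.1, ha.2.trans hk.le⟩ :
    _ ⊆ {a : K | a ∈ v.A ∧ v.abv a ≤ (v.qInf : ℝ) ^ k})
  clear hk
  have key : ∀ (k : ℕ) (s : Set K), (∀ a ∈ s, v.abv a ≤ (v.qInf : ℝ) ^ k) →
      (∀ c : K, {a ∈ s | v.abv (a - c) < (v.qInf : ℝ) ^ k}.Finite) → s.Finite := by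
    intro k s hs hfib
    have hq := v.qInf_pos_real
    have hmem : ∀ a ∈ s, a * v.π ^ k ∈ v.ring := fun a ha => by
      rw [v.mem_ring_iff, map_mul, map_pow, abv_π, inv_pow, mul_inv_le_iff₀ (pow_pos hq _), one_mul]
      exact hs a ha
    classical
    refine Set.Finite.of_finite_fibers (fun a => if h : a * v.π ^ k ∈ v.ring then
      IsLocalRing.residue v.ring ⟨_, h⟩ else 0) (Set.toFinite _) ?_
    rintro _ ⟨c, hc, rfl⟩
    refine (hfib c).subset ?_
    rintro a ⟨ha, hac⟩
    refine ⟨ha, ?_⟩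
    simp only [Set.mem_preimage, Set.mem_singleton_iff, dif_pos (hmem a ha),
      dif_pos (hmem c hc)] at hac
    rw [← sub_eq_zero, ← map_sub, residue_eq_zero_iff] at hac
    have h2 : v.abv ((a - c) * v.π ^ k) < 1 := by rw [sub_mul]; exact hac
    rwa [map_mul, map_pow, abv_π, inv_pow, mul_inv_lt_iff₀ (pow_pos hq _), one_mul] at h2
  induction k with
  | zero =>
    refine key 0 _ (fun a ha => ha.2) fun c => ?_
    refine Set.Subsingleton.finite fun a ha b hb => ?_
    by_contra hne
    have h1 := v.one_le_abv_of_mem_A hK (sub_mem ha.1.1 hb.1.1) (sub_ne_zero.2 hne)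
    have h2 := v.abv_sub_le_max (a - c) (b - c)
    rw [sub_sub_sub_cancel_right] at h2
    exact absurd (h2.trans_lt (max_lt ha.2 hb.2)) (by simpa using h1)
  | succ k ih =>
    refine key (k + 1) _ (fun a ha => ha.2) fun c => ?_
    rcases Set.eq_empty_or_nonempty {a ∈ {a : K | a ∈ v.A ∧ v.abv a ≤ (v.qInf : ℝ) ^ (k + 1)} |
        v.abv (a - c) < (v.qInf : ℝ) ^ (k + 1)} with hne | hne
    · exact hne ▸ Set.finite_empty
    · obtain ⟨b, hb⟩ := hne
      refine (ih.image fun a => a + b).subset fun a ha => ⟨a - b, ⟨sub_mem ha.1.1 hb.1.1, ?_⟩,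
        sub_add_cancel a b⟩
      have h2 := v.abv_sub_le_max (a - c) (b - c)
      rw [sub_sub_sub_cancel_right] at h2
      have h3 := h2.trans_lt (max_lt ha.2 hb.2)
      have h4 := (v.abv_lt_zpow_succ_iff (x := a - b) k).1
      exact_mod_cast h4 (by exact_mod_cast h3)

open scoped IntermediateField.algebraAdjoinAdjoin in
-- For `z ∈ A` with `|z| > 1`, the places regular at `z` are exactly those other than `∞`, so
-- decomposing along `z` separates a part in `A` from a part bounded at `∞`.
theorem isDiscreteCocompact (hK : IsGlobalFunctionField F K) : v.IsDiscreteCocompact := by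
  have := hK.1
  obtain ⟨z, hzA, hz1⟩ := v.exists_one_lt_abv hK
  have hz0 : z ≠ 0 := by
    rintro rfl
    rw [map_zero] at hz1
    exact absurd hz1 (not_lt.2 zero_le_one)
  have ht := v.transcendental_of_abv_ne_one hK hz0 hz1.ne'
  have hfin := hK.finiteDimensional_adjoin ht
  have hzW : z ∉ v.ring := by rwa [v.mem_ring_iff, not_le]
  refine ⟨v.finite_ball_A hK, fun a => v.one_le_abv_of_mem_A hK, ?_, fun x => ?_⟩
  · obtain ⟨Φ, hΦ, hdec⟩ := exists_finite_decomposition ht hfin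
    obtain ⟨C, hC⟩ := (hΦ.image v.abv).bddAbove
    refine ⟨max C 1, fun x => ?_⟩
    obtain ⟨b, φ, y, rfl, hφ, hb, hy⟩ := hdec x
    refine ⟨b, (v.mem_A_iff b).2 fun R hR => hb R ((v.mem_A_iff z).1 hzA R hR), ?_⟩
    rw [add_assoc, add_sub_cancel_left]
    exact (v.abv_add_le_max _ _).trans
      (max_le_max (hC ⟨φ, hφ, rfl⟩) ((v.mem_ring_iff y).1 (hy v.ring hzW)))
  · obtain ⟨a, ha0, ha⟩ := exists_integral_multiples (Algebra.adjoin F {z})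
      (IntermediateField.adjoin F {z}) {x}
    have h1 := ha x (Finset.mem_singleton_self x)
    refine ⟨a, (v.mem_A_iff _).2 fun R hR =>
      adjoin_le_valuationSubring (F := F) R ((v.mem_A_iff z).1 hzA R hR) a.2,
      fun h => ha0 (Subtype.ext h), (v.mem_A_iff _).2 fun R hR =>
      integral_mem_valuationSubring (F := F) R ((v.mem_A_iff z).1 hzA R hR) h1⟩

theorem exists_qInf_eq_pow (hK : IsGlobalFunctionField F K) :
    ∃ f : ℕ, f ≠ 0 ∧ v.qInf = Nat.card F ^ f := by
  have := hK.1
  let ψ : F →+* IsLocalRing.ResidueField v.ring := (IsLocalRing.residue v.ring).comp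
    ((algebraMap F K).codRestrict v.ring fun c => algebraMap_mem_valuationSubring v.ring c)
  let := ψ.toAlgebra
  have h : v.qInf = Nat.card F ^ Module.finrank F (IsLocalRing.ResidueField v.ring) :=
    Module.natCard_eq_pow_finrank
  refine ⟨_, fun h0 => ?_, h⟩
  rw [h0, pow_zero] at h
  exact v.one_lt_qInf.ne' h

end GlobalField

end Place

open scoped Classical

/-! ### Products of 1-units in ultrametric fields. -/

section Ultrametric

open Filter

variable {L : Type*} [NormedField L] [IsUltrametricDist L]

theorem norm_add_le_max' (x y : L) : ‖x + y‖ ≤ max ‖x‖ ‖y‖ := IsUltrametricDist.norm_add_le_max x y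

theorem norm_eq_of_norm_sub_lt {x y : L} (h : ‖x - y‖ < ‖y‖) : ‖x‖ = ‖y‖ := by
  have := IsUltrametricDist.norm_add_eq_max_of_norm_ne_norm h.ne
  rwa [sub_add_cancel, max_eq_right h.le] at this

theorem norm_eq_one_of_norm_sub_one_lt {x : L} (h : ‖x - 1‖ < 1) : ‖x‖ = 1 := by
  rw [← norm_one (α := L)] at h ⊢
  exact norm_eq_of_norm_sub_lt h

theorem norm_mul_sub_one_le {x y : L} {ε : ℝ} (hε : ε ≤ 1) (hx : ‖x - 1‖ ≤ ε) (hy : ‖y - 1‖ ≤ ε) :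
    ‖x * y - 1‖ ≤ ε := by
  have hy1 : ‖y‖ ≤ 1 := by
    have := norm_add_le_max' (y - 1) 1
    rw [sub_add_cancel, norm_one] at this
    exact this.trans (max_le (hy.trans hε) le_rfl)
  have e : x * y - 1 = (x - 1) * y + (y - 1) := by ring
  rw [e]
  refine (norm_add_le_max' _ _).trans (max_le ?_ hy)
  rw [norm_mul]
  exact (mul_le_of_le_one_right (norm_nonneg _) hy1).trans hx

theorem norm_prod_sub_one_le {ι : Type*} (s : Finset ι) (f : ι → L) {ε : ℝ} (h0 : 0 ≤ ε)
    (hε : ε ≤ 1) (h : ∀ i ∈ s, ‖f i - 1‖ ≤ ε) : ‖∏ i ∈ s, f i - 1‖ ≤ ε := by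
  induction s using Finset.cons_induction with
  | empty => simpa using h0
  | cons a s ha ih =>
    rw [Finset.prod_cons]
    exact norm_mul_sub_one_le hε (h a (Finset.mem_cons_self a s))
      (ih fun i hi => h i (Finset.mem_cons_of_mem hi))

theorem norm_pow_sub_one_le {x : L} {ε : ℝ} (h0 : 0 ≤ ε) (hε : ε ≤ 1) (h : ‖x - 1‖ ≤ ε) (n : ℕ) :
    ‖x ^ n - 1‖ ≤ ε := by
  simpa using norm_prod_sub_one_le (Finset.range n) (fun _ => x) h0 hε fun _ _ => h

theorem norm_inv_sub_one_le {x : L} {ε : ℝ} (hε : ε < 1) (h : ‖x - 1‖ ≤ ε) : ‖x⁻¹ - 1‖ ≤ ε := by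
  have h1 := norm_eq_one_of_norm_sub_one_lt (h.trans_lt hε)
  have h0 : x ≠ 0 := norm_ne_zero_iff.1 (by rw [h1]; exact one_ne_zero)
  have e : x⁻¹ - 1 = -(x - 1) * x⁻¹ := by
    field_simp
    ring
  rw [e, norm_mul, norm_neg, norm_inv, h1, inv_one, mul_one]
  exact h

/-- All but finitely many factors have norm one, so the finite products stay bounded, and a tail
product is as close to one as its worst factor. -/
theorem multipliable_of_tendsto_cofinite_one [CompleteSpace L] {ι : Type*} {f : ι → L}
    (hf : Tendsto f cofinite (𝓝 1)) : Multipliable f := by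
  classical
  have hfin : ∀ δ : ℝ, 0 < δ → {i | ¬ ‖f i - 1‖ < δ}.Finite := fun δ hδ => by
    have := (tendsto_iff_norm_sub_tendsto_zero.1 hf).eventually (gt_mem_nhds hδ)
    exact this
  let T := (hfin 1 one_pos).toFinset
  have hT : ∀ i, i ∉ T → ‖f i - 1‖ < 1 := fun i hi => by simpa [T] using hi
  have key : CauchySeq fun s : Finset ι => ∏ i ∈ s, f i := by
    rw [Metric.cauchySeq_iff']
    intro ε hε
    set B := ‖∏ i ∈ T, f i‖ with hB
    have hB0 : 0 ≤ B := norm_nonneg _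
    -- The summand one in `B + 1` covers the case of a vanishing factor, where `B = 0`.
    have hδ : 0 < min 1 (ε / (B + 1)) := by positivity
    let S := T ∪ (hfin _ hδ).toFinset
    have hS : ∀ i, i ∉ S → ‖f i - 1‖ ≤ min 1 (ε / (B + 1)) := fun i hi => by
      have : i ∉ (hfin _ hδ).toFinset := fun h => hi (Finset.mem_union_right _ h)
      rw [Set.Finite.mem_toFinset] at this
      exact (not_not.1 this).le
    have hSB : ‖∏ i ∈ S, f i‖ ≤ B := by
      rw [← Finset.prod_sdiff (Finset.subset_union_left : T ⊆ S), norm_mul, norm_prod]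
      refine mul_le_of_le_one_left hB0 (Finset.prod_le_one (fun _ _ => norm_nonneg _) fun i hi => ?_)
      exact (norm_eq_one_of_norm_sub_one_lt (hT i (Finset.mem_sdiff.1 hi).2)).le
    refine ⟨S, fun s hs => ?_⟩
    rw [dist_eq_norm, ← Finset.prod_sdiff hs, ← sub_one_mul, norm_mul]
    have h1 := norm_prod_sub_one_le (s \ S) f hδ.le (min_le_left _ _)
      fun i hi => hS i (Finset.mem_sdiff.1 hi).2
    calc _ ≤ ε / (B + 1) * B :=
          mul_le_mul (h1.trans (min_le_right _ _)) hSB (norm_nonneg _) (by positivity)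
      _ < ε / (B + 1) * (B + 1) := by
          apply mul_lt_mul_of_pos_left (lt_add_one B)
          positivity
      _ = ε := by field_simp
  obtain ⟨a, ha⟩ := cauchySeq_tendsto_of_complete key
  exact ⟨a, ha⟩

end Ultrametric

/-! ### Additive polynomials of finite subgroups. -/

section SubgroupPolynomial

variable {L : Type*} [Field L]

/-- The monic polynomial function `∏ (z + l)` of a finite set `B`. -/
def nodeProd (B : Finset L) (z : L) : L := ∏ l ∈ B, (z + l)

/-- The product of the nonzero elements of `B`. -/
def nonzeroProd (B : Finset L) : L := ∏ l ∈ B.erase 0, l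

/-- `B` is a subgroup of the additive group of `L`. -/
structure IsFinSubgroup (B : Finset L) : Prop where
  zero_mem : 0 ∈ B
  sub_mem : ∀ a ∈ B, ∀ b ∈ B, a - b ∈ B

variable {B : Finset L}

theorem IsFinSubgroup.neg_mem (hB : IsFinSubgroup B) {a : L} (ha : a ∈ B) : -a ∈ B := by
  rw [← zero_sub]
  exact hB.sub_mem _ hB.zero_mem _ ha

theorem IsFinSubgroup.add_mem (hB : IsFinSubgroup B) {a b : L} (ha : a ∈ B) (hb : b ∈ B) :
    a + b ∈ B := by
  rw [← sub_neg_eq_add]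
  exact hB.sub_mem _ ha _ (hB.neg_mem hb)

theorem nonzeroProd_ne_zero (B : Finset L) : nonzeroProd B ≠ 0 :=
  Finset.prod_ne_zero_iff.2 fun _ hl => Finset.ne_of_mem_erase hl

theorem IsFinSubgroup.nodeProd_add_mem (hB : IsFinSubgroup B) (z : L) {b : L} (hb : b ∈ B) :
    nodeProd B (z + b) = nodeProd B z := by
  refine Finset.prod_bij' (fun l _ => b + l) (fun l _ => l - b) ?_ ?_ ?_ ?_ ?_
  · exact fun l hl => hB.add_mem hb hl
  · exact fun l hl => hB.sub_mem _ hl _ hb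
  · exact fun l _ => add_sub_cancel_left b l
  · exact fun l _ => add_sub_cancel b l
  · exact fun l _ => add_assoc z b l

theorem IsFinSubgroup.nodeProd_eq_zero (hB : IsFinSubgroup B) {b : L} (hb : b ∈ B) :
    nodeProd B b = 0 :=
  Finset.prod_eq_zero (hB.neg_mem hb) (add_neg_cancel b)

/-- For fixed `y`, the polynomial `f(X + y) - f(X) - f(y)` has degree below `|B|`, since the leading
terms cancel, and vanishes on all of `B`. -/
theorem IsFinSubgroup.nodeProd_add (hB : IsFinSubgroup B) (x y : L) :
    nodeProd B (x + y) = nodeProd B x + nodeProd B y := by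
  open Polynomial in
  let f : L[X] := ∏ l ∈ B, (X + C l)
  have hf : ∀ z, f.eval z = nodeProd B z := fun z => by
    simp [f, eval_prod, nodeProd]
  have hmonic : f.Monic := monic_prod_of_monic _ _ fun l _ => monic_X_add_C l
  have hdeg : f.natDegree = B.card := by
    rw [natDegree_prod_of_monic _ _ fun l _ => monic_X_add_C l]
    simp
  let g : L[X] := f.comp (X + C y)
  have hgm : g.Monic := hmonic.comp_X_add_C y
  have hgdeg : g.natDegree = B.card := by
    rw [natDegree_comp, natDegree_X_add_C, mul_one, hdeg]
  have hcard : 0 < B.card := Finset.card_pos.2 ⟨0, hB.zero_mem⟩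
  have hzero : g - f - C (nodeProd B y) = 0 := by
    refine eq_zero_of_natDegree_lt_card_of_eval_eq_zero' _ B (fun b hb => ?_) ?_
    · rw [eval_sub, eval_sub, eval_comp, hf, eval_C]
      simp only [eval_add, eval_X, eval_C]
      rw [hf, hB.nodeProd_eq_zero hb, add_comm b y, hB.nodeProd_add_mem y hb, sub_zero, sub_self]
    · have h1 : (g - f).degree < g.degree := by
        refine degree_sub_lt_left ?_ hgm.ne_zero ?_
        · rw [degree_eq_natDegree hgm.ne_zero, degree_eq_natDegree hmonic.ne_zero, hgdeg, hdeg]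
        · rw [hgm.leadingCoeff, hmonic.leadingCoeff]
      have h2 : (g - f).natDegree < B.card := by
        by_cases h0 : g - f = 0
        · rw [h0, natDegree_zero]
          exact hcard
        · rw [← hgdeg]
          exact natDegree_lt_natDegree h0 h1
      rwa [natDegree_sub_C]
  have := congrArg (eval x) hzero
  rw [eval_sub, eval_sub, eval_comp, eval_C, eval_zero] at this
  simp only [eval_add, eval_X, eval_C] at this
  rw [hf, hf] at this
  linear_combination this

theorem IsFinSubgroup.prod_erase_neg (hB : IsFinSubgroup B) (g : L → L) :
    ∏ l ∈ B.erase 0, g (-l) = ∏ l ∈ B.erase 0, g l := by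
  have h : ∀ l ∈ B.erase 0, -l ∈ B.erase 0 := fun l hl =>
    Finset.mem_erase.2 ⟨neg_ne_zero.2 (Finset.ne_of_mem_erase hl),
      hB.neg_mem (Finset.mem_of_mem_erase hl)⟩
  exact Finset.prod_bij' (fun l _ => -l) (fun l _ => -l) h h (fun l _ => neg_neg l)
    (fun l _ => neg_neg l) fun _ _ => rfl

/-- The finite product `z ∏ (1 - z / l)` over the nonzero `l ∈ B`. -/
def truncExp (B : Finset L) (z : L) : L := z * ∏ l ∈ B.erase 0, (1 - z / l)

theorem IsFinSubgroup.truncExp_eq (hB : IsFinSubgroup B) (z : L) :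
    truncExp B z = nodeProd B z / nonzeroProd B := by
  have h := hB.prod_erase_neg fun l => 1 - z / l
  rw [eq_div_iff (nonzeroProd_ne_zero B), truncExp, ← h, nonzeroProd, nodeProd, mul_assoc,
    ← Finset.prod_mul_distrib, ← Finset.mul_prod_erase B _ hB.zero_mem, add_zero]
  congr 1
  refine Finset.prod_congr rfl fun l hl => ?_
  have := Finset.ne_of_mem_erase hl
  field_simp
  ring

end SubgroupPolynomial

/-! ### Exponential functions of discrete subgroups. -/

section Filtration

open Filter

variable (L : Type*) [NormedField L]

/-- A discrete subgroup of `L`, presented as the union of an increasing family of finite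
subgroups. -/
structure LatticeFiltration where
  ball : ℝ → Finset L
  isFinSubgroup : ∀ R, IsFinSubgroup (ball R)
  mono : Monotone ball
  growth : ∀ M : ℝ, ∃ R₀, ∀ R, ∀ l ∈ ball R, l ∉ ball R₀ → M ≤ ‖l‖

namespace LatticeFiltration

variable {L} (Λ : LatticeFiltration L)

/-- The discrete subgroup given by a filtration. -/
def carrier : Set L := {l | ∃ R, l ∈ Λ.ball R}

/-- The exponential function of a discrete subgroup. -/
def exp (z : L) : L := z * ∏' l : {l : L // l ∈ Λ.carrier ∧ l ≠ 0}, (1 - z / l.1)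

theorem exists_norm_lt (z : L) : ∃ R₀, ∃ M : ℝ, ‖z‖ < M ∧
    ∀ R, ∀ l ∈ Λ.ball R, l ∉ Λ.ball R₀ → M ≤ ‖l‖ := by
  obtain ⟨R₀, h⟩ := Λ.growth (‖z‖ + 1)
  exact ⟨R₀, ‖z‖ + 1, lt_add_one _, h⟩

theorem norm_div_le {z l : L} {M : ℝ} (hz : ‖z‖ < M) (hl : M ≤ ‖l‖) :
    ‖(1 - z / l) - 1‖ ≤ ‖z‖ / M := by
  rw [sub_sub_cancel_left, norm_neg, norm_div]
  exact div_le_div_of_nonneg_left (norm_nonneg z) ((norm_nonneg z).trans_lt hz) hl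

theorem truncExp_factor {R R' : ℝ} (h : R ≤ R') (z : L) :
    truncExp (Λ.ball R') z = truncExp (Λ.ball R) z * ∏ l ∈ Λ.ball R' \ Λ.ball R, (1 - z / l) := by
  have e : (Λ.ball R').erase 0 \ (Λ.ball R).erase 0 = Λ.ball R' \ Λ.ball R := by
    ext l
    simp only [Finset.mem_sdiff, Finset.mem_erase]
    refine ⟨fun h => ⟨h.1.2, fun h' => h.2 ⟨h.1.1, h'⟩⟩, fun h => ⟨⟨?_, h.1⟩, fun h' => h.2 h'.2⟩⟩
    rintro rfl
    exact h.2 (Λ.isFinSubgroup R).zero_mem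
  rw [truncExp, truncExp, ← Finset.prod_sdiff (Finset.erase_subset_erase 0 (Λ.mono h)), e]
  ring

/-- Each additional factor is within `‖z‖ / M` of one. The relative form of the error controls the
zeros of the limit and, later, convergence of inverses. -/
theorem norm_truncExp_sub_le [IsUltrametricDist L] {R R' M : ℝ} (h : R ≤ R') {z : L} (hz : ‖z‖ < M)
    (hM : ∀ R', ∀ l ∈ Λ.ball R', l ∉ Λ.ball R → M ≤ ‖l‖) :
    ‖truncExp (Λ.ball R') z - truncExp (Λ.ball R) z‖ ≤ ‖z‖ / M * ‖truncExp (Λ.ball R) z‖ := by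
  have hM0 : 0 < M := (norm_nonneg z).trans_lt hz
  rw [truncExp_factor Λ h, ← mul_sub_one, norm_mul, mul_comm]
  refine mul_le_mul_of_nonneg_right ?_ (norm_nonneg _)
  refine norm_prod_sub_one_le _ _ (by positivity) ((div_le_one hM0).2 hz.le) fun l hl => ?_
  exact norm_div_le hz (hM R' l (Finset.mem_sdiff.1 hl).1 (Finset.mem_sdiff.1 hl).2)

/-- Since the factors tend to one, the unordered product converges and may be evaluated along the
exhausting balls. -/
theorem tendsto_truncExp [IsUltrametricDist L] [CompleteSpace L] (z : L) :
    Tendsto (fun R => truncExp (Λ.ball R) z) atTop (𝓝 (Λ.exp z)) := by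
  have hmul : Multipliable fun l : {l : L // l ∈ Λ.carrier ∧ l ≠ 0} => 1 - z / l.1 := by
    apply multipliable_of_tendsto_cofinite_one
    rw [tendsto_iff_norm_sub_tendsto_zero]
    refine Metric.tendsto_nhds.2 fun ε hε => ?_
    obtain ⟨R₀, hR₀⟩ := Λ.growth ((‖z‖ + 1) / ε)
    rw [eventually_cofinite]
    refine Set.Finite.subset ((Λ.ball R₀).finite_toSet.preimage Subtype.val_injective.injOn)
      fun l hl => ?_
    by_contra hl'
    obtain ⟨R, hR⟩ := l.2.1
    apply hl
    rw [dist_zero_right, norm_norm, sub_sub_cancel_left, norm_neg, norm_div,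
      div_lt_iff₀ (norm_pos_iff.2 l.2.2)]
    have h1 := hR₀ R l.1 hR hl'
    rw [div_le_iff₀ hε] at h1
    linarith
  have h1 : Tendsto (fun s : Finset {l : L // l ∈ Λ.carrier ∧ l ≠ 0} => ∏ l ∈ s, (1 - z / l.1))
      atTop (𝓝 (∏' l : {l : L // l ∈ Λ.carrier ∧ l ≠ 0}, (1 - z / l.1))) := hmul.hasProd
  let S : ℝ → Finset {l : L // l ∈ Λ.carrier ∧ l ≠ 0} := fun R =>
    Finset.subtype _ ((Λ.ball R).erase 0)
  have hS : Tendsto S atTop atTop := by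
    refine tendsto_atTop_finset_of_monotone (fun R R' h l hl => ?_) fun l => ?_
    · rw [Finset.mem_subtype] at hl ⊢
      exact Finset.erase_subset_erase 0 (Λ.mono h) hl
    · obtain ⟨R, hR⟩ := l.2.1
      exact ⟨R, Finset.mem_subtype.2 (Finset.mem_erase.2 ⟨l.2.2, hR⟩)⟩
  have h2 : Tendsto (fun R => ∏ l ∈ S R, (1 - z / l.1)) atTop
      (𝓝 (∏' l : {l : L // l ∈ Λ.carrier ∧ l ≠ 0}, (1 - z / l.1))) := h1.comp hS
  refine (h2.const_mul z).congr fun R => ?_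
  rw [truncExp]
  congr 1
  refine Finset.prod_subtype_of_mem (fun l => 1 - z / l) fun l hl => ?_
  exact ⟨⟨R, Finset.mem_of_mem_erase hl⟩, Finset.ne_of_mem_erase hl⟩

variable [IsUltrametricDist L] [CompleteSpace L]

theorem norm_exp_sub_truncExp_le {R M : ℝ} {z : L} (hz : ‖z‖ < M)
    (hM : ∀ R', ∀ l ∈ Λ.ball R', l ∉ Λ.ball R → M ≤ ‖l‖) :
    ‖Λ.exp z - truncExp (Λ.ball R) z‖ ≤ ‖z‖ / M * ‖truncExp (Λ.ball R) z‖ :=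
  le_of_tendsto ((Λ.tendsto_truncExp z).sub_const _).norm
    (eventually_atTop.2 ⟨R, fun _ h => Λ.norm_truncExp_sub_le h hz hM⟩)

theorem tendsto_nodeProd_div (z : L) :
    Tendsto (fun R => nodeProd (Λ.ball R) z / nonzeroProd (Λ.ball R)) atTop (𝓝 (Λ.exp z)) :=
  (Λ.tendsto_truncExp z).congr fun R => (Λ.isFinSubgroup R).truncExp_eq z

theorem exp_add (x y : L) : Λ.exp (x + y) = Λ.exp x + Λ.exp y := by
  refine tendsto_nhds_unique (Λ.tendsto_nodeProd_div (x + y)) ?_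
  refine ((Λ.tendsto_nodeProd_div x).add (Λ.tendsto_nodeProd_div y)).congr fun R => ?_
  rw [(Λ.isFinSubgroup R).nodeProd_add, add_div]

/-- The relative error is below one for a large ball, so a zero of the limit is already a zero of
the finite product. -/
theorem exp_eq_zero_iff (z : L) : Λ.exp z = 0 ↔ z ∈ Λ.carrier := by
  constructor
  · intro h
    by_contra hz
    obtain ⟨R, M, hzM, hM⟩ := Λ.exists_norm_lt z
    have hM0 : 0 < M := (norm_nonneg z).trans_lt hzM
    have h1 := Λ.norm_exp_sub_truncExp_le hzM hM
    rw [h, zero_sub, norm_neg] at h1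
    have h2 : truncExp (Λ.ball R) z = 0 := by
      by_contra hne
      have := (le_mul_iff_one_le_left (norm_pos_iff.2 hne)).1 h1
      exact absurd ((div_lt_one hM0).2 hzM) (not_lt.2 this)
    rw [truncExp, mul_eq_zero, Finset.prod_eq_zero_iff] at h2
    rcases h2 with rfl | ⟨l, hl, h2⟩
    · exact hz ⟨R, (Λ.isFinSubgroup R).zero_mem⟩
    · rw [sub_eq_zero, eq_comm, div_eq_one_iff_eq (Finset.ne_of_mem_erase hl)] at h2
      exact hz ⟨R, h2 ▸ Finset.mem_of_mem_erase hl⟩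
  · rintro ⟨R, hR⟩
    refine tendsto_nhds_unique (Λ.tendsto_nodeProd_div z) ?_
    refine tendsto_const_nhds.congr' (eventually_atTop.2 ⟨R, fun R' h => ?_⟩)
    simp only [(Λ.isFinSubgroup R').nodeProd_eq_zero (Λ.mono h hR), zero_div]

theorem exp_add_mem (z : L) {l : L} (hl : l ∈ Λ.carrier) : Λ.exp (z + l) = Λ.exp z := by
  rw [exp_add, (Λ.exp_eq_zero_iff l).2 hl, add_zero]

theorem exp_neg (z : L) : Λ.exp (-z) = -Λ.exp z := by
  have h := Λ.exp_add z (-z)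
  rw [add_neg_cancel, (Λ.exp_eq_zero_iff 0).2 ⟨0, (Λ.isFinSubgroup 0).zero_mem⟩] at h
  linear_combination -h

end LatticeFiltration

end Filtration

namespace Place

variable {K : Type*} [Field K] (v : Place K)

/-! ### Norms on `K^r` and the pairing with points of `Ψ`. -/

section Norms

theorem isUltrametricDist_KinfAlg : IsUltrametricDist v.KinfAlg :=
  IsUltrametricDist.isUltrametricDist_of_forall_norm_add_le_max_norm fun x y =>
    isNonarchimedean_spectralNorm (K := v.Kinf) (L := v.KinfAlg) x y

instance ultrametricCinf : IsUltrametricDist v.Cinf := by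
  have := v.isUltrametricDist_KinfAlg
  refine IsUltrametricDist.isUltrametricDist_of_forall_norm_add_le_max_norm fun x y => ?_
  refine UniformSpace.Completion.induction_on₂ x y ?_ ?_
  · exact isClosed_le (by fun_prop) (by fun_prop)
  · intro a b
    rw [← UniformSpace.Completion.coe_add, UniformSpace.Completion.norm_coe,
      UniformSpace.Completion.norm_coe, UniformSpace.Completion.norm_coe]
    exact IsUltrametricDist.norm_add_le_max a b

theorem norm_KinfToCinf (x : v.Kinf) : ‖v.KinfToCinf x‖ = ‖x‖ :=
  norm_algebraMap' v.Cinf x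

theorem norm_toCinf (x : K) : ‖v.toCinf x‖ = v.abv x := by
  rw [toCinf, RingHom.comp_apply, norm_KinfToCinf, norm_toKinf]

variable {r : ℕ}

/-- The image of `x ∈ K ^ r` in `K_∞ ^ r`. -/
def vecToKinf (x : Fin r → K) : Fin r → v.Kinf := fun i => v.toKinf (x i)

/-- The maximum norm on `K ^ r`. -/
def maxNorm (x : Fin r → K) : ℝ := ‖v.vecToKinf x‖

theorem maxNorm_nonneg (x : Fin r → K) : 0 ≤ v.maxNorm x := norm_nonneg _

theorem maxNorm_le_iff {x : Fin r → K} {R : ℝ} (hR : 0 ≤ R) :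
    v.maxNorm x ≤ R ↔ ∀ i, v.abv (x i) ≤ R := by
  rw [maxNorm, pi_norm_le_iff_of_nonneg hR]
  exact forall_congr' fun i => by rw [vecToKinf, norm_toKinf]

theorem abv_le_maxNorm (x : Fin r → K) (i : Fin r) : v.abv (x i) ≤ v.maxNorm x :=
  (v.maxNorm_le_iff (v.maxNorm_nonneg x)).1 le_rfl i

@[simp]
theorem maxNorm_zero : v.maxNorm (0 : Fin r → K) = 0 :=
  le_antisymm ((v.maxNorm_le_iff le_rfl).2 fun i => by simp) (v.maxNorm_nonneg _)

theorem maxNorm_pos {x : Fin r → K} (hx : x ≠ 0) : 0 < v.maxNorm x := by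
  obtain ⟨i, hi⟩ := Function.ne_iff.1 hx
  exact (v.abv.pos hi).trans_le (v.abv_le_maxNorm x i)

theorem maxNorm_add_le_max (x y : Fin r → K) :
    v.maxNorm (x + y) ≤ max (v.maxNorm x) (v.maxNorm y) :=
  (v.maxNorm_le_iff (le_max_of_le_left (v.maxNorm_nonneg x))).2 fun i =>
    (v.abv_add_le_max _ _).trans (max_le_max (v.abv_le_maxNorm x i) (v.abv_le_maxNorm y i))

@[simp]
theorem maxNorm_neg (x : Fin r → K) : v.maxNorm (-x) = v.maxNorm x :=
  le_antisymm ((v.maxNorm_le_iff (v.maxNorm_nonneg x)).2 fun i => by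
      simpa using v.abv_le_maxNorm x i)
    ((v.maxNorm_le_iff (v.maxNorm_nonneg _)).2 fun i => by simpa using v.abv_le_maxNorm (-x) i)

theorem maxNorm_sub_le_max (x y : Fin r → K) :
    v.maxNorm (x - y) ≤ max (v.maxNorm x) (v.maxNorm y) := by
  rw [sub_eq_add_neg, ← v.maxNorm_neg y]
  exact v.maxNorm_add_le_max x (-y)

theorem exists_abv_eq_maxNorm {x : Fin r → K} (hx : x ≠ 0) : ∃ i, v.abv (x i) = v.maxNorm x := by
  have : Nonempty (Fin r) := by
    by_contra h
    rw [not_nonempty_iff] at h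
    exact hx (Subsingleton.elim _ _)
  obtain ⟨i, hi⟩ := Finite.exists_max fun i => v.abv (x i)
  exact ⟨i, le_antisymm (v.abv_le_maxNorm x i)
    ((v.maxNorm_le_iff (v.abv.nonneg _)).2 hi)⟩

theorem maxNorm_smul (a : K) (x : Fin r → K) : v.maxNorm (a • x) = v.abv a * v.maxNorm x := by
  have h : ∀ (a : K) (x : Fin r → K), v.maxNorm (a • x) ≤ v.abv a * v.maxNorm x := fun a x =>
    (v.maxNorm_le_iff (mul_nonneg (v.abv.nonneg a) (v.maxNorm_nonneg x))).2 fun i => by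
      rw [Pi.smul_apply, smul_eq_mul, map_mul]
      exact mul_le_mul_of_nonneg_left (v.abv_le_maxNorm x i) (v.abv.nonneg a)
  refine le_antisymm (h a x) ?_
  by_cases ha : a = 0
  · simp [ha]
  have h1 := h a⁻¹ (a • x)
  rw [inv_smul_smul₀ ha, map_inv₀] at h1
  exact (le_inv_mul_iff₀ (v.abv.pos ha)).1 h1

/-! ### The pairing -/

theorem pair_add (x y : Fin r → K) (ω : Fin r → v.Cinf) :
    v.pair (x + y) ω = v.pair x ω + v.pair y ω := by
  simp [pair, add_mul, Finset.sum_add_distrib]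

theorem pair_smul (a : K) (x : Fin r → K) (ω : Fin r → v.Cinf) :
    v.pair (a • x) ω = v.toCinf a * v.pair x ω := by
  simp [pair, Finset.mul_sum, mul_assoc]

theorem pair_sub (x y : Fin r → K) (ω : Fin r → v.Cinf) :
    v.pair (x - y) ω = v.pair x ω - v.pair y ω := by
  simp [pair, sub_mul, Finset.sum_sub_distrib]

@[simp]
theorem pair_zero (ω : Fin r → v.Cinf) : v.pair 0 ω = 0 := by simp [pair]

theorem pair_eq_pairInf (x : Fin r → K) (ω : Fin r → v.Cinf) :
    v.pair x ω = v.pairInf (v.vecToKinf x) ω := rfl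

/-- Dividing `x` by a coordinate of largest absolute value gives norm one, where the defining
inequality of `Ψ_n` applies. -/
theorem le_norm_pair {n : ℕ} {ω : v.Psi r} (hω : ω ∈ v.PsiAff r n) (x : Fin r → K) :
    ((v.qInf : ℝ) ^ n)⁻¹ * v.maxNorm x ≤ ‖v.pair x ω.1‖ := by
  by_cases hx : x = 0
  · simp [hx]
  obtain ⟨i, hi⟩ := v.exists_abv_eq_maxNorm hx
  have h0 : x i ≠ 0 := fun h => by
    rw [h, map_zero] at hi
    exact (v.maxNorm_pos hx).ne hi
  have h1 : v.maxNorm ((x i)⁻¹ • x) = 1 := by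
    rw [maxNorm_smul, map_inv₀, hi, inv_mul_cancel₀ (v.maxNorm_pos hx).ne']
  have h2 := hω.2 (v.vecToKinf ((x i)⁻¹ • x)) h1
  rw [← pair_eq_pairInf, pair_smul, norm_mul, norm_toCinf, map_inv₀, hi] at h2
  rwa [inv_mul_eq_div, le_div_iff₀ (v.maxNorm_pos hx)] at h2

theorem norm_sum_le_of_forall_le {ι : Type*} (s : Finset ι) (f : ι → v.Cinf) {C : ℝ} (hC : 0 ≤ C)
    (h : ∀ i ∈ s, ‖f i‖ ≤ C) : ‖∑ i ∈ s, f i‖ ≤ C :=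
  IsUltrametricDist.norm_sum_le_of_forall_le_of_nonneg hC h

theorem norm_pair_le {n : ℕ} {ω : v.Psi r} (hω : ω ∈ v.PsiAff r n) (x : Fin r → K) :
    ‖v.pair x ω.1‖ ≤ (v.qInf : ℝ) ^ n * v.maxNorm x := by
  refine v.norm_sum_le_of_forall_le _ _ (mul_nonneg (by positivity) (v.maxNorm_nonneg x))
    fun i _ => ?_
  rw [norm_mul, norm_toCinf, mul_comm]
  exact mul_le_mul (hω.1 i) (v.abv_le_maxNorm x i) (v.abv.nonneg _) (by positivity)

/-- An injective linear map on a finite-dimensional space over the complete field `K_∞` is bounded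
below. -/
theorem exists_mem_PsiAff (ω : v.Psi r) : ∃ n, ω ∈ v.PsiAff r n := by
  let f : (Fin r → v.Kinf) →ₗ[v.Kinf] v.Cinf :=
    { toFun := fun x => v.pairInf x ω.1
      map_add' := fun x y => by simp [pairInf, add_mul, Finset.sum_add_distrib]
      map_smul' := fun a x => by
        refine Eq.trans ?_ (Algebra.smul_def a (v.pairInf x ω.1)).symm
        change v.pairInf (a • x) ω.1 = v.KinfToCinf a * v.pairInf x ω.1
        simp only [pairInf, Pi.smul_apply, smul_eq_mul, map_mul, Finset.mul_sum, mul_assoc] }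
  have hf : f.ker = ⊥ := LinearMap.ker_eq_bot'.2 ω.2
  obtain ⟨C, hC, h⟩ := f.exists_antilipschitzWith hf
  obtain ⟨B, hB⟩ := (Set.finite_range fun i => ‖ω.1 i‖).bddAbove
  obtain ⟨n, hn⟩ := pow_unbounded_of_one_lt (max B C) v.one_lt_qInf_real
  refine ⟨n, fun i => (hB ⟨i, rfl⟩).trans ((le_max_left _ _).trans hn.le), fun x hx => ?_⟩
  have h1 := h.le_mul_norm (x := x) (map_zero f)
  rw [hx] at h1
  have h2 : ‖v.pairInf x ω.1‖ = ‖f x‖ := rfl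
  rw [h2, inv_le_iff_one_le_mul₀ (pow_pos v.qInf_pos_real _)]
  refine h1.trans ?_
  rw [mul_comm]
  exact mul_le_mul_of_nonneg_left ((le_max_right _ _).trans hn.le) (norm_nonneg _)

theorem pair_eq_zero_iff (ω : v.Psi r) (x : Fin r → K) : v.pair x ω.1 = 0 ↔ x = 0 := by
  constructor
  · intro h
    obtain ⟨n, hn⟩ := v.exists_mem_PsiAff ω
    have h1 := v.le_norm_pair hn x
    by_contra hx
    rw [h, norm_zero] at h1
    exact absurd h1 (not_le.2 (mul_pos (inv_pos.2 (pow_pos v.qInf_pos_real _)) (v.maxNorm_pos hx)))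
  · rintro rfl
    exact v.pair_zero _

theorem pair_injective (ω : v.Psi r) : Function.Injective fun x : Fin r → K => v.pair x ω.1 :=
  fun x y h => by
    have h' : v.pair x ω.1 = v.pair y ω.1 := h
    rw [← sub_eq_zero, ← pair_sub, pair_eq_zero_iff, sub_eq_zero] at h'
    exact h'

end Norms

/-! ### Lattices are discrete and cocompact; counting points in balls. -/

section Lattices

variable {r : ℕ} {v}

theorem IsDiscreteCocompact.exists_common_denominator (hv : v.IsDiscreteCocompact) (T : Finset K) :
    ∃ c ∈ v.A, c ≠ 0 ∧ ∀ x ∈ T, c * x ∈ v.A := by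
  induction T using Finset.induction_on with
  | empty => exact ⟨1, one_mem _, one_ne_zero, by simp⟩
  | insert y T _ ih =>
    obtain ⟨c, hc, hc0, h⟩ := ih
    obtain ⟨d, hd, hd0, h'⟩ := hv.exists_mul_mem y
    refine ⟨c * d, mul_mem hc hd, mul_ne_zero hc0 hd0, fun x hx => ?_⟩
    rcases Finset.mem_insert.1 hx with rfl | hx
    · rw [mul_assoc]
      exact mul_mem hc h'
    · rw [mul_comm c, mul_assoc]
      exact mul_mem hd (h x hx)

/-- A common denominator of the generators carries `Y` into `A^r`, where balls are finite. -/
theorem IsDiscreteCocompact.finite_latticeBall (hv : v.IsDiscreteCocompact) (Y : v.Lattice r)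
    (R : ℝ) : {y : Fin r → K | y ∈ Y.1 ∧ v.maxNorm y ≤ R}.Finite := by
  obtain ⟨S, hS⟩ := Y.2.1
  obtain ⟨c, hcA, hc0, hc⟩ := hv.exists_common_denominator
    ((S ×ˢ Finset.univ).image fun p : (Fin r → K) × Fin r => p.1 p.2)
  have hY : ∀ y ∈ Y.1, ∀ i, c * y i ∈ v.A := by
    intro y hy
    rw [← hS] at hy
    induction hy using Submodule.span_induction with
    | mem x h => exact fun i => hc _ (Finset.mem_image.2 ⟨(x, i), by simpa using h, rfl⟩)
    | zero => intro i; simp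
    | add x y _ _ hx hy => intro i; rw [Pi.add_apply, mul_add]; exact add_mem (hx i) (hy i)
    | smul a x _ hx =>
      intro i
      have : c * (a • x) i = a * (c * x i) := by
        rw [Pi.smul_apply, Subring.smul_def, smul_eq_mul]
        ring
      rw [this]
      exact mul_mem a.2 (hx i)
  refine Set.Finite.of_finite_image (f := fun y => c • y) ?_ (smul_right_injective _ hc0).injOn
  refine Set.Finite.subset (Set.Finite.pi' fun _ : Fin r => hv.finite_ball (v.abv c * R)) ?_
  rintro _ ⟨y, hy, rfl⟩ i
  refine ⟨hY y hy.1 i, ?_⟩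
  change v.abv (c * y i) ≤ _
  rw [map_mul]
  exact mul_le_mul_of_nonneg_left ((v.abv_le_maxNorm y i).trans hy.2) (v.abv.nonneg c)

/-- Call a vector good if its `K`-multiples lie within bounded distance of `Y`. Elements of `Y` are
good because `A` is cocompact, and goodness passes to sums and scalar multiples, hence to the
standard basis. -/
theorem IsDiscreteCocompact.exists_maxNorm_sub_le (hv : v.IsDiscreteCocompact) (Y : v.Lattice r) :
    ∃ ρ : ℝ, ∀ x : Fin r → K, ∃ y ∈ Y.1, v.maxNorm (x - y) ≤ ρ := by
  obtain ⟨ρ, hρ⟩ := hv.exists_abv_sub_le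
  have h : ∀ x : Fin r → K, ∃ ρ' : ℝ, ∀ k : K, ∃ y ∈ Y.1, v.maxNorm (k • x - y) ≤ ρ' := by
    intro x
    have hx : x ∈ Submodule.span K (Y.1 : Set (Fin r → K)) := by
      rw [Y.2.2]
      exact Submodule.mem_top
    induction hx using Submodule.span_induction with
    | mem x h =>
      refine ⟨ρ * v.maxNorm x, fun k => ?_⟩
      obtain ⟨a, ha, hk⟩ := hρ k
      refine ⟨(⟨a, ha⟩ : v.A) • x, Y.1.smul_mem _ h, ?_⟩
      rw [Subring.smul_def, ← sub_smul, maxNorm_smul]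
      exact mul_le_mul_of_nonneg_right hk (v.maxNorm_nonneg x)
    | zero => exact ⟨0, fun k => ⟨0, Y.1.zero_mem, by simp⟩⟩
    | add x y _ _ hx hy =>
      obtain ⟨ρ₁, h₁⟩ := hx
      obtain ⟨ρ₂, h₂⟩ := hy
      refine ⟨max ρ₁ ρ₂, fun k => ?_⟩
      obtain ⟨y₁, hy₁, e₁⟩ := h₁ k
      obtain ⟨y₂, hy₂, e₂⟩ := h₂ k
      refine ⟨y₁ + y₂, add_mem hy₁ hy₂, ?_⟩
      rw [smul_add, add_sub_add_comm]
      exact (v.maxNorm_add_le_max _ _).trans (max_le_max e₁ e₂)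
    | smul a x _ hx =>
      obtain ⟨ρ₁, h₁⟩ := hx
      refine ⟨ρ₁, fun k => ?_⟩
      rw [smul_smul]
      exact h₁ (k * a)
  choose ρ' hρ' using fun i : Fin r => h (Pi.single i 1)
  obtain ⟨B, hB⟩ := (Set.finite_range ρ').bddAbove
  refine ⟨max B 0, fun x => ?_⟩
  choose y hy e using fun i => hρ' i (x i)
  refine ⟨∑ i, y i, sum_mem fun i _ => hy i, (v.maxNorm_le_iff (le_max_right _ _)).2 fun j => ?_⟩
  have hx : x - ∑ i, y i = ∑ i, (x i • (Pi.single i 1 : Fin r → K) - y i) := by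
    rw [Finset.sum_sub_distrib]
    congr 1
    exact pi_eq_sum_univ' x |>.trans (Finset.sum_congr rfl fun i _ => by ext k; simp [Pi.single_apply])
  have hle : ∀ s : Finset (Fin r),
      v.maxNorm (∑ i ∈ s, (x i • (Pi.single i 1 : Fin r → K) - y i)) ≤ max B 0 := by
    intro s
    induction s using Finset.cons_induction with
    | empty => simp
    | cons a s ha ih =>
      rw [Finset.sum_cons]
      exact (v.maxNorm_add_le_max _ _).trans
        (max_le ((e a).trans (le_max_of_le_left (hB ⟨a, rfl⟩))) ih)
  rw [hx]
  exact (v.abv_le_maxNorm _ j).trans (hle _)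

variable (v) in
/-- The elements of the lattice `Y` of norm at most `R`. -/
def latticeBall (Y : v.Lattice r) (R : ℝ) : Finset (Fin r → K) :=
  if h : {y : Fin r → K | y ∈ Y.1 ∧ v.maxNorm y ≤ R}.Finite then h.toFinset else ∅

theorem IsDiscreteCocompact.mem_latticeBall (hv : v.IsDiscreteCocompact) {Y : v.Lattice r} {R : ℝ}
    {y : Fin r → K} : y ∈ v.latticeBall Y R ↔ y ∈ Y.1 ∧ v.maxNorm y ≤ R := by
  rw [latticeBall, dif_pos (hv.finite_latticeBall Y R), Set.Finite.mem_toFinset, Set.mem_ofPred_eq]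

/-- Reducing `π^{j+1} y` modulo the maximal ideal maps the larger ball to the `r`-th power of the
residue field. Its nonempty fibres are translates of the smaller ball, and it is surjective once
`q_∞^j` exceeds the cocompactness radius. -/
theorem IsDiscreteCocompact.card_latticeBall_succ (hv : v.IsDiscreteCocompact) (Y : v.Lattice r) :
    ∃ J : ℕ, ∀ j ≥ J, (v.latticeBall Y ((v.qInf : ℝ) ^ (j + 1))).card =
      v.qInf ^ r * (v.latticeBall Y ((v.qInf : ℝ) ^ j)).card := by
  obtain ⟨ρ, hρ⟩ := hv.exists_maxNorm_sub_le Y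
  obtain ⟨J, hJ⟩ := pow_unbounded_of_one_lt ρ v.one_lt_qInf_real
  refine ⟨J, fun j hj => ?_⟩
  have hq := v.qInf_pos_real
  have hρj : ρ ≤ (v.qInf : ℝ) ^ j :=
    hJ.le.trans (pow_le_pow_right₀ v.one_lt_qInf_real.le hj)
  have hjj : (v.qInf : ℝ) ^ j ≤ (v.qInf : ℝ) ^ (j + 1) :=
    pow_le_pow_right₀ v.one_lt_qInf_real.le j.le_succ
  have hmem : ∀ x : K, x * v.π ^ (j + 1) ∈ v.ring ↔ v.abv x ≤ (v.qInf : ℝ) ^ (j + 1) := fun x => by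
    rw [v.mem_ring_iff, map_mul, map_pow, abv_π, inv_pow, mul_inv_le_iff₀ (pow_pos hq _), one_mul]
  let f : (Fin r → K) → Fin r → IsLocalRing.ResidueField v.ring := fun y i =>
    if h : y i * v.π ^ (j + 1) ∈ v.ring then IsLocalRing.residue v.ring ⟨_, h⟩ else 0
  have hf : ∀ x y : Fin r → K, v.maxNorm x ≤ (v.qInf : ℝ) ^ (j + 1) →
      v.maxNorm y ≤ (v.qInf : ℝ) ^ (j + 1) →
      (f x = f y ↔ v.maxNorm (x - y) ≤ (v.qInf : ℝ) ^ j) := by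
    intro x y hx hy
    rw [maxNorm_le_iff _ (by positivity), funext_iff]
    refine forall_congr' fun i => ?_
    have hxi := (hmem (x i)).2 ((v.abv_le_maxNorm x i).trans hx)
    have hyi := (hmem (y i)).2 ((v.abv_le_maxNorm y i).trans hy)
    simp only [f, dif_pos hxi, dif_pos hyi]
    rw [← sub_eq_zero, ← map_sub, residue_eq_zero_iff]
    have e : ((⟨x i * v.π ^ (j + 1), hxi⟩ - ⟨y i * v.π ^ (j + 1), hyi⟩ : v.ring) : K)
        = (x - y) i * v.π ^ (j + 1) := by
      rw [Pi.sub_apply, sub_mul]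
      rfl
    rw [e, map_mul, map_pow, abv_π, inv_pow, mul_inv_lt_iff₀ (pow_pos hq _), one_mul]
    exact_mod_cast v.abv_lt_zpow_succ_iff (x := (x - y) i) j
  have hsurj : ∀ w, ∃ y ∈ v.latticeBall Y ((v.qInf : ℝ) ^ (j + 1)), f y = w := by
    intro w
    choose z hz using fun i => IsLocalRing.residue_surjective (w i)
    let x : Fin r → K := fun i => (z i : K) * (v.π ^ (j + 1))⁻¹
    have hπ : v.π ^ (j + 1) ≠ 0 := pow_ne_zero _ v.π_ne_zero
    have hxz : ∀ i, x i * v.π ^ (j + 1) = z i := fun i => inv_mul_cancel_right₀ hπ _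
    have hx : v.maxNorm x ≤ (v.qInf : ℝ) ^ (j + 1) :=
      (v.maxNorm_le_iff (by positivity)).2 fun i => (hmem _).1 (by rw [hxz]; exact (z i).2)
    obtain ⟨y, hy, hxy⟩ := hρ x
    have hy' : v.maxNorm y ≤ (v.qInf : ℝ) ^ (j + 1) := by
      rw [← sub_sub_cancel x y]
      exact (v.maxNorm_sub_le_max _ _).trans (max_le hx ((hxy.trans hρj).trans hjj))
    refine ⟨y, hv.mem_latticeBall.2 ⟨hy, hy'⟩, ?_⟩
    rw [← (hf x y hx hy').2 (hxy.trans hρj)]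
    funext i
    have hxi : x i * v.π ^ (j + 1) ∈ v.ring := by rw [hxz]; exact (z i).2
    simp only [f, dif_pos hxi]
    rw [← hz i]
    congr 1
    exact Subtype.ext (hxz i)
  have := Fintype.ofFinite (IsLocalRing.ResidueField v.ring)
  rw [Finset.card_eq_sum_card_fiberwise (f := f) (t := Finset.univ) fun _ _ => Finset.mem_univ _]
  rw [Finset.sum_congr rfl (g := fun _ => (v.latticeBall Y ((v.qInf : ℝ) ^ j)).card)]
  · rw [Finset.sum_const, Finset.card_univ, Fintype.card_fun, Fintype.card_fin, smul_eq_mul, qInf,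
      Nat.card_eq_fintype_card]
  · intro w _
    obtain ⟨y, hy, rfl⟩ := hsurj w
    have hyb := hv.mem_latticeBall.1 hy
    refine Finset.card_bij' (fun x _ => x - y) (fun x _ => x + y) ?_ ?_ ?_ ?_
    · intro x hx
      obtain ⟨hx, hxy⟩ := Finset.mem_filter.1 hx
      have hxb := hv.mem_latticeBall.1 hx
      exact hv.mem_latticeBall.2 ⟨sub_mem hxb.1 hyb.1, (hf x y hxb.2 hyb.2).1 hxy⟩
    · intro x hx
      have hxb := hv.mem_latticeBall.1 hx
      have h1 : v.maxNorm (x + y) ≤ (v.qInf : ℝ) ^ (j + 1) :=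
        (v.maxNorm_add_le_max _ _).trans (max_le (hxb.2.trans hjj) hyb.2)
      refine Finset.mem_filter.2 ⟨hv.mem_latticeBall.2 ⟨add_mem hxb.1 hyb.1, h1⟩, ?_⟩
      rw [hf _ _ h1 hyb.2, add_sub_cancel_right]
      exact hxb.2
    · exact fun x _ => sub_add_cancel x y
    · exact fun x _ => add_sub_cancel_right x y

end Lattices

end Place

/-! ### Products over finite subgroups under translation. -/

section SubgroupProducts

variable {L : Type*} [Field L] {B : Finset L}

theorem IsFinSubgroup.prod_add_left (hB : IsFinSubgroup B) (g : L → L) {b : L} (hb : b ∈ B) :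
    ∏ l ∈ B, g (b + l) = ∏ l ∈ B, g l :=
  Finset.prod_bij' (fun l _ => b + l) (fun l _ => l - b) (fun _ hl => hB.add_mem hb hl)
    (fun _ hl => hB.sub_mem _ hl _ hb) (fun l _ => add_sub_cancel_left b l)
    (fun l _ => add_sub_cancel b l) fun _ _ => rfl

theorem nonzeroProd_eq_prod_ite (B : Finset L) :
    nonzeroProd B = ∏ l ∈ B, if l = 0 then 1 else l := by
  rw [nonzeroProd, ← Finset.prod_erase B (f := fun l => if l = 0 then 1 else l) (if_pos rfl)]
  exact Finset.prod_congr rfl fun l hl => (if_neg (Finset.ne_of_mem_erase hl)).symm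

end SubgroupProducts

namespace Place

open Filter

variable {K : Type*} [Field K] {v : Place K} {r : ℕ}

/-! ### Pairs of lattices and their coset representatives. -/

section Cosets

theorem mk_out (Y : v.Lattice r) (c : (Fin r → K) ⧸ Y.1) :
    Submodule.Quotient.mk (p := Y.1) (Quotient.out c) = c := Quotient.out_eq c

theorem out_sub_mem_iff (Y : v.Lattice r) (c : (Fin r → K) ⧸ Y.1) (x : Fin r → K) :
    Quotient.out c - x ∈ Y.1 ↔ c = Submodule.Quotient.mk x := by
  rw [← Submodule.Quotient.eq, mk_out]

theorem out_mem_iff (Y : v.Lattice r) (c : (Fin r → K) ⧸ Y.1) :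
    Quotient.out c ∈ Y.1 ↔ c = 0 := by
  rw [← Submodule.Quotient.mk_eq_zero, mk_out]

theorem IsDiscreteCocompact.finite_cosets (hv : v.IsDiscreteCocompact) (Y Y' : v.Lattice r)
    (h : Y.1 ≤ Y'.1) : {c : (Fin r → K) ⧸ Y.1 | Quotient.out c ∈ Y'.1}.Finite := by
  obtain ⟨ρ, hρ⟩ := hv.exists_maxNorm_sub_le Y
  refine ((hv.finite_latticeBall Y' ρ).image Submodule.Quotient.mk).subset fun c hc => ?_
  obtain ⟨y, hy, hcy⟩ := hρ (Quotient.out c)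
  refine ⟨Quotient.out c - y, ⟨sub_mem hc (h hy), hcy⟩, ?_⟩
  conv_rhs => rw [← mk_out Y c]
  rw [Submodule.Quotient.eq, sub_sub_cancel_left]
  exact neg_mem hy

variable (v) in
/-- The classes of `Y'` modulo `Y`. -/
def cosets (Y Y' : v.Lattice r) : Finset ((Fin r → K) ⧸ Y.1) :=
  if h : {c : (Fin r → K) ⧸ Y.1 | Quotient.out c ∈ Y'.1}.Finite then h.toFinset else ∅

theorem IsDiscreteCocompact.mem_cosets (hv : v.IsDiscreteCocompact) {Y Y' : v.Lattice r}
    (h : Y.1 ≤ Y'.1) {c : (Fin r → K) ⧸ Y.1} : c ∈ v.cosets Y Y' ↔ Quotient.out c ∈ Y'.1 := by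
  rw [cosets, dif_pos (hv.finite_cosets Y Y' h), Set.Finite.mem_toFinset, Set.mem_ofPred_eq]

theorem IsDiscreteCocompact.zero_mem_cosets (hv : v.IsDiscreteCocompact) {Y Y' : v.Lattice r}
    (h : Y.1 ≤ Y'.1) : 0 ∈ v.cosets Y Y' :=
  (hv.mem_cosets h).2 (h ((out_mem_iff Y 0).2 rfl))

theorem injOn_out_add (Y : v.Lattice r) {s : Set (((Fin r → K) ⧸ Y.1) × (Fin r → K))}
    (hs : ∀ p ∈ s, p.2 ∈ Y.1) : s.InjOn fun p => Quotient.out p.1 + p.2 := by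
  rintro ⟨c, y⟩ hp ⟨c', y'⟩ hp' h
  have h' : Quotient.out c + y = Quotient.out c' + y' := h
  have hc : c = c' := by
    rw [← mk_out Y c', ← out_sub_mem_iff]
    have : Quotient.out c - Quotient.out c' = y' - y := by
      rw [sub_eq_sub_iff_add_eq_add, h', add_comm]
    rw [this]
    exact sub_mem (hs _ hp') (hs _ hp)
  subst hc
  rw [add_left_cancel h']

/-- Once the radius exceeds the norms of the finitely many representatives, translating by them
preserves the ultrametric bound, so the decomposition is exact. -/
theorem IsDiscreteCocompact.exists_latticeBall_eq_image (hv : v.IsDiscreteCocompact)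
    {Y Y' : v.Lattice r} (h : Y.1 ≤ Y'.1) :
    ∃ R₁, ∀ R ≥ R₁, (∀ c ∈ v.cosets Y Y', v.maxNorm (Quotient.out c) ≤ R) ∧
      v.latticeBall Y' R = (v.cosets Y Y' ×ˢ v.latticeBall Y R).image
        fun p => Quotient.out p.1 + p.2 := by
  obtain ⟨R₁, hR₁⟩ :=
    ((v.cosets Y Y').finite_toSet.image fun c => v.maxNorm (Quotient.out c)).bddAbove
  refine ⟨R₁, fun R hR => ?_⟩
  have hc : ∀ c ∈ v.cosets Y Y', v.maxNorm (Quotient.out c) ≤ R := fun c hc =>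
    (hR₁ ⟨c, hc, rfl⟩).trans hR
  refine ⟨hc, ?_⟩
  ext x
  rw [Finset.mem_image, hv.mem_latticeBall]
  constructor
  · rintro ⟨hx, hxR⟩
    have h1 : Quotient.out (Submodule.Quotient.mk (p := Y.1) x) - x ∈ Y.1 :=
      (out_sub_mem_iff Y _ x).2 rfl
    have h2 : Submodule.Quotient.mk x ∈ v.cosets Y Y' := by
      rw [hv.mem_cosets h, ← sub_add_cancel (Quotient.out _) x]
      exact add_mem (h h1) hx
    refine ⟨⟨Submodule.Quotient.mk x, x - Quotient.out (Submodule.Quotient.mk (p := Y.1) x)⟩,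
      Finset.mem_product.2 ⟨h2, hv.mem_latticeBall.2 ⟨?_, ?_⟩⟩, add_sub_cancel _ _⟩
    · rw [← neg_sub]
      exact neg_mem h1
    · exact (v.maxNorm_sub_le_max _ _).trans (max_le hxR (hc _ h2))
  · rintro ⟨⟨c, y⟩, hp, rfl⟩
    obtain ⟨hcT, hy⟩ := Finset.mem_product.1 hp
    obtain ⟨hy, hyR⟩ := hv.mem_latticeBall.1 hy
    exact ⟨add_mem ((hv.mem_cosets h).1 hcT) (h hy),
      (v.maxNorm_add_le_max _ _).trans (max_le (hc c hcT) hyR)⟩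

theorem IsDiscreteCocompact.injOn_product (hv : v.IsDiscreteCocompact) (Y Y' : v.Lattice r)
    (R : ℝ) : Set.InjOn
      (fun p : ((Fin r → K) ⧸ Y.1) × (Fin r → K) => Quotient.out p.1 + p.2)
      ((v.cosets Y Y' ×ˢ v.latticeBall Y R : Finset (((Fin r → K) ⧸ Y.1) × (Fin r → K))) :
        Set (((Fin r → K) ⧸ Y.1) × (Fin r → K))) :=
  injOn_out_add Y fun _ hp => (hv.mem_latticeBall.1 (Finset.mem_product.1 hp).2).1

theorem IsDiscreteCocompact.exists_card_latticeBall (hv : v.IsDiscreteCocompact)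
    {Y Y' : v.Lattice r} (h : Y.1 ≤ Y'.1) :
    ∃ R₁, ∀ R ≥ R₁, (v.latticeBall Y' R).card =
      (v.cosets Y Y').card * (v.latticeBall Y R).card := by
  obtain ⟨R₁, hR₁⟩ := hv.exists_latticeBall_eq_image h
  refine ⟨R₁, fun R hR => ?_⟩
  rw [(hR₁ R hR).2, Finset.card_image_of_injOn (hv.injOn_product Y Y' R), Finset.card_product]

end Cosets

/-! ### The exponential of `Y_ω` and its dependence on `Y`. -/

section Exponential

theorem IsDiscreteCocompact.le_norm_of_notMem (hv : v.IsDiscreteCocompact) {Y : v.Lattice r}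
    {n : ℕ} {ω : v.Psi r} (hω : ω ∈ v.PsiAff r n) {R R' : ℝ} {l : v.Cinf}
    (hl : l ∈ (v.latticeBall Y R').image fun y => v.pair y ω.1)
    (hl' : l ∉ (v.latticeBall Y R).image fun y => v.pair y ω.1) :
    ((v.qInf : ℝ) ^ n)⁻¹ * R ≤ ‖l‖ := by
  obtain ⟨y, hy, rfl⟩ := Finset.mem_image.1 hl
  have h1 : R < v.maxNorm y := by
    by_contra h
    exact hl' (Finset.mem_image.2 ⟨y, hv.mem_latticeBall.2
      ⟨(hv.mem_latticeBall.1 hy).1, not_lt.1 h⟩, rfl⟩)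
  exact (mul_le_mul_of_nonneg_left h1.le (by positivity)).trans (v.le_norm_pair hω y)

/-- The discrete subgroup `Y_ω`, filtered by the maximum norm of `K ^ r`. -/
def filtration (hv : v.IsDiscreteCocompact) (Y : v.Lattice r) (ω : v.Psi r) :
    LatticeFiltration v.Cinf where
  -- The maximum keeps zero in the ball for negative radii, as a subgroup requires.
  ball R := (v.latticeBall Y (max R 0)).image fun y => v.pair y ω.1
  isFinSubgroup R := by
    refine ⟨Finset.mem_image.2 ⟨0, hv.mem_latticeBall.2 ⟨zero_mem _, by simp⟩, v.pair_zero _⟩, ?_⟩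
    intro a ha b hb
    obtain ⟨x, hx, rfl⟩ := Finset.mem_image.1 ha
    obtain ⟨y, hy, rfl⟩ := Finset.mem_image.1 hb
    have hx := hv.mem_latticeBall.1 hx
    have hy := hv.mem_latticeBall.1 hy
    exact Finset.mem_image.2 ⟨x - y, hv.mem_latticeBall.2 ⟨sub_mem hx.1 hy.1,
      (v.maxNorm_sub_le_max _ _).trans (max_le hx.2 hy.2)⟩, v.pair_sub _ _ _⟩
  mono R R' h := by
    refine Finset.image_subset_image fun y hy => ?_
    have hy := hv.mem_latticeBall.1 hy
    exact hv.mem_latticeBall.2 ⟨hy.1, hy.2.trans (max_le_max h le_rfl)⟩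
  growth M := by
    obtain ⟨n, hn⟩ := v.exists_mem_PsiAff ω
    refine ⟨(v.qInf : ℝ) ^ n * M, fun R l hl hl' => ?_⟩
    refine le_trans ?_ (hv.le_norm_of_notMem hn hl hl')
    rw [le_inv_mul_iff₀ (pow_pos v.qInf_pos_real n)]
    exact le_max_left _ _

theorem filtration_ball (hv : v.IsDiscreteCocompact) (Y : v.Lattice r) (ω : v.Psi r) {R : ℝ}
    (hR : 0 ≤ R) :
    (filtration hv Y ω).ball R = (v.latticeBall Y R).image fun y => v.pair y ω.1 := by
  change (v.latticeBall Y (max R 0)).image _ = _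
  rw [max_eq_left hR]

theorem carrier_filtration (hv : v.IsDiscreteCocompact) (Y : v.Lattice r) (ω : v.Psi r) :
    (filtration hv Y ω).carrier = v.latticeImage Y ω := by
  ext l
  constructor
  · rintro ⟨R, hl⟩
    obtain ⟨y, hy, rfl⟩ := Finset.mem_image.1 hl
    exact ⟨y, (hv.mem_latticeBall.1 hy).1, rfl⟩
  · rintro ⟨y, hy, rfl⟩
    exact ⟨v.maxNorm y, Finset.mem_image.2
      ⟨y, hv.mem_latticeBall.2 ⟨hy, le_max_left _ _⟩, rfl⟩⟩

theorem expFun_eq (hv : v.IsDiscreteCocompact) (Y : v.Lattice r) (ω : v.Psi r) (z : v.Cinf) :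
    v.expFun (v.latticeImage Y ω) z = (filtration hv Y ω).exp z := by
  rw [← carrier_filtration hv]
  rfl

theorem pair_mem_carrier_iff (hv : v.IsDiscreteCocompact) (Y : v.Lattice r) (ω : v.Psi r)
    (x : Fin r → K) : v.pair x ω.1 ∈ (filtration hv Y ω).carrier ↔ x ∈ Y.1 := by
  rw [carrier_filtration]
  constructor
  · rintro ⟨y, hy, h⟩
    exact v.pair_injective ω h ▸ hy
  · exact fun h => ⟨x, h, rfl⟩

theorem exp_pair_eq_zero_iff (hv : v.IsDiscreteCocompact) (Y : v.Lattice r) (ω : v.Psi r)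
    (x : Fin r → K) : (filtration hv Y ω).exp (v.pair x ω.1) = 0 ↔ x ∈ Y.1 := by
  rw [LatticeFiltration.exp_eq_zero_iff, pair_mem_carrier_iff]

theorem exp_add_pair (hv : v.IsDiscreteCocompact) (Y : v.Lattice r) (ω : v.Psi r) (z : v.Cinf)
    {x y : Fin r → K} (h : x - y ∈ Y.1) :
    (filtration hv Y ω).exp (z + v.pair x ω.1) = (filtration hv Y ω).exp (z + v.pair y ω.1) := by
  have h1 := (filtration hv Y ω).exp_add_mem (z + v.pair y ω.1)
    ((pair_mem_carrier_iff hv Y ω (x - y)).2 h)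
  rwa [pair_sub, add_assoc, add_sub_cancel] at h1

theorem prod_filtration_ball (hv : v.IsDiscreteCocompact) (Y : v.Lattice r) (ω : v.Psi r) {R : ℝ}
    (hR : 0 ≤ R) (g : v.Cinf → v.Cinf) :
    ∏ l ∈ (filtration hv Y ω).ball R, g l = ∏ y ∈ v.latticeBall Y R, g (v.pair y ω.1) := by
  rw [filtration_ball hv Y ω hR, Finset.prod_image (v.pair_injective ω).injOn]

theorem card_filtration_ball (hv : v.IsDiscreteCocompact) (Y : v.Lattice r) (ω : v.Psi r) {R : ℝ}
    (hR : 0 ≤ R) : ((filtration hv Y ω).ball R).card = (v.latticeBall Y R).card := by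
  rw [filtration_ball hv Y ω hR, Finset.card_image_of_injective _ (v.pair_injective ω)]

theorem exists_prod_ball_eq (hv : v.IsDiscreteCocompact) {Y Y' : v.Lattice r} (h : Y.1 ≤ Y'.1)
    (ω : v.Psi r) : ∃ R₁ : ℝ, ∀ R ≥ R₁, ∀ g : v.Cinf → v.Cinf,
      ∏ l ∈ (filtration hv Y' ω).ball R, g l =
        ∏ c ∈ v.cosets Y Y', ∏ l ∈ (filtration hv Y ω).ball R,
          g (v.pair (Quotient.out c) ω.1 + l) := by
  obtain ⟨R₁, hR₁⟩ := hv.exists_latticeBall_eq_image h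
  refine ⟨max R₁ 0, fun R hR g => ?_⟩
  have h0 : 0 ≤ R := (le_max_right _ _).trans hR
  rw [prod_filtration_ball hv Y' ω h0, (hR₁ R ((le_max_left _ _).trans hR)).2,
    Finset.prod_image (hv.injOn_product Y Y' R), Finset.prod_product]
  refine Finset.prod_congr rfl fun c _ => ?_
  rw [prod_filtration_ball hv Y ω h0]
  exact Finset.prod_congr rfl fun y _ => by rw [pair_add]

theorem exists_nodeProd_eq (hv : v.IsDiscreteCocompact) {Y Y' : v.Lattice r} (h : Y.1 ≤ Y'.1)
    (ω : v.Psi r) : ∃ R₁ : ℝ, ∀ R ≥ R₁, ∀ z : v.Cinf,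
      nodeProd ((filtration hv Y' ω).ball R) z = ∏ c ∈ v.cosets Y Y',
        nodeProd ((filtration hv Y ω).ball R) (z + v.pair (Quotient.out c) ω.1) := by
  obtain ⟨R₁, hR₁⟩ := exists_prod_ball_eq hv h ω
  refine ⟨R₁, fun R hR z => ?_⟩
  rw [nodeProd, hR₁ R hR]
  exact Finset.prod_congr rfl fun c _ => Finset.prod_congr rfl fun l _ => (add_assoc _ _ _).symm

theorem exists_nonzeroProd_eq (hv : v.IsDiscreteCocompact) {Y Y' : v.Lattice r} (h : Y.1 ≤ Y'.1)
    (ω : v.Psi r) : ∃ R₁ : ℝ, ∀ R ≥ R₁,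
      nonzeroProd ((filtration hv Y' ω).ball R) = nonzeroProd ((filtration hv Y ω).ball R) *
        ∏ c ∈ (v.cosets Y Y').erase 0,
          nodeProd ((filtration hv Y ω).ball R) (v.pair (Quotient.out c) ω.1) := by
  obtain ⟨R₁, hR₁⟩ := exists_prod_ball_eq hv h ω
  -- The chosen representative of the zero class is some element of `Y`, not necessarily zero; the
  -- ball must be large enough to contain its image.
  obtain ⟨R₂, h₂⟩ := (pair_mem_carrier_iff hv Y ω _).2
    ((out_mem_iff Y (0 : (Fin r → K) ⧸ Y.1)).2 rfl)
  refine ⟨max R₁ R₂, fun R hR => ?_⟩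
  rw [nonzeroProd_eq_prod_ite, hR₁ R ((le_max_left _ _).trans hR),
    ← Finset.mul_prod_erase _ _ (hv.zero_mem_cosets h), nonzeroProd_eq_prod_ite]
  congr 1
  · exact ((filtration hv Y ω).isFinSubgroup R).prod_add_left (fun l => if l = 0 then 1 else l)
      ((filtration hv Y ω).mono ((le_max_right _ _).trans hR) h₂)
  · refine Finset.prod_congr rfl fun c hc => Finset.prod_congr rfl fun l hl => if_neg fun h0 => ?_
    apply Finset.ne_of_mem_erase hc
    rw [← out_mem_iff, ← pair_mem_carrier_iff hv Y ω, eq_neg_of_add_eq_zero_left h0]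
    exact ⟨R, ((filtration hv Y ω).isFinSubgroup R).neg_mem hl⟩

variable (v) in
/-- The product of the `e^{Y_ω}(c · ω)` over the nonzero classes `c` of `Y'` modulo `Y`. -/
def divProd (Y Y' : v.Lattice r) (ω : v.Psi r) : v.Cinf :=
  ∏ c ∈ (v.cosets Y Y').erase 0, v.divFun (Quotient.out c) Y ω

theorem divFun_eq (hv : v.IsDiscreteCocompact) (u : Fin r → K) (Y : v.Lattice r) (ω : v.Psi r) :
    v.divFun u Y ω = (filtration hv Y ω).exp (v.pair u ω.1) := expFun_eq hv Y ω _

theorem divFun_ne_zero (hv : v.IsDiscreteCocompact) {u : Fin r → K} {Y : v.Lattice r}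
    (ω : v.Psi r) (hu : u ∉ Y.1) : v.divFun u Y ω ≠ 0 := by
  rwa [divFun_eq hv, Ne, exp_pair_eq_zero_iff]

theorem divFun_congr (hv : v.IsDiscreteCocompact) {u u' : Fin r → K} {Y : v.Lattice r}
    (ω : v.Psi r) (h : u - u' ∈ Y.1) : v.divFun u Y ω = v.divFun u' Y ω := by
  have := exp_add_pair hv Y ω 0 h
  rwa [zero_add, zero_add, ← divFun_eq, ← divFun_eq] at this

theorem divProd_ne_zero (hv : v.IsDiscreteCocompact) (Y Y' : v.Lattice r) (ω : v.Psi r) :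
    v.divProd Y Y' ω ≠ 0 :=
  Finset.prod_ne_zero_iff.2 fun c hc =>
    divFun_ne_zero hv ω (by rw [out_mem_iff]; exact Finset.ne_of_mem_erase hc)

/-- This link between values of exponentials and lattice products lets discriminants of different
lattices be compared. -/
theorem tendsto_divProd (hv : v.IsDiscreteCocompact) {Y Y' : v.Lattice r} (h : Y.1 ≤ Y'.1)
    (ω : v.Psi r) :
    Tendsto (fun R => nonzeroProd ((filtration hv Y' ω).ball R) /
      nonzeroProd ((filtration hv Y ω).ball R) ^ (v.cosets Y Y').card) atTop
      (𝓝 (v.divProd Y Y' ω)) := by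
  obtain ⟨R₁, hR₁⟩ := exists_nonzeroProd_eq hv h ω
  have h1 : Tendsto (fun R => ∏ c ∈ (v.cosets Y Y').erase 0,
      nodeProd ((filtration hv Y ω).ball R) (v.pair (Quotient.out c) ω.1) /
        nonzeroProd ((filtration hv Y ω).ball R)) atTop (𝓝 (v.divProd Y Y' ω)) := by
    refine tendsto_finsetProd _ fun c _ => ?_
    rw [divFun_eq hv]
    exact (filtration hv Y ω).tendsto_nodeProd_div _
  refine h1.congr' (eventually_atTop.2 ⟨R₁, fun R hR => ?_⟩)
  have h0 := nonzeroProd_ne_zero ((filtration hv Y ω).ball R)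
  beta_reduce
  rw [hR₁ R hR, Finset.prod_div_distrib, Finset.prod_const,
    ← Finset.card_erase_add_one (hv.zero_mem_cosets h), pow_succ']
  rw [mul_div_mul_left _ _ h0]

/-- The coset decomposition of balls gives the identity for the monic polynomials; `tendsto_divProd`
accounts for the normalizing constants in the limit. -/
theorem exp_mul_divProd (hv : v.IsDiscreteCocompact) {Y Y' : v.Lattice r} (h : Y.1 ≤ Y'.1)
    (ω : v.Psi r) (z : v.Cinf) :
    (filtration hv Y' ω).exp z * v.divProd Y Y' ω =
      ∏ c ∈ v.cosets Y Y', (filtration hv Y ω).exp (z + v.pair (Quotient.out c) ω.1) := by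
  obtain ⟨R₁, hR₁⟩ := exists_nodeProd_eq hv h ω
  refine tendsto_nhds_unique
    (((filtration hv Y' ω).tendsto_nodeProd_div z).mul (tendsto_divProd hv h ω)) ?_
  refine (tendsto_finsetProd (v.cosets Y Y') fun c _ => (filtration hv Y ω).tendsto_nodeProd_div
    (z + v.pair (Quotient.out c) ω.1)).congr' (eventually_atTop.2 ⟨R₁, fun R hR => ?_⟩)
  have h0 := nonzeroProd_ne_zero ((filtration hv Y ω).ball R)
  have h0' := nonzeroProd_ne_zero ((filtration hv Y' ω).ball R)
  beta_reduce
  rw [hR₁ R hR, Finset.prod_div_distrib, Finset.prod_const]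
  field_simp

end Exponential

end Place

open Filter

/-! ### Limits of quotients `X_j^{Q^k} / X_{j+k}`. -/

section Telescoping

variable {L : Type*} [NormedField L]

/-- The `k`-th quotient of the sequence `X`, normalized by powers of `ϖ`. -/
def normalizedQuot (Q : ℕ) (ϖ : L) (c : ℕ → ℕ) (X : ℕ → L) (k j : ℕ) : L :=
  X j ^ Q ^ k / (ϖ ^ (k * c (j + k)) * X (j + k))

variable {Q : ℕ} {ϖ : L} {c : ℕ → ℕ} {X : ℕ → L}

theorem normalizedQuot_zero (hX : ∀ j, X j ≠ 0) (j : ℕ) : normalizedQuot Q ϖ c X 0 j = 1 := by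
  simp [normalizedQuot, hX j]

theorem normalizedQuot_ne_zero (hϖ : ϖ ≠ 0) (hX : ∀ j, X j ≠ 0) (k j : ℕ) :
    normalizedQuot Q ϖ c X k j ≠ 0 :=
  div_ne_zero (pow_ne_zero _ (hX j)) (mul_ne_zero (pow_ne_zero _ hϖ) (hX _))

/-- The intermediate `X (j + k)` cancels, and the growth law for `c` makes the exponents of `ϖ` add
up. -/
theorem normalizedQuot_succ (hϖ : ϖ ≠ 0) (hX : ∀ j, X j ≠ 0) {k j : ℕ}
    (hc : c (j + k + 1) = Q * c (j + k)) :
    normalizedQuot Q ϖ c X (k + 1) j =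
      normalizedQuot Q ϖ c X k j ^ Q * normalizedQuot Q ϖ c X 1 (j + k) := by
  have h1 := hX (j + k)
  have h2 := hX (j + k + 1)
  have e : (k + 1) * c (j + k + 1) = k * c (j + k) * Q + 1 * c (j + k + 1) := by
    rw [hc]
    ring
  simp only [normalizedQuot, ← add_assoc, e, pow_one]
  rw [div_pow, mul_pow, ← pow_mul, ← pow_mul, ← pow_succ, pow_add ϖ]
  field_simp

/-- Solving the recursion for its last factor turns convergence at two consecutive `k` into
convergence at `k = 1`. -/
theorem tendsto_normalizedQuot_one (hϖ : ϖ ≠ 0) (hX : ∀ j, X j ≠ 0)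
    (hc : ∀ᶠ j in atTop, c (j + 1) = Q * c j) {k : ℕ} {a b : L} (ha : a ≠ 0)
    (hA : Tendsto (normalizedQuot Q ϖ c X k) atTop (𝓝 a))
    (hB : Tendsto (normalizedQuot Q ϖ c X (k + 1)) atTop (𝓝 b)) :
    Tendsto (normalizedQuot Q ϖ c X 1) atTop (𝓝 (b / a ^ Q)) := by
  rw [← tendsto_add_atTop_iff_nat k]
  refine (hB.div (hA.pow Q) (pow_ne_zero _ ha)).congr' ?_
  filter_upwards [(tendsto_add_atTop_nat k).eventually hc] with j hj
  rw [Pi.div_apply, normalizedQuot_succ hϖ hX hj, mul_div_cancel_left₀]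
  exact pow_ne_zero _ (normalizedQuot_ne_zero hϖ hX k j)

theorem tendsto_normalizedQuot (hϖ : ϖ ≠ 0) (hX : ∀ j, X j ≠ 0)
    (hc : ∀ᶠ j in atTop, c (j + 1) = Q * c j) {δ : L}
    (h : Tendsto (normalizedQuot Q ϖ c X 1) atTop (𝓝 δ)) (k : ℕ) :
    Tendsto (normalizedQuot Q ϖ c X k) atTop (𝓝 (δ ^ ∑ i ∈ Finset.range k, Q ^ i)) := by
  induction k with
  | zero =>
    rw [Finset.sum_range_zero, pow_zero]
    exact tendsto_const_nhds.congr fun j => (normalizedQuot_zero hX j).symm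
  | succ k ih =>
    rw [geom_sum_succ, pow_add, pow_one, mul_comm Q, pow_mul]
    refine ((ih.pow Q).mul ((tendsto_add_atTop_iff_nat k).2 h)).congr' ?_
    filter_upwards [(tendsto_add_atTop_nat k).eventually hc] with j hj
    exact (normalizedQuot_succ hϖ hX hj).symm

/-- Write `X'_j = Z_j X_j^n` with `Z_j → Z`. The quotient for `X'` is the `n`-th power of that for
`X` times `Z_j^Q / Z_{j+1}`, and `c' = nc` matches the powers of `ϖ`. -/
theorem tendsto_normalizedQuot_one_of_index (hQ : 1 ≤ Q) (hϖ : ϖ ≠ 0) (hX : ∀ j, X j ≠ 0)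
    {c' : ℕ → ℕ} {X' : ℕ → L} {n : ℕ} (hc' : ∀ᶠ j in atTop, c' j = n * c j) {Z δ : L}
    (hZ0 : Z ≠ 0) (hZ : Tendsto (fun j => X' j / X j ^ n) atTop (𝓝 Z))
    (h : Tendsto (normalizedQuot Q ϖ c X 1) atTop (𝓝 δ)) :
    Tendsto (normalizedQuot Q ϖ c' X' 1) atTop (𝓝 (δ ^ n * Z ^ (Q - 1))) := by
  have h1 := ((hZ.pow Q).div ((tendsto_add_atTop_iff_nat 1).2 hZ) hZ0).mul (h.pow n)
  have e : Z ^ Q / Z * δ ^ n = δ ^ n * Z ^ (Q - 1) := by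
    obtain ⟨m, rfl⟩ := Nat.exists_eq_add_of_le' hQ
    rw [pow_succ, mul_div_cancel_right₀ _ hZ0, Nat.add_sub_cancel, mul_comm]
  rw [← e]
  refine h1.congr' ?_
  filter_upwards [(tendsto_add_atTop_nat 1).eventually hc'] with j hj
  have h2 := hX j
  have h3 := hX (j + 1)
  simp only [normalizedQuot, Pi.div_apply, one_mul, pow_one, hj]
  rw [div_pow, div_pow, mul_pow, ← pow_mul, ← pow_mul, ← pow_mul, mul_comm n Q,
    mul_comm (c (j + 1)) n]
  by_cases h4 : X' (j + 1) = 0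
  · simp [h4]
  field_simp

/-- Eventually the exponents are a constant times `Q^i`, and Frobenius gives `x^{Q^i} - 1 = (x -
1)^{Q^i}` with `‖x - 1‖ < 1`. -/
theorem tendsto_pow_of_norm_sub_one_lt {p : ℕ} [Fact p.Prime] [CharP L p] {m : ℕ} (hm : m ≠ 0)
    (hQ : Q = p ^ m) (hc : ∀ᶠ j in atTop, c (j + 1) = Q * c j) [IsUltrametricDist L] {u : L}
    (hu : ‖u - 1‖ < 1) : Tendsto (fun j => u ^ c j) atTop (𝓝 1) := by
  obtain ⟨J, hJ⟩ := eventually_atTop.1 hc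
  have hc2 : ∀ i, c (i + J) = c J * Q ^ i := by
    intro i
    induction i with
    | zero => simp
    | succ i ih => rw [Nat.add_right_comm, hJ _ (Nat.le_add_left J i), ih, pow_succ]; ring
  rw [← tendsto_add_atTop_iff_nat J, tendsto_iff_norm_sub_tendsto_zero]
  have h1 : ‖u ^ c J - 1‖ < 1 := (norm_pow_sub_one_le (norm_nonneg _) hu.le le_rfl _).trans_lt hu
  have hQ1 : 1 < Q := hQ ▸ Nat.one_lt_pow hm (Fact.out : p.Prime).one_lt
  have h2 := (tendsto_pow_atTop_nhds_zero_of_lt_one (norm_nonneg _) h1).comp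
    (tendsto_pow_atTop_atTop_of_one_lt hQ1)
  refine h2.congr fun i => ?_
  have e : u ^ c (i + J) - 1 = (u ^ c J - 1) ^ Q ^ i := by
    rw [hc2, pow_mul, hQ, ← pow_mul p, sub_pow_char_pow, one_pow]
  rw [e, norm_pow]
  rfl

end Telescoping

/-! ### Effect of scaling on finite products. -/

section ScaledSubgroup

variable {L : Type*} [Field L] {B : Finset L} {α : L}

theorem prod_erase_image_inv_mul (hα : α ≠ 0) (g : L → L) :
    ∏ l ∈ (B.image fun l => α⁻¹ * l).erase 0, g l = ∏ l ∈ B.erase 0, g (α⁻¹ * l) := by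
  have h : (B.image fun l => α⁻¹ * l).erase 0 = (B.erase 0).image fun l => α⁻¹ * l := by
    ext x
    simp only [Finset.mem_erase, Finset.mem_image]
    constructor
    · rintro ⟨hx, l, hl, rfl⟩
      exact ⟨l, ⟨right_ne_zero_of_mul hx, hl⟩, rfl⟩
    · rintro ⟨l, ⟨hl0, hl⟩, rfl⟩
      exact ⟨mul_ne_zero (inv_ne_zero hα) hl0, l, hl, rfl⟩
  rw [h, Finset.prod_image (mul_right_injective₀ (inv_ne_zero hα)).injOn]

theorem nonzeroProd_image_inv_mul (hα : α ≠ 0) (h0 : 0 ∈ B) :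
    nonzeroProd (B.image fun l => α⁻¹ * l) = α * (α ^ B.card)⁻¹ * nonzeroProd B := by
  rw [nonzeroProd, prod_erase_image_inv_mul hα, Finset.prod_mul_distrib, Finset.prod_const,
    ← Finset.card_erase_add_one h0, pow_succ, nonzeroProd, inv_pow]
  field_simp

theorem truncExp_image_inv_mul (hα : α ≠ 0) (z : L) :
    α * truncExp (B.image fun l => α⁻¹ * l) z = truncExp B (α * z) := by
  rw [truncExp, truncExp, prod_erase_image_inv_mul hα, mul_assoc]
  congr 2
  refine Finset.prod_congr rfl fun l hl => ?_
  have := Finset.ne_of_mem_erase hl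
  field_simp

end ScaledSubgroup

namespace Place

variable {K : Type*} [Field K] {v : Place K} {r : ℕ}

/-! ### The lattices `a⁻¹Y`. -/

section DivLattice

variable (v) in
/-- The lattice `a⁻¹ Y`. -/
def divLattice (a : K) (ha : a ≠ 0) (Y : v.Lattice r) : v.Lattice r :=
  ⟨Y.1.map ((a⁻¹ • LinearMap.id : (Fin r → K) →ₗ[K] (Fin r → K)).restrictScalars v.A),
    Y.2.1.map _, by
      rw [eq_top_iff]
      refine le_trans Y.2.2.ge ?_
      rw [Submodule.span_le]
      intro y hy
      have h := Submodule.smul_mem (Submodule.span K ((Y.1.map ((a⁻¹ • LinearMap.id :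
        (Fin r → K) →ₗ[K] (Fin r → K)).restrictScalars v.A) : Submodule v.A (Fin r → K)) :
        Set (Fin r → K))) a (Submodule.subset_span (Submodule.mem_map_of_mem hy))
      have e : a • ((a⁻¹ • LinearMap.id : (Fin r → K) →ₗ[K] (Fin r → K)).restrictScalars v.A) y
          = y := smul_inv_smul₀ ha y
      rwa [e] at h⟩

theorem mem_divLattice {a : K} (ha : a ≠ 0) {Y : v.Lattice r} {x : Fin r → K} :
    x ∈ (v.divLattice a ha Y).1 ↔ a • x ∈ Y.1 := by
  constructor
  · rintro ⟨y, hy, rfl⟩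
    have e : a • ((a⁻¹ • LinearMap.id : (Fin r → K) →ₗ[K] (Fin r → K)).restrictScalars v.A) y
        = y := smul_inv_smul₀ ha y
    rw [e]
    exact hy
  · exact fun h => ⟨a • x, h, inv_smul_smul₀ ha x⟩

theorem le_divLattice {a : K} (ha : a ≠ 0) (haA : a ∈ v.A) (Y : v.Lattice r) :
    Y.1 ≤ (v.divLattice a ha Y).1 := fun _ hy =>
  (mem_divLattice ha).2 (Y.1.smul_mem (⟨a, haA⟩ : v.A) hy)

theorem latticeBall_divLattice (hv : v.IsDiscreteCocompact) {a : K} (ha : a ≠ 0)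
    (Y : v.Lattice r) (R : ℝ) :
    v.latticeBall (v.divLattice a ha Y) R =
      (v.latticeBall Y (v.abv a * R)).image fun y => a⁻¹ • y := by
  ext x
  rw [Finset.mem_image, hv.mem_latticeBall, mem_divLattice]
  constructor
  · rintro ⟨h1, h2⟩
    refine ⟨a • x, hv.mem_latticeBall.2 ⟨h1, ?_⟩, inv_smul_smul₀ ha x⟩
    rw [maxNorm_smul]
    exact mul_le_mul_of_nonneg_left h2 (v.abv.nonneg a)
  · rintro ⟨y, hy, rfl⟩
    have hy := hv.mem_latticeBall.1 hy
    rw [smul_inv_smul₀ ha, maxNorm_smul, map_inv₀, inv_mul_le_iff₀ (v.abv.pos ha)]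
    exact hy

theorem card_latticeBall_divLattice (hv : v.IsDiscreteCocompact) {a : K} (ha : a ≠ 0)
    (Y : v.Lattice r) (R : ℝ) :
    (v.latticeBall (v.divLattice a ha Y) R).card = (v.latticeBall Y (v.abv a * R)).card := by
  rw [latticeBall_divLattice hv ha, Finset.card_image_of_injective]
  exact smul_right_injective _ (inv_ne_zero ha)

theorem toCinf_ne_zero {a : K} (ha : a ≠ 0) : v.toCinf a ≠ 0 :=
  (map_ne_zero v.toCinf).2 ha

theorem filtration_divLattice_ball (hv : v.IsDiscreteCocompact) {a : K} (ha : a ≠ 0)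
    (Y : v.Lattice r) (ω : v.Psi r) {R : ℝ} (hR : 0 ≤ R) :
    (filtration hv (v.divLattice a ha Y) ω).ball R =
      ((filtration hv Y ω).ball (v.abv a * R)).image fun l => (v.toCinf a)⁻¹ * l := by
  rw [filtration_ball hv _ ω hR, filtration_ball hv _ ω (mul_nonneg (v.abv.nonneg a) hR),
    latticeBall_divLattice hv ha, Finset.image_image, Finset.image_image]
  refine Finset.image_congr fun y _ => ?_
  simp only [Function.comp_apply]
  rw [pair_smul, map_inv₀]

/-- By homogeneity, the multiplication `z ↦ az` inside the exponential becomes passage from `Y` to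
the larger lattice `a⁻¹Y`. -/
theorem toCinf_mul_exp_divLattice (hv : v.IsDiscreteCocompact) {a : K} (ha : a ≠ 0)
    (Y : v.Lattice r) (ω : v.Psi r) (z : v.Cinf) :
    v.toCinf a * (filtration hv (v.divLattice a ha Y) ω).exp z =
      (filtration hv Y ω).exp (v.toCinf a * z) := by
  have h1 := ((filtration hv Y ω).tendsto_truncExp (v.toCinf a * z)).comp
    (tendsto_id.const_mul_atTop (v.abv.pos ha))
  refine tendsto_nhds_unique
    (((filtration hv (v.divLattice a ha Y) ω).tendsto_truncExp z).const_mul (v.toCinf a))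
    (h1.congr' ?_)
  filter_upwards [eventually_ge_atTop 0] with R hR
  rw [filtration_divLattice_ball hv ha Y ω hR, truncExp_image_inv_mul (toCinf_ne_zero ha)]
  rfl

theorem IsDiscreteCocompact.exists_abv_eq_pow (hv : v.IsDiscreteCocompact) {a : K} (haA : a ∈ v.A)
    (ha : a ≠ 0) : ∃ k : ℕ, v.abv a = (v.qInf : ℝ) ^ k := by
  obtain ⟨n, hn⟩ := v.exists_abv_eq_zpow ha
  have h1 := hv.one_le_abv a haA ha
  rw [hn, ← zpow_zero (v.qInf : ℝ), zpow_le_zpow_iff_right₀ v.one_lt_qInf_real] at h1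
  obtain ⟨k, rfl⟩ := Int.eq_ofNat_of_zero_le h1
  exact ⟨k, by rw [hn, zpow_natCast]⟩

variable (v) in
theorem tendsto_qInf_pow : Tendsto (fun j : ℕ => (v.qInf : ℝ) ^ j) atTop atTop :=
  tendsto_pow_atTop_atTop_of_one_lt v.one_lt_qInf_real

variable (v) in
/-- The number of elements of `Y` of norm at most `q_∞ ^ j`. -/
def latticeCount (Y : v.Lattice r) (j : ℕ) : ℕ := (v.latticeBall Y ((v.qInf : ℝ) ^ j)).card

theorem IsDiscreteCocompact.latticeCount_pos (hv : v.IsDiscreteCocompact) (Y : v.Lattice r)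
    (j : ℕ) : 0 < v.latticeCount Y j :=
  Finset.card_pos.2 ⟨0, hv.mem_latticeBall.2 ⟨zero_mem _, by
    rw [maxNorm_zero]
    exact pow_nonneg v.qInf_pos_real.le _⟩⟩

theorem IsDiscreteCocompact.eventually_latticeCount_succ (hv : v.IsDiscreteCocompact)
    (Y : v.Lattice r) :
    ∀ᶠ j in atTop, v.latticeCount Y (j + 1) = v.qInf ^ r * v.latticeCount Y j :=
  eventually_atTop.2 (hv.card_latticeBall_succ Y)

theorem IsDiscreteCocompact.eventually_latticeCount_add (hv : v.IsDiscreteCocompact)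
    (Y : v.Lattice r) (k : ℕ) :
    ∀ᶠ j in atTop, v.latticeCount Y (j + k) = (v.qInf ^ r) ^ k * v.latticeCount Y j := by
  induction k with
  | zero => exact Eventually.of_forall fun j => by simp
  | succ k ih =>
    filter_upwards [ih, (tendsto_add_atTop_nat k).eventually (hv.eventually_latticeCount_succ Y)]
      with j h1 h2
    rw [← add_assoc, h2, h1, pow_succ]
    ring

theorem IsDiscreteCocompact.eventually_latticeCount_index (hv : v.IsDiscreteCocompact)
    {Y Y' : v.Lattice r} (h : Y.1 ≤ Y'.1) :
    ∀ᶠ j in atTop, v.latticeCount Y' j = (v.cosets Y Y').card * v.latticeCount Y j := by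
  obtain ⟨R₁, hR₁⟩ := hv.exists_card_latticeBall h
  filter_upwards [(tendsto_qInf_pow v).eventually_ge_atTop R₁] with j hj
  exact hR₁ _ hj

theorem IsDiscreteCocompact.latticeCount_divLattice (hv : v.IsDiscreteCocompact) {a : K}
    (ha : a ≠ 0) {k : ℕ} (hk : v.abv a = (v.qInf : ℝ) ^ k) (Y : v.Lattice r) (j : ℕ) :
    v.latticeCount (v.divLattice a ha Y) j = v.latticeCount Y (j + k) := by
  rw [latticeCount, card_latticeBall_divLattice hv ha, hk, ← pow_add, add_comm k, latticeCount]

/-- The index is read off from point counts: a ball of `a⁻¹Y` is in bijection with a ball of `Y`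
whose radius is `q_∞^k` times larger. -/
theorem IsDiscreteCocompact.card_cosets_divLattice (hv : v.IsDiscreteCocompact) {a : K}
    (ha : a ≠ 0) (haA : a ∈ v.A) {k : ℕ} (hk : v.abv a = (v.qInf : ℝ) ^ k) (Y : v.Lattice r) :
    (v.cosets Y (v.divLattice a ha Y)).card = (v.qInf ^ r) ^ k := by
  obtain ⟨j, h1, h2⟩ := ((hv.eventually_latticeCount_index (le_divLattice ha haA Y)).and
    (hv.eventually_latticeCount_add Y k)).exists
  rw [hv.latticeCount_divLattice ha hk, h2] at h1
  exact (Nat.eq_of_mul_eq_mul_right (hv.latticeCount_pos Y j) h1).symm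

end DivLattice

/-! ### The polynomials `φ_a` and their uniqueness. -/

section DrinfeldPolynomial

variable (v) in
/-- The polynomial `φ_a^Λ` for `Λ = Y_ω`. -/
def drinfeldPoly (a : K) (ha : a ≠ 0) (Y : v.Lattice r) (ω : v.Psi r) : Polynomial v.Cinf :=
  Polynomial.C (v.toCinf a) * (Polynomial.X * ∏ c ∈ (v.cosets Y (v.divLattice a ha Y)).erase 0,
    (1 + Polynomial.C (v.divFun (Quotient.out c) Y ω)⁻¹ * Polynomial.X))

/-- Apply the product formula to `Y ⊆ a⁻¹Y`; by additivity each factor `e(z + c)` divided by `e(c)`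
is linear in `e(z)`. -/
theorem isDrinfeldPoly_drinfeldPoly (hv : v.IsDiscreteCocompact) {a : K} (ha : a ≠ 0)
    (haA : a ∈ v.A) (Y : v.Lattice r) (ω : v.Psi r) :
    v.IsDrinfeldPoly (v.latticeImage Y ω) a (v.drinfeldPoly a ha Y ω) := by
  intro z
  have hle := le_divLattice ha haA Y
  rw [expFun_eq hv, expFun_eq hv, ← toCinf_mul_exp_divLattice hv ha, drinfeldPoly,
    Polynomial.eval_mul, Polynomial.eval_C, Polynomial.eval_mul, Polynomial.eval_X,
    Polynomial.eval_prod]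
  congr 1
  have hZ := divProd_ne_zero hv Y (v.divLattice a ha Y) ω
  apply mul_right_cancel₀ hZ
  rw [exp_mul_divProd hv hle, ← Finset.mul_prod_erase _ _ (hv.zero_mem_cosets hle), mul_assoc,
    divProd, ← Finset.prod_mul_distrib]
  congr 1
  · have h0 : Quotient.out (0 : (Fin r → K) ⧸ Y.1) - 0 ∈ Y.1 := by
      rw [sub_zero, out_mem_iff]
    rw [exp_add_pair hv Y ω z h0, pair_zero, add_zero]
  · refine Finset.prod_congr rfl fun c hc => ?_
    have h0 : v.divFun (Quotient.out c) Y ω ≠ 0 :=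
      divFun_ne_zero hv ω (by rw [out_mem_iff]; exact Finset.ne_of_mem_erase hc)
    simp only [Polynomial.eval_add, Polynomial.eval_one, Polynomial.eval_mul, Polynomial.eval_C,
      Polynomial.eval_X]
    rw [LatticeFiltration.exp_add, ← divFun_eq hv, add_mul, one_mul, mul_assoc, mul_comm _⁻¹,
      mul_inv_cancel_right₀ h0, add_comm]

theorem coeff_drinfeldPoly (hv : v.IsDiscreteCocompact) {a : K} (ha : a ≠ 0)
    (haA : a ∈ v.A) (Y : v.Lattice r) (ω : v.Psi r) :
    (v.drinfeldPoly a ha Y ω).coeff (v.cosets Y (v.divLattice a ha Y)).card =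
      v.toCinf a / v.divProd Y (v.divLattice a ha Y) ω := by
  have hle := le_divLattice ha haA Y
  rw [drinfeldPoly, Polynomial.coeff_C_mul, ← Finset.card_erase_add_one (hv.zero_mem_cosets hle),
    Polynomial.coeff_X_mul, div_eq_mul_inv, divProd, ← Finset.prod_inv_distrib]
  congr 1
  have h := Polynomial.coeff_prod_of_natDegree_le
    (s := (v.cosets Y (v.divLattice a ha Y)).erase 0)
    (f := fun c => 1 + Polynomial.C (v.divFun (Quotient.out c) Y ω)⁻¹ * Polynomial.X) (n := 1)
    fun c _ => by compute_degree
  rw [mul_one] at h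
  rw [h]
  refine Finset.prod_congr rfl fun c _ => ?_
  simp [Polynomial.coeff_one]

/-- Both polynomials are prescribed on the image of the exponential, which is infinite: the classes
of `b^{-n}Y` modulo `Y` have distinct images, and their number is unbounded because `r ≥ 1` and `|b|
> 1`. -/
theorem isDrinfeldPoly_unique (hv : v.IsDiscreteCocompact) (hr : 1 ≤ r)
    (hpole : ∃ a ∈ v.A, 1 < v.abv a) {Y : v.Lattice r} {ω : v.Psi r} {a : K}
    {φ φ' : Polynomial v.Cinf} (h : v.IsDrinfeldPoly (v.latticeImage Y ω) a φ)
    (h' : v.IsDrinfeldPoly (v.latticeImage Y ω) a φ') : φ = φ' := by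
  refine Polynomial.eq_of_infinite_eval_eq φ φ' ?_
  intro hfin
  obtain ⟨b, hbA, hb1⟩ := hpole
  have hb0 : b ≠ 0 := by
    rintro rfl
    rw [map_zero] at hb1
    exact absurd hb1 (not_lt.2 zero_le_one)
  have hle : ∀ n : ℕ, (v.cosets Y (v.divLattice (b ^ n) (pow_ne_zero n hb0) Y)).card ≤
      hfin.toFinset.card := fun n => by
    refine Finset.card_le_card_of_injOn (fun c => v.divFun (Quotient.out c) Y ω)
      (fun c _ => ?_) fun c _ c' _ hcc => ?_
    · rw [Finset.mem_coe, Set.Finite.mem_toFinset, Set.mem_ofPred_eq]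
      exact (h _).trans (h' _).symm
    · have h1 : v.divFun (Quotient.out c) Y ω = v.divFun (Quotient.out c') Y ω := hcc
      rw [divFun_eq hv, divFun_eq hv, ← sub_eq_zero, sub_eq_add_neg, ← LatticeFiltration.exp_neg,
        ← LatticeFiltration.exp_add, ← sub_eq_add_neg, ← pair_sub, exp_pair_eq_zero_iff,
        out_sub_mem_iff, mk_out] at h1
      exact h1
  obtain ⟨k, hk⟩ := hv.exists_abv_eq_pow hbA hb0
  have hk0 : k ≠ 0 := by
    rintro rfl
    rw [hk, pow_zero] at hb1
    exact lt_irrefl _ hb1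
  have h1 := hle hfin.toFinset.card
  rw [hv.card_cosets_divLattice (pow_ne_zero _ hb0) (pow_mem hbA _)
    (by rw [map_pow, hk, ← pow_mul])] at h1
  refine absurd h1 (not_le.2 ?_)
  rw [← pow_mul]
  refine (Nat.lt_pow_self v.one_lt_qInf).trans_le
    (Nat.pow_le_pow_right (zero_lt_one.trans v.one_lt_qInf) ?_)
  rw [← mul_assoc]
  exact Nat.le_mul_of_pos_left _ (Nat.mul_pos hr (Nat.pos_of_ne_zero hk0))

end DrinfeldPolynomial

end Place

namespace Place

variable {K : Type*} [Field K] {v : Place K} {r : ℕ}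

theorem exists_charP_Cinf {F : Type*} [Field F] [Algebra F K] (hK : IsGlobalFunctionField F K)
    (v : Place K) : ∃ p m : ℕ, p.Prime ∧ CharP v.Cinf p ∧ m ≠ 0 ∧ v.qInf = p ^ m := by
  obtain ⟨f, hf, hq⟩ := v.exists_qInf_eq_pow hK
  have := hK.1
  have := Fintype.ofFinite F
  obtain ⟨p, hp, n, hn⟩ := FiniteField.card' F
  have hc : CharP v.Cinf p :=
    charP_of_injective_ringHom (f := v.toCinf.comp (algebraMap F K)) (RingHom.injective _) p
  refine ⟨p, n * f, hn.1, hc, mul_ne_zero n.ne_zero hf, ?_⟩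
  rw [hq, Nat.card_eq_fintype_card, hn.2, ← pow_mul]

/-- Approximate `π^{-k}` by an element of `A`; for large `k` the bounded error is smaller than
`q_∞^k`, so it affects neither sign nor degree. -/
theorem IsDiscreteCocompact.exists_sgnEqOne (hv : v.IsDiscreteCocompact) :
    ∃ k₀ : ℕ, ∀ k ≥ k₀, ∃ a ∈ v.A, v.SgnEqOne a ∧ v.abv a = (v.qInf : ℝ) ^ k := by
  obtain ⟨ρ, hρ⟩ := hv.exists_abv_sub_le
  obtain ⟨k₀, hk₀⟩ := eventually_atTop.1 ((tendsto_qInf_pow v).eventually_gt_atTop ρ)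
  refine ⟨k₀, fun k hk => ?_⟩
  obtain ⟨a, ha, hxa⟩ := hρ (v.π ^ k)⁻¹
  have hx : v.abv (v.π ^ k)⁻¹ = (v.qInf : ℝ) ^ k := by
    rw [map_inv₀, map_pow, v.abv_π, inv_pow, inv_inv]
  have hlt : v.abv ((v.π ^ k)⁻¹ - a) < (v.qInf : ℝ) ^ k := hxa.trans_lt (hk₀ k hk)
  have hlt' : v.abv (a - (v.π ^ k)⁻¹) < (v.qInf : ℝ) ^ k := by rwa [v.abv.map_sub]
  refine ⟨a, ha, ⟨k, ?_⟩, ?_⟩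
  · have e : a * v.π ^ (k : ℤ) - 1 = (a - (v.π ^ k)⁻¹) * v.π ^ k := by
      rw [zpow_natCast, sub_mul, inv_mul_cancel₀ (pow_ne_zero _ v.π_ne_zero)]
    rw [e, map_mul, map_pow, v.abv_π, inv_pow, ← div_eq_mul_inv,
      div_lt_one (pow_pos v.qInf_pos_real _)]
    exact hlt'
  · rw [← hx]
    exact v.abv_eq_of_abv_sub_lt (hx ▸ hlt')

theorem norm_toCinf_mul_sub_one_lt {a : K} (hs : v.SgnEqOne a) {k : ℕ}
    (hk : v.abv a = (v.qInf : ℝ) ^ k) :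
    ‖v.toCinf a * v.toCinf v.π ^ k - 1‖ < 1 := by
  obtain ⟨n, hn⟩ := hs
  have h1 : v.abv (a * v.π ^ n) = 1 := by
    rw [← map_one v.abv]
    exact v.abv_eq_of_abv_sub_lt (by rwa [map_one])
  rw [map_mul, hk, v.abv_zpow_π, ← zpow_natCast, ← zpow_add₀ v.qInf_pos_real.ne',
    zpow_eq_one_iff_right₀ v.qInf_pos_real.le v.one_lt_qInf_real.ne'] at h1
  -- The exponent in the sign condition is forced by the absolute value.
  obtain rfl : n = k := by omega
  rw [← map_pow, ← map_mul, ← map_one v.toCinf, ← map_sub, norm_toCinf]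
  rwa [zpow_natCast] at hn

/-! ### Existence, uniqueness and transformation of the canonical discriminant. -/

section Discriminant

/-- The product of the non-zero elements of `Y_ω` that belong to the `y ∈ Y` of norm at most
`q_∞ ^ j`. -/
def ballProd (hv : v.IsDiscreteCocompact) (Y : v.Lattice r) (ω : v.Psi r) (j : ℕ) : v.Cinf :=
  nonzeroProd ((filtration hv Y ω).ball ((v.qInf : ℝ) ^ j))

theorem ballProd_ne_zero (hv : v.IsDiscreteCocompact) (Y : v.Lattice r) (ω : v.Psi r) (j : ℕ) :
    ballProd hv Y ω j ≠ 0 := nonzeroProd_ne_zero _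

theorem tendsto_ballProd (hv : v.IsDiscreteCocompact) {Y Y' : v.Lattice r} (h : Y.1 ≤ Y'.1)
    (ω : v.Psi r) : Tendsto (fun j => ballProd hv Y' ω j /
      ballProd hv Y ω j ^ (v.cosets Y Y').card) atTop (𝓝 (v.divProd Y Y' ω)) :=
  (tendsto_divProd hv h ω).comp (tendsto_qInf_pow v)

theorem ballProd_divLattice (hv : v.IsDiscreteCocompact) {a : K} (ha : a ≠ 0) {k : ℕ}
    (hk : v.abv a = (v.qInf : ℝ) ^ k) (Y : v.Lattice r) (ω : v.Psi r) (j : ℕ) :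
    ballProd hv (v.divLattice a ha Y) ω j =
      v.toCinf a * (v.toCinf a ^ v.latticeCount Y (j + k))⁻¹ * ballProd hv Y ω (j + k) := by
  have h0 : (0 : ℝ) ≤ (v.qInf : ℝ) ^ (j + k) := pow_nonneg v.qInf_pos_real.le _
  rw [ballProd, filtration_divLattice_ball hv ha Y ω (pow_nonneg v.qInf_pos_real.le _), hk,
    ← pow_add, add_comm k, nonzeroProd_image_inv_mul (toCinf_ne_zero ha)
      ((filtration hv Y ω).isFinSubgroup _).1, card_filtration_ball hv Y ω h0]
  rfl

/-- The coefficient `Δ_a` of the lattice `Y_ω`. -/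
def divDisc (a : K) (ha : a ≠ 0) (Y : v.Lattice r) (ω : v.Psi r) : v.Cinf :=
  v.toCinf a / v.divProd Y (v.divLattice a ha Y) ω

theorem divDisc_ne_zero (hv : v.IsDiscreteCocompact) {a : K} (ha : a ≠ 0) (Y : v.Lattice r)
    (ω : v.Psi r) : divDisc a ha Y ω ≠ 0 :=
  div_ne_zero (toCinf_ne_zero ha) (divProd_ne_zero hv _ _ ω)

/-- The ball product of `a⁻¹Y` is `a^{1-c_{j+k}} X_{j+k}`, so `Δ_a` is the limit of `a^{c_{j+k}}
X_j^{Q^k} / X_{j+k}`. The sign condition enters through `(aπ^k)^{c_{j+k}} → 1`; afterwards only the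
degree of `a` remains. -/
theorem tendsto_divDisc (hv : v.IsDiscreteCocompact) {p m : ℕ} [Fact p.Prime] [CharP v.Cinf p]
    (hm : m ≠ 0) (hQ : v.qInf ^ r = p ^ m) {a : K} (ha : a ≠ 0) (haA : a ∈ v.A)
    (hs : v.SgnEqOne a) {k : ℕ} (hk : v.abv a = (v.qInf : ℝ) ^ k) (Y : v.Lattice r) (ω : v.Psi r) :
    Tendsto (normalizedQuot (v.qInf ^ r) (v.toCinf v.π) (v.latticeCount Y) (ballProd hv Y ω) k)
      atTop (𝓝 (divDisc a ha Y ω)) := by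
  have hα : v.toCinf a ≠ 0 := toCinf_ne_zero ha
  have hϖ : v.toCinf v.π ≠ 0 := toCinf_ne_zero v.π_ne_zero
  have h1 := (tendsto_ballProd hv (le_divLattice ha haA Y) ω).inv₀ (divProd_ne_zero hv _ _ ω)
  have h2 := (tendsto_add_atTop_iff_nat k).2 (tendsto_pow_of_norm_sub_one_lt hm hQ
    (hv.eventually_latticeCount_succ Y) (norm_toCinf_mul_sub_one_lt hs hk))
  have h3 := (h1.const_mul (v.toCinf a)).div h2 one_ne_zero
  rw [div_one, ← div_eq_mul_inv] at h3
  refine h3.congr fun j => ?_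
  have h4 := ballProd_ne_zero hv Y ω j
  have h5 := ballProd_ne_zero hv Y ω (j + k)
  rw [Pi.div_apply, ballProd_divLattice hv ha hk, hv.card_cosets_divLattice ha haA hk,
    normalizedQuot, mul_pow (v.toCinf a), pow_mul (v.toCinf v.π) k]
  field_simp

/-- The candidate for the canonical discriminant given by elements of consecutive degrees. -/
def discQuot (a b : K) (ha : a ≠ 0) (hb : b ≠ 0) (Y : v.Lattice r) (ω : v.Psi r) : v.Cinf :=
  divDisc b hb Y ω / divDisc a ha Y ω ^ v.qInf ^ r

theorem one_lt_qInf_pow (v : Place K) (hr : 1 ≤ r) : 1 < v.qInf ^ r :=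
  Nat.one_lt_pow (Nat.one_le_iff_ne_zero.1 hr) v.one_lt_qInf

theorem geomSum_eq_div_w (v : Place K) (hr : 1 ≤ r) {q d k : ℕ} (h : q ^ d = v.qInf ^ k) :
    (q ^ (r * d) - 1) / v.w r = ∑ i ∈ Finset.range k, (v.qInf ^ r) ^ i := by
  rw [Nat.geomSum_eq (one_lt_qInf_pow v hr), w, mul_comm, pow_mul, h, ← pow_mul, ← pow_mul,
    mul_comm]

theorem coeff_eq_divDisc (hv : v.IsDiscreteCocompact) {a : K} (ha : a ≠ 0)
    (haA : a ∈ v.A) {k : ℕ} (hk : v.abv a = (v.qInf : ℝ) ^ k) {q d : ℕ} (h : q ^ d = v.qInf ^ k)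
    (Y : v.Lattice r) (ω : v.Psi r) :
    (v.drinfeldPoly a ha Y ω).coeff (q ^ (r * d)) = divDisc a ha Y ω := by
  rw [divDisc, ← coeff_drinfeldPoly hv ha haA, hv.card_cosets_divLattice ha haA hk, mul_comm,
    pow_mul, h, ← pow_mul, ← pow_mul, mul_comm]

theorem ne_zero_of_sgnEqOne {a : K} (hs : v.SgnEqOne a) : a ≠ 0 := by
  rintro rfl
  obtain ⟨n, hn⟩ := hs
  rw [zero_mul, zero_sub, v.abv.map_neg, map_one] at hn
  exact lt_irrefl _ hn

/-- The limit of the `k`-step quotients is computed twice: as `Δ_a`, and by telescoping as a power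
of `δ`. -/
theorem isCanonicalDiscriminant_of_tendsto (hv : v.IsDiscreteCocompact) (F : Type*) (hr : 1 ≤ r)
    {p m : ℕ} [Fact p.Prime] [CharP v.Cinf p] (hm : m ≠ 0) (hQ : v.qInf ^ r = p ^ m)
    {Y : v.Lattice r} {ω : v.Psi r} {δ : v.Cinf}
    (h : Tendsto (normalizedQuot (v.qInf ^ r) (v.toCinf v.π) (v.latticeCount Y)
      (ballProd hv Y ω) 1) atTop (𝓝 δ)) :
    v.IsCanonicalDiscriminant F r (v.latticeImage Y ω) δ := by
  intro a haA hs d hd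
  have ha := ne_zero_of_sgnEqOne hs
  obtain ⟨k, hk⟩ := hv.exists_abv_eq_pow haA ha
  have hdk : Nat.card F ^ d = v.qInf ^ k := by
    rw [hk] at hd
    exact_mod_cast hd.symm
  refine ⟨_, isDrinfeldPoly_drinfeldPoly hv ha haA Y ω, ?_⟩
  rw [coeff_eq_divDisc hv ha haA hk hdk, geomSum_eq_div_w v hr hdk]
  exact tendsto_nhds_unique (tendsto_divDisc hv hm hQ ha haA hs hk Y ω)
    (tendsto_normalizedQuot (toCinf_ne_zero v.π_ne_zero) (ballProd_ne_zero hv Y ω)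
      (hv.eventually_latticeCount_succ Y) h k)

/-- The exponents `s_k = 1 + Q + ⋯ + Q^{k-1}` satisfy `s_{k+1} = Q s_k + 1`, so `δ` is recovered as
`Δ_b / Δ_a^Q`. -/
theorem eq_discQuot_of_isCanonicalDiscriminant (hv : v.IsDiscreteCocompact) {F : Type*}
    (hr : 1 ≤ r) {f : ℕ} (hf : v.qInf = Nat.card F ^ f) (hpole : ∃ a ∈ v.A, 1 < v.abv a)
    {a b : K} (ha : v.SgnEqOne a) (haA : a ∈ v.A) (hb : v.SgnEqOne b) (hbA : b ∈ v.A)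
    {k : ℕ} (hak : v.abv a = (v.qInf : ℝ) ^ k) (hbk : v.abv b = (v.qInf : ℝ) ^ (k + 1))
    {Y : v.Lattice r} {ω : v.Psi r} {δ : v.Cinf}
    (h : v.IsCanonicalDiscriminant F r (v.latticeImage Y ω) δ) :
    δ = discQuot a b (ne_zero_of_sgnEqOne ha) (ne_zero_of_sgnEqOne hb) Y ω := by
  have key : ∀ (a : K) (ha : v.SgnEqOne a) (k : ℕ), a ∈ v.A → v.abv a = (v.qInf : ℝ) ^ k →
      divDisc a (ne_zero_of_sgnEqOne ha) Y ω = δ ^ ∑ i ∈ Finset.range k, (v.qInf ^ r) ^ i := by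
    intro a ha k haA hk
    have hdk : Nat.card F ^ (f * k) = v.qInf ^ k := by rw [hf, ← pow_mul]
    obtain ⟨φ, hφ, hc⟩ := h a haA ha (f * k) (by rw [hk]; exact_mod_cast hdk.symm)
    -- The hypothesis only supplies some `φ`; uniqueness identifies it with the explicit polynomial,
    -- whose coefficient is known.
    rw [isDrinfeldPoly_unique hv hr hpole hφ (isDrinfeldPoly_drinfeldPoly hv
      (ne_zero_of_sgnEqOne ha) haA Y ω), coeff_eq_divDisc hv _ haA hk hdk,
      geomSum_eq_div_w v hr hdk] at hc
    exact hc
  have h0 := divDisc_ne_zero hv (ne_zero_of_sgnEqOne ha) Y ω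
  rw [discQuot, eq_div_iff (pow_ne_zero _ h0), key b hb _ hbA hbk, key a ha _ haA hak,
    geom_sum_succ, pow_succ', mul_comm (v.qInf ^ r), pow_mul]

/-- Two elements of `A` of sign one and of consecutive degrees. -/
structure IsSignPair (v : Place K) (a b : K) (k : ℕ) : Prop where
  left_mem : a ∈ v.A
  right_mem : b ∈ v.A
  sgn_left : v.SgnEqOne a
  sgn_right : v.SgnEqOne b
  abv_left : v.abv a = (v.qInf : ℝ) ^ k
  abv_right : v.abv b = (v.qInf : ℝ) ^ (k + 1)

theorem IsDiscreteCocompact.exists_isSignPair (hv : v.IsDiscreteCocompact) :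
    ∃ a b k, v.IsSignPair a b k := by
  obtain ⟨k, hk⟩ := hv.exists_sgnEqOne
  obtain ⟨a, haA, ha, hak⟩ := hk k le_rfl
  obtain ⟨b, hbA, hb, hbk⟩ := hk (k + 1) (Nat.le_succ k)
  exact ⟨a, b, k, haA, hbA, ha, hb, hak, hbk⟩

variable {F : Type*} [Field F] [Algebra F K]

theorem tendsto_discQuot (hK : IsGlobalFunctionField F K) (hv : v.IsDiscreteCocompact)
    (hr : 1 ≤ r) {a b : K} {k : ℕ} (h : v.IsSignPair a b k) (Y : v.Lattice r) (ω : v.Psi r) :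
    Tendsto (normalizedQuot (v.qInf ^ r) (v.toCinf v.π) (v.latticeCount Y)
      (ballProd hv Y ω) 1) atTop
      (𝓝 (discQuot a b (ne_zero_of_sgnEqOne h.sgn_left) (ne_zero_of_sgnEqOne h.sgn_right) Y ω)) := by
  obtain ⟨p, m, hp, hc, hm, hq⟩ := exists_charP_Cinf hK v
  have : Fact p.Prime := ⟨hp⟩
  have hm' : m * r ≠ 0 := mul_ne_zero hm (Nat.one_le_iff_ne_zero.1 hr)
  have hQ : v.qInf ^ r = p ^ (m * r) := by rw [hq, ← pow_mul]
  exact tendsto_normalizedQuot_one (toCinf_ne_zero v.π_ne_zero) (ballProd_ne_zero hv Y ω)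
    (hv.eventually_latticeCount_succ Y) (divDisc_ne_zero hv _ Y ω)
    (tendsto_divDisc hv hm' hQ _ h.left_mem h.sgn_left h.abv_left Y ω)
    (tendsto_divDisc hv hm' hQ _ h.right_mem h.sgn_right h.abv_right Y ω)

theorem isCanonicalDiscriminant_iff (hK : IsGlobalFunctionField F K) (hr : 1 ≤ r) {a b : K}
    {k : ℕ} (h : v.IsSignPair a b k) {Y : v.Lattice r} {ω : v.Psi r} {δ : v.Cinf} :
    v.IsCanonicalDiscriminant F r (v.latticeImage Y ω) δ ↔
      δ = discQuot a b (ne_zero_of_sgnEqOne h.sgn_left) (ne_zero_of_sgnEqOne h.sgn_right) Y ω := by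
  have hv := v.isDiscreteCocompact hK
  obtain ⟨f, -, hf⟩ := v.exists_qInf_eq_pow hK
  refine ⟨fun hδ => eq_discQuot_of_isCanonicalDiscriminant hv hr hf (v.exists_one_lt_abv hK)
    h.sgn_left h.left_mem h.sgn_right h.right_mem h.abv_left h.abv_right hδ, ?_⟩
  rintro rfl
  obtain ⟨p, m, hp, hc, hm, hq⟩ := exists_charP_Cinf hK v
  have : Fact p.Prime := ⟨hp⟩
  exact isCanonicalDiscriminant_of_tendsto hv F hr (mul_ne_zero hm (Nat.one_le_iff_ne_zero.1 hr))
    (by rw [hq, ← pow_mul]) (tendsto_discQuot hK hv hr h Y ω)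

theorem existsUnique_isCanonicalDiscriminant (hK : IsGlobalFunctionField F K) (hr : 1 ≤ r)
    (Y : v.Lattice r) (ω : v.Psi r) :
    ∃! δ : v.Cinf, v.IsCanonicalDiscriminant F r (v.latticeImage Y ω) δ := by
  obtain ⟨a, b, k, h⟩ := (v.isDiscreteCocompact hK).exists_isSignPair
  exact ⟨_, (isCanonicalDiscriminant_iff hK hr h).2 rfl,
    fun δ hδ => (isCanonicalDiscriminant_iff hK hr h).1 hδ⟩

theorem discriminant_eq_discQuot (hK : IsGlobalFunctionField F K) (hr : 1 ≤ r) {a b : K} {k : ℕ}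
    (h : v.IsSignPair a b k) (Y : v.Lattice r) (ω : v.Psi r) : v.discriminant F Y ω =
      discQuot a b (ne_zero_of_sgnEqOne h.sgn_left) (ne_zero_of_sgnEqOne h.sgn_right) Y ω :=
  (isCanonicalDiscriminant_iff hK hr h).1
    (Classical.epsilon_spec (existsUnique_isCanonicalDiscriminant hK hr Y ω).exists)

/-- Both discriminants are limits of one-step quotients, and the ball products of the two lattices
are related asymptotically by `tendsto_ballProd`. -/
theorem discriminant_eq_mul_divProd (hK : IsGlobalFunctionField F K) (hr : 1 ≤ r)
    {Y Y' : v.Lattice r} (h : Y.1 ≤ Y'.1) (ω : v.Psi r) :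
    v.discriminant F Y' ω =
      v.discriminant F Y ω ^ (v.cosets Y Y').card * v.divProd Y Y' ω ^ v.w r := by
  have hv := v.isDiscreteCocompact hK
  obtain ⟨a, b, k, hab⟩ := hv.exists_isSignPair
  have h1 := tendsto_discQuot hK hv hr hab Y ω
  have h2 := tendsto_discQuot hK hv hr hab Y' ω
  rw [← discriminant_eq_discQuot hK hr hab] at h1 h2
  exact tendsto_nhds_unique h2 (tendsto_normalizedQuot_one_of_index (one_lt_qInf_pow v hr).le
    (toCinf_ne_zero v.π_ne_zero) (ballProd_ne_zero hv Y ω) (hv.eventually_latticeCount_index h)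
    (divProd_ne_zero hv Y Y' ω) (tendsto_ballProd hv h ω) h1)

end Discriminant

/-! ### Fibres of `V/Y → V/Y'`. -/

section Distribution

variable (v) in
/-- The classes modulo `Y` that are congruent to `x` modulo `Y'`. -/
def fibre (Y Y' : v.Lattice r) (x : Fin r → K) : Finset ((Fin r → K) ⧸ Y.1) :=
  (v.cosets Y Y').image fun c => c + Submodule.Quotient.mk x

theorem IsDiscreteCocompact.mem_fibre (hv : v.IsDiscreteCocompact) {Y Y' : v.Lattice r}
    (h : Y.1 ≤ Y'.1) (x : Fin r → K) (c : (Fin r → K) ⧸ Y.1) :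
    c ∈ v.fibre Y Y' x ↔ Quotient.out c - x ∈ Y'.1 := by
  have e : c ∈ v.fibre Y Y' x ↔ c - Submodule.Quotient.mk x ∈ v.cosets Y Y' := by
    rw [fibre, Finset.mem_image]
    constructor
    · rintro ⟨c, hc, rfl⟩
      rwa [add_sub_cancel_right]
    · exact fun hc => ⟨_, hc, sub_add_cancel _ _⟩
  rw [e, hv.mem_cosets h]
  have h1 : Quotient.out (c - Submodule.Quotient.mk x) - (Quotient.out c - x) ∈ Y.1 := by
    rw [out_sub_mem_iff, Submodule.Quotient.mk_sub, mk_out]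
  constructor
  · intro h2
    have h3 := sub_mem h2 (h h1)
    rwa [sub_sub_cancel] at h3
  · intro h2
    have h3 := add_mem (h h1) h2
    rwa [sub_add_cancel] at h3

theorem card_fibre (Y Y' : v.Lattice r) (x : Fin r → K) :
    (v.fibre Y Y' x).card = (v.cosets Y Y').card :=
  Finset.card_image_of_injective _ (add_left_injective _)

theorem prod_fibre {M : Type*} [CommMonoid M] (Y Y' : v.Lattice r) (x : Fin r → K)
    (g : (Fin r → K) ⧸ Y.1 → M) :
    ∏ c ∈ v.fibre Y Y' x, g c = ∏ c ∈ v.cosets Y Y', g (c + Submodule.Quotient.mk x) :=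
  Finset.prod_image fun _ _ _ _ h => add_right_cancel h

theorem prod_divFun_fibre (hv : v.IsDiscreteCocompact) {Y Y' : v.Lattice r} (h : Y.1 ≤ Y'.1)
    (ω : v.Psi r) (x : Fin r → K) :
    ∏ c ∈ v.fibre Y Y' x, v.divFun (Quotient.out c) Y ω =
      v.divFun x Y' ω * v.divProd Y Y' ω := by
  refine (prod_fibre Y Y' x fun c => v.divFun (Quotient.out c) Y ω).trans ?_
  rw [divFun_eq hv, exp_mul_divProd hv h]
  refine Finset.prod_congr rfl fun c _ => ?_
  rw [← pair_add, ← divFun_eq hv]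
  refine divFun_congr hv ω ?_
  rw [out_sub_mem_iff, Submodule.Quotient.mk_add, mk_out, add_comm]

end Distribution

end Place

namespace Place

variable {K : Type*} [Field K] {v : Place K} {r : ℕ}

/-! ### Uniform limits of holomorphic functions. -/

section HolomorphicFunctions

theorem isHolomorphic_eval (P : MvPolynomial (Fin r) v.Cinf) :
    v.IsHolomorphic fun ω : v.Psi r => MvPolynomial.eval ω.1 P := fun n ε hε =>
  ⟨P, 1, ⟨1, one_pos, fun ω _ => by simp⟩, fun ω _ => by simpa using hε.le⟩

theorem isHolomorphic_inv_eval {P : MvPolynomial (Fin r) v.Cinf}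
    (hP : ∀ n, ∃ c : ℝ, 0 < c ∧ ∀ ω ∈ v.PsiAff r n, c ≤ ‖MvPolynomial.eval ω.1 P‖) :
    v.IsHolomorphic fun ω : v.Psi r => (MvPolynomial.eval ω.1 P)⁻¹ := fun n ε hε =>
  ⟨1, P, hP n, fun ω _ => by simpa using hε.le⟩

theorem isHolomorphic_of_forall_exists {f : v.Psi r → v.Cinf}
    (h : ∀ n : ℕ, ∀ ε : ℝ, 0 < ε → ∃ g : v.Psi r → v.Cinf, v.IsHolomorphic g ∧
      ∀ ω ∈ v.PsiAff r n, ‖f ω - g ω‖ ≤ ε) : v.IsHolomorphic f := by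
  intro n ε hε
  obtain ⟨g, hg, hfg⟩ := h n (ε / 2) (half_pos hε)
  obtain ⟨P, Q, hQ, hPQ⟩ := hg n (ε / 2) (half_pos hε)
  refine ⟨P, Q, hQ, fun ω hω => ?_⟩
  rw [← sub_add_sub_cancel (f ω) (g ω)]
  exact (norm_add_le _ _).trans (by linarith [hfg ω hω, hPQ ω hω])

variable {ι : Type*} {l : Filter ι}

/-- A relative error at most `1/2` forces `‖g_i‖ = ‖f‖` on `Ψ_n`, so one bounded `g_i` bounds all
late ones, and the relative error becomes an absolute one. -/
theorem eventually_norm_sub_le [l.NeBot] {f : v.Psi r → v.Cinf} {g : ι → v.Psi r → v.Cinf}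
    (hg : ∀ i, v.IsHolomorphic (g i)) (hg0 : ∀ i ω, g i ω ≠ 0)
    (h : ∀ n : ℕ, ∀ ε : ℝ, 0 < ε → ∀ᶠ i in l, ∀ ω ∈ v.PsiAff r n, ‖f ω / g i ω - 1‖ ≤ ε)
    (n : ℕ) {ε : ℝ} (hε : 0 < ε) : ∀ᶠ i in l, ∀ ω ∈ v.PsiAff r n, ‖f ω - g i ω‖ ≤ ε := by
  have hnorm : ∀ᶠ i in l, ∀ ω ∈ v.PsiAff r n, ‖g i ω‖ = ‖f ω‖ := by
    filter_upwards [h n (1 / 2) (by norm_num)] with i hi ω hω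
    have h1 := norm_eq_one_of_norm_sub_one_lt ((hi ω hω).trans_lt (by norm_num))
    rw [norm_div, div_eq_one_iff_eq (norm_ne_zero_iff.2 (hg0 i ω))] at h1
    exact h1.symm
  obtain ⟨i₀, hi₀⟩ := hnorm.exists
  obtain ⟨B, hB, hgB⟩ := (hg i₀).bounded v n
  filter_upwards [hnorm, h n (ε / (B + 1)) (by positivity)] with i h1 h2 ω hω
  have e : f ω - g i ω = g i ω * (f ω / g i ω - 1) := by
    have := hg0 i ω
    field_simp
  have h3 : ‖g i ω‖ ≤ B + 1 := by
    rw [h1 ω hω, ← hi₀ ω hω]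
    exact (hgB ω hω).trans (by linarith)
  rw [e, norm_mul]
  calc ‖g i ω‖ * ‖f ω / g i ω - 1‖ ≤ (B + 1) * (ε / (B + 1)) :=
        mul_le_mul h3 (h2 ω hω) (norm_nonneg _) (by positivity)
    _ = ε := by field_simp

theorem tendsto_hol_iff {f : v.Hol r} {g : ι → v.Hol r} :
    Tendsto g l (𝓝 f) ↔ ∀ n : ℕ, ∀ ε : ℝ, 0 < ε → ∀ᶠ i in l, ∀ ω ∈ v.PsiAff r n,
      ‖(f : v.Psi r → v.Cinf) ω - (g i : v.Psi r → v.Cinf) ω‖ ≤ ε := by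
  rw [nhds_induced, tendsto_comap_iff, UniformOnFun.tendsto_iff_tendstoUniformlyOn]
  simp only [Set.forall_mem_range, Metric.tendstoUniformlyOn_iff]
  refine forall_congr' fun n => ⟨fun h ε hε => ?_, fun h ε hε => ?_⟩
  · filter_upwards [h ε hε] with i hi ω hω
    rw [← dist_eq_norm]
    exact (hi ω hω).le
  · filter_upwards [h (ε / 2) (half_pos hε)] with i hi ω hω
    refine lt_of_le_of_lt ?_ (half_lt_self hε)
    have := hi ω hω
    rwa [← dist_eq_norm] at this

end HolomorphicFunctions

/-! ### Invertible holomorphic functions and their limits. -/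

section Units

variable (v r) in
/-- The value at `ω` as a homomorphism. -/
def valueHom (ω : v.Psi r) : (v.Hol r)ˣ →* v.Cinf where
  toFun h := v.value h ω
  map_one' := rfl
  map_mul' _ _ := rfl

theorem value_mul (h k : (v.Hol r)ˣ) (ω : v.Psi r) :
    v.value (h * k) ω = v.value h ω * v.value k ω := rfl

theorem value_one (ω : v.Psi r) : v.value (1 : (v.Hol r)ˣ) ω = 1 := rfl

theorem value_inv (h : (v.Hol r)ˣ) (ω : v.Psi r) : v.value h⁻¹ ω = (v.value h ω)⁻¹ := by
  apply eq_inv_of_mul_eq_one_left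
  rw [← value_mul, inv_mul_cancel, value_one]

theorem value_ne_zero (h : (v.Hol r)ˣ) (ω : v.Psi r) : v.value h ω ≠ 0 := by
  intro h0
  have h1 := value_one ω
  rw [← mul_inv_cancel h, value_mul, h0, zero_mul] at h1
  exact zero_ne_one h1

theorem value_div (h k : (v.Hol r)ˣ) (ω : v.Psi r) :
    v.value (h / k) ω = v.value h ω / v.value k ω := by
  rw [div_eq_mul_inv, value_mul, value_inv, div_eq_mul_inv]

theorem value_pow (h : (v.Hol r)ˣ) (n : ℕ) (ω : v.Psi r) :
    v.value (h ^ n) ω = v.value h ω ^ n := map_pow (valueHom v r ω) h n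

theorem value_prod {ι : Type*} (s : Finset ι) (h : ι → (v.Hol r)ˣ) (ω : v.Psi r) :
    v.value (∏ i ∈ s, h i) ω = ∏ i ∈ s, v.value (h i) ω := map_prod (valueHom v r ω) h s

theorem units_ext {h k : (v.Hol r)ˣ} (e : ∀ ω, v.value h ω = v.value k ω) : h = k :=
  Units.ext (Subtype.ext (funext e))

theorem exists_unit {f : v.Psi r → v.Cinf} (hf : v.IsHolomorphic f)
    (hf' : v.IsHolomorphic fun ω => (f ω)⁻¹) (h0 : ∀ ω, f ω ≠ 0) :
    ∃ h : (v.Hol r)ˣ, ∀ ω, v.value h ω = f ω :=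
  ⟨⟨⟨f, hf⟩, ⟨_, hf'⟩, Subtype.ext (funext fun ω => mul_inv_cancel₀ (h0 ω)),
    Subtype.ext (funext fun ω => inv_mul_cancel₀ (h0 ω))⟩, fun _ => rfl⟩

theorem exists_unit_const {a : v.Cinf} (ha : a ≠ 0) :
    ∃ h : (v.Hol r)ˣ, ∀ ω, v.value h ω = a :=
  exists_unit (v.isHolomorphic_const a) (v.isHolomorphic_const a⁻¹) fun _ => ha

theorem exists_unit_pair (x : {x : Fin r → K // x ≠ 0}) :
    ∃ h : (v.Hol r)ˣ, ∀ ω, v.value h ω = v.pair x.1 ω.1 := by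
  let P : MvPolynomial (Fin r) v.Cinf :=
    ∑ i, MvPolynomial.C (v.toCinf (x.1 i)) * MvPolynomial.X i
  have hP : (fun ω : v.Psi r => v.pair x.1 ω.1) = fun ω => MvPolynomial.eval ω.1 P := by
    funext ω
    simp [P, pair]
  refine exists_unit (hP ▸ isHolomorphic_eval P) ?_ fun ω => ?_
  · have hP' : (fun ω : v.Psi r => (v.pair x.1 ω.1)⁻¹) =
        fun ω => (MvPolynomial.eval ω.1 P)⁻¹ := funext fun ω => congrArg _ (congrFun hP ω)
    rw [hP']
    refine isHolomorphic_inv_eval fun n => ⟨((v.qInf : ℝ) ^ n)⁻¹ * v.maxNorm x.1,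
      mul_pos (inv_pos.2 (pow_pos v.qInf_pos_real n)) (v.maxNorm_pos x.2), fun ω hω => ?_⟩
    rw [← congrFun hP ω]
    exact v.le_norm_pair hω x.1
  · rw [Ne, v.pair_eq_zero_iff ω]
    exact x.2

variable (v) in
/-- The linear form `ω ↦ x · ω` as an invertible holomorphic function. -/
def lin (x : {x : Fin r → K // x ≠ 0}) : (v.Hol r)ˣ := (exists_unit_pair x).choose

theorem value_lin (x : {x : Fin r → K // x ≠ 0}) (ω : v.Psi r) :
    v.value (v.lin x) ω = v.pair x.1 ω.1 := (exists_unit_pair x).choose_spec ω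

/-- Closeness of a ratio to one is stable under inversion. Hence function and inverse are both
uniform limits, which is what holomorphy of the limit unit and convergence in the unit topology
require. -/
theorem exists_unit_tendsto {ι : Type*} {l : Filter ι} [l.NeBot] {f : v.Psi r → v.Cinf}
    {h : ι → (v.Hol r)ˣ} (H : ∀ n : ℕ, ∀ ε : ℝ, 0 < ε → ∀ᶠ i in l, ∀ ω ∈ v.PsiAff r n,
      ‖f ω / v.value (h i) ω - 1‖ ≤ ε) :
    ∃ k : (v.Hol r)ˣ, (∀ ω, v.value k ω = f ω) ∧ Tendsto h l (𝓝 k) := by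
  have H' : ∀ n : ℕ, ∀ ε : ℝ, 0 < ε → ∀ᶠ i in l, ∀ ω ∈ v.PsiAff r n,
      ‖(f ω)⁻¹ / v.value (h i)⁻¹ ω - 1‖ ≤ ε := by
    intro n ε hε
    filter_upwards [H n (min ε (1 / 2)) (lt_min hε (by norm_num))] with i hi ω hω
    rw [value_inv, ← inv_div_inv, inv_inv, inv_inv, ← inv_div]
    refine (norm_inv_sub_one_le ?_ (hi ω hω)).trans (min_le_left _ _)
    exact (min_le_right _ _).trans_lt (by norm_num)
  have h0 : ∀ ω, f ω ≠ 0 := by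
    intro ω hω
    obtain ⟨n, hn⟩ := v.exists_mem_PsiAff ω
    obtain ⟨i, hi⟩ := (H n (1 / 2) (by norm_num)).exists
    have := hi ω hn
    rw [hω, zero_div, zero_sub, norm_neg, norm_one] at this
    norm_num at this
  have hh : ∀ k : (v.Hol r)ˣ, v.IsHolomorphic (v.value k) := fun k => (k : v.Hol r).2
  have E := fun n ε hε => eventually_norm_sub_le (fun i => hh (h i)) (fun i => value_ne_zero (h i))
    H n (ε := ε) hε
  have E' := fun n ε hε => eventually_norm_sub_le (fun i => hh (h i)⁻¹)
    (fun i => value_ne_zero (h i)⁻¹) H' n (ε := ε) hε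
  obtain ⟨k, hk⟩ := exists_unit
    (isHolomorphic_of_forall_exists fun n ε hε => (E n ε hε).exists.imp' (fun i => v.value (h i))
      fun i hi => ⟨hh _, hi⟩)
    (isHolomorphic_of_forall_exists fun n ε hε => (E' n ε hε).exists.imp'
      (fun i => v.value (h i)⁻¹) fun i hi => ⟨hh _, hi⟩) h0
  refine ⟨k, hk, ?_⟩
  rw [Units.isInducing_embedProduct.tendsto_nhds_iff]
  refine Tendsto.prodMk_nhds ?_ ?_
  · rw [tendsto_hol_iff]
    intro n ε hε
    filter_upwards [E n ε hε] with i hi ω hω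
    change ‖v.value k ω - _‖ ≤ ε
    rw [hk]
    exact hi ω hω
  · refine (MulOpposite.continuous_op.tendsto _).comp ?_
    rw [tendsto_hol_iff]
    intro n ε hε
    filter_upwards [E' n ε hε] with i hi ω hω
    change ‖v.value k⁻¹ ω - _‖ ≤ ε
    rw [value_inv, hk]
    exact hi ω hω

end Units

/-! ### Division functions as limits of quotients of linear forms. -/

section DivisionFunctions

variable (v) in
/-- The non-zero elements of norm at most `R` of the class of `u` modulo `Y`. -/
def cosetBall (u : Fin r → K) (Y : v.Lattice r) (R : ℝ) : Set {x : Fin r → K // x ≠ 0} :=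
  {x | x.1 - u ∈ Y.1 ∧ v.maxNorm x.1 ≤ R}

theorem IsDiscreteCocompact.bijOn_cosetBall (hv : v.IsDiscreteCocompact) {u : Fin r → K}
    {Y : v.Lattice r} (hu : u ∉ Y.1) {R : ℝ} (hR : v.maxNorm u ≤ R) :
    Set.BijOn (fun x : {x : Fin r → K // x ≠ 0} => x.1 - u) (v.cosetBall u Y R)
      (v.latticeBall Y R) := by
  refine ⟨fun x hx => ?_, fun x _ y _ hxy => Subtype.ext (sub_left_injective hxy), fun y hy => ?_⟩
  · exact hv.mem_latticeBall.2 ⟨hx.1, (v.maxNorm_sub_le_max _ _).trans (max_le hx.2 hR)⟩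
  · have hy := hv.mem_latticeBall.1 hy
    have h0 : y + u ≠ 0 := fun h => hu (by
      rw [← neg_eq_of_add_eq_zero_right h]
      exact neg_mem hy.1)
    refine ⟨⟨y + u, h0⟩, ⟨?_, (v.maxNorm_add_le_max _ _).trans (max_le hy.2 hR)⟩,
      add_sub_cancel_right y u⟩
    rw [add_sub_cancel_right]
    exact hy.1

theorem IsDiscreteCocompact.bijOn_cosetBall_zero (hv : v.IsDiscreteCocompact)
    (Y : v.Lattice r) (R : ℝ) :
    Set.BijOn (fun x : {x : Fin r → K // x ≠ 0} => x.1) (v.cosetBall 0 Y R)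
      ((v.latticeBall Y R).erase 0) := by
  refine ⟨fun x hx => ?_, Subtype.val_injective.injOn, fun y hy => ?_⟩
  · refine Finset.mem_coe.2 (Finset.mem_erase.2 ⟨x.2, hv.mem_latticeBall.2 ⟨?_, hx.2⟩⟩)
    simpa using hx.1
  · have hy := Finset.mem_erase.1 (Finset.mem_coe.1 hy)
    have hy' := hv.mem_latticeBall.1 hy.2
    exact ⟨⟨y, hy.1⟩, ⟨by simpa using hy'.1, hy'.2⟩, rfl⟩

theorem IsDiscreteCocompact.finite_cosetBall (hv : v.IsDiscreteCocompact) (u : Fin r → K)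
    (Y : v.Lattice r) (R : ℝ) : (v.cosetBall u Y R).Finite := by
  refine Set.Finite.of_finite_image (f := fun x => x.1 - u)
    ((v.latticeBall Y (max R (v.maxNorm u))).finite_toSet.subset ?_)
    fun x _ y _ hxy => Subtype.ext (sub_left_injective hxy)
  rintro _ ⟨x, hx, rfl⟩
  exact hv.mem_latticeBall.2 ⟨hx.1, (v.maxNorm_sub_le_max _ _).trans (max_le_max_right _ hx.2)⟩

variable (v) in
/-- The quotient of the products of the `(x · ω) ^ e` over the non-zero `x` of norm at most `R` in
the class of `u` and in `Y`. -/
def partialQuot (e : ℕ) (u : Fin r → K) (Y : v.Lattice r) (R : ℝ) : (v.Hol r)ˣ :=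
  (∏ᶠ x ∈ v.cosetBall u Y R, v.lin x ^ e) / ∏ᶠ y ∈ v.cosetBall 0 Y R, v.lin y ^ e

/-- For `R` at least the norm of `u`, translation by `u` identifies the coset ball with the lattice
ball, so the quotient is a truncated exponential. -/
theorem value_partialQuot (hv : v.IsDiscreteCocompact) (e : ℕ) {u : Fin r → K} {Y : v.Lattice r}
    (hu : u ∉ Y.1) {R : ℝ} (hR : v.maxNorm u ≤ R) (ω : v.Psi r) :
    v.value (v.partialQuot e u Y R) ω =
      truncExp ((filtration hv Y ω).ball R) (v.pair u ω.1) ^ e := by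
  have hR0 : 0 ≤ R := (v.maxNorm_nonneg u).trans hR
  have h1 : v.value (∏ᶠ x ∈ v.cosetBall u Y R, v.lin x ^ e) ω =
      nodeProd ((filtration hv Y ω).ball R) (v.pair u ω.1) ^ e := by
    change valueHom v r ω _ = _
    rw [MonoidHom.map_finprod_mem _ _ (hv.finite_cosetBall u Y R), nodeProd,
      prod_filtration_ball hv Y ω hR0, ← Finset.prod_pow, ← finprod_mem_coe_finset]
    refine finprod_mem_eq_of_bijOn _ (hv.bijOn_cosetBall hu hR) fun x _ => ?_
    change v.value (v.lin x ^ e) ω = _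
    rw [value_pow, value_lin, ← pair_add, add_sub_cancel]
  have h2 : v.value (∏ᶠ y ∈ v.cosetBall 0 Y R, v.lin y ^ e) ω =
      nonzeroProd ((filtration hv Y ω).ball R) ^ e := by
    change valueHom v r ω _ = _
    have h3 : ((filtration hv Y ω).ball R).erase 0 =
        ((v.latticeBall Y R).erase 0).image fun y => v.pair y ω.1 := by
      rw [filtration_ball hv Y ω hR0, Finset.image_erase (v.pair_injective ω), pair_zero]
    rw [MonoidHom.map_finprod_mem _ _ (hv.finite_cosetBall 0 Y R), nonzeroProd, h3,
      Finset.prod_image (v.pair_injective ω).injOn, ← Finset.prod_pow, ← finprod_mem_coe_finset]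
    refine finprod_mem_eq_of_bijOn _ (hv.bijOn_cosetBall_zero Y R) fun x _ => ?_
    change v.value (v.lin x ^ e) ω = _
    rw [value_pow, value_lin]
  rw [partialQuot, value_div, h1, h2, ← div_pow, ← ((filtration hv Y ω).isFinSubgroup R).truncExp_eq]

theorem norm_divFun_div_sub_one_le (hv : v.IsDiscreteCocompact) {u : Fin r → K} {Y : v.Lattice r}
    {n : ℕ} {R : ℝ} (hR : (v.qInf : ℝ) ^ n * v.maxNorm u < ((v.qInf : ℝ) ^ n)⁻¹ * R)
    {ω : v.Psi r} (hω : ω ∈ v.PsiAff r n)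
    (h0 : truncExp ((filtration hv Y ω).ball R) (v.pair u ω.1) ≠ 0) :
    ‖v.divFun u Y ω / truncExp ((filtration hv Y ω).ball R) (v.pair u ω.1) - 1‖ ≤
      (v.qInf : ℝ) ^ n * v.maxNorm u / (((v.qInf : ℝ) ^ n)⁻¹ * R) := by
  have hq : 0 < (v.qInf : ℝ) ^ n := pow_pos v.qInf_pos_real n
  have hM : 0 < ((v.qInf : ℝ) ^ n)⁻¹ * R :=
    (mul_nonneg hq.le (v.maxNorm_nonneg u)).trans_lt hR
  have hz := v.norm_pair_le hω u
  have hR0 : 0 ≤ R := ((mul_pos_iff_of_pos_left (inv_pos.2 hq)).1 hM).le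
  have h1 := (filtration hv Y ω).norm_exp_sub_truncExp_le (R := R) (hz.trans_lt hR)
    fun R' l hl hl' => hv.le_norm_of_notMem hω hl (by rwa [filtration_ball hv Y ω hR0] at hl')
  rw [divFun_eq hv, ← div_self h0, ← sub_div, norm_div, div_le_iff₀ (norm_pos_iff.2 h0)]
  refine h1.trans (mul_le_mul_of_nonneg_right ?_ (norm_nonneg _))
  exact div_le_div_of_nonneg_right hz hM.le

/-- On `Ψ_n` the relative error is at most `q_∞^{2n} ‖u‖ / R`, independently of `ω`. The resulting
limit serves both as proof of holomorphy and as the limit in the motivation. -/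
theorem exists_unit_divFun (hv : v.IsDiscreteCocompact) (e : ℕ) {u : Fin r → K} {Y : v.Lattice r}
    (hu : u ∉ Y.1) : ∃ k : (v.Hol r)ˣ, (∀ ω, v.value k ω = v.divFun u Y ω ^ e) ∧
      Tendsto (v.partialQuot e u Y) atTop (𝓝 k) := by
  refine exists_unit_tendsto fun n ε hε => ?_
  set C := (v.qInf : ℝ) ^ n * v.maxNorm u with hC
  have hq : 0 < (v.qInf : ℝ) ^ n := pow_pos v.qInf_pos_real n
  have ht : Tendsto (fun R : ℝ => ((v.qInf : ℝ) ^ n)⁻¹ * R) atTop atTop :=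
    tendsto_id.const_mul_atTop (inv_pos.2 hq)
  have hlim := (ht.const_div_atTop C).eventually_le_const (lt_min hε one_pos)
  filter_upwards [hlim, eventually_ge_atTop (v.maxNorm u), ht.eventually_gt_atTop C]
    with R h1 h2 h3 ω hω
  -- The exponent one serves only to show that the truncation is nonzero, being the value of a unit.
  have hval := value_partialQuot hv 1 hu h2 ω
  rw [pow_one] at hval
  have h0 := hval ▸ value_ne_zero _ ω
  have h4 := (norm_divFun_div_sub_one_le hv h3 hω h0).trans h1
  rw [value_partialQuot hv e hu h2 ω, ← div_pow]
  exact (norm_pow_sub_one_le (le_min hε.le zero_le_one) (min_le_right _ _) h4 e).trans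
    (min_le_left _ _)

end DivisionFunctions

end Place

namespace Place

variable {K : Type*} [Field K] {v : Place K} {r : ℕ}

/-! ### Derivatives of general distributions. -/

section DerivedDistributions

variable {M : Type*} [CommGroup M]

theorem fibreProd_eq (hv : v.IsDiscreteCocompact) {Y Y' : v.Lattice r} (h : Y.1 ≤ Y'.1)
    (f : v.Domain r → M) (x : Fin r → K) :
    v.fibreProd f Y Y' x = ∏ c ∈ v.fibre Y Y' x, f (Quotient.out c, Y) :=
  finprod_cond_eq_prod_of_cond_iff _ fun {c} _ => (hv.mem_fibre h x c).symm

theorem disc_eq (hv : v.IsDiscreteCocompact) {Y Y' : v.Lattice r} (h : Y.1 ≤ Y'.1)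
    (g : v.Domain r → M) :
    v.disc g Y Y' = (∏ c ∈ (v.cosets Y Y').erase 0, g (Quotient.out c, Y))⁻¹ := by
  rw [disc]
  congr 1
  refine finprod_cond_eq_prod_of_cond_iff _ fun {c} _ => ?_
  rw [Finset.mem_erase, hv.mem_cosets h]

theorem fibre_of_mem (hv : v.IsDiscreteCocompact) {Y Y' : v.Lattice r} (h : Y.1 ≤ Y'.1)
    {x : Fin r → K} (hx : x ∈ Y'.1) : v.fibre Y Y' x = v.cosets Y Y' := by
  ext c
  rw [hv.mem_fibre h, hv.mem_cosets h]
  exact ⟨fun hc => by simpa using add_mem hc hx, fun hc => sub_mem hc hx⟩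

/-- All fibres have the same cardinality `n`, so dividing by `f(0, Y)` costs the same factor `f(0,
Y)^n` in each; the discriminant of the pair, read off from the fibre of zero, cancels it. -/
theorem isDerivedDistribution_derivative (hv : v.IsDiscreteCocompact) {f : v.Domain r → M}
    (hf : v.IsDistribution f) : v.IsDerivedDistribution (v.derivative f) := by
  have h1 : ∀ (u : Fin r → K) (Y : v.Lattice r), u ∈ Y.1 → v.derivative f (u, Y) = 1 := by
    intro u Y hu
    rw [derivative, div_eq_one]
    exact hf.1 u 0 Y (by rwa [sub_zero])
  refine ⟨h1, fun u u' Y h => congrArg (· / f (0, Y)) (hf.1 u u' Y h), fun Y Y' h x => ?_⟩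
  have key : ∀ x, ∏ c ∈ v.fibre Y Y' x, v.derivative f (Quotient.out c, Y) =
      f (x, Y') / f (0, Y) ^ (v.cosets Y Y').card := by
    intro x
    rw [← hf.2 Y Y' h x, fibreProd_eq hv h, ← card_fibre Y Y' x]
    simp only [derivative]
    rw [Finset.prod_div_distrib, Finset.prod_const]
  have h0 := key 0
  rw [fibre_of_mem hv h (zero_mem _), ← Finset.mul_prod_erase _ _ (hv.zero_mem_cosets h),
    h1 _ _ ((out_mem_iff Y 0).2 rfl), one_mul] at h0
  rw [fibreProd_eq hv h, disc_eq hv h, key, h0, ← div_eq_mul_inv, div_div_div_cancel_right,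
    derivative]

end DerivedDistributions

/-! ### The discriminant distribution. -/

section DiscriminantDistribution

theorem value_derivative {F : Type*} {f : v.Domain r → (v.Hol r)ˣ}
    (hf : ∀ (u : Fin r → K) (Y : v.Lattice r) (ω : v.Psi r),
        (u ∉ Y.1 → v.value (f (u, Y)) ω = v.divFun u Y ω ^ v.w r * v.discriminant F Y ω) ∧
        (u ∈ Y.1 → v.value (f (u, Y)) ω = v.discriminant F Y ω))
    {u : Fin r → K} {Y : v.Lattice r} (ω : v.Psi r) (hu : u ∉ Y.1) :
    v.value (v.derivative f (u, Y)) ω = v.divFun u Y ω ^ v.w r := by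
  rw [derivative, value_div, (hf u Y ω).1 hu, (hf 0 Y ω).2 (zero_mem _), mul_div_cancel_right₀]
  rw [← (hf 0 Y ω).2 (zero_mem _)]
  exact value_ne_zero _ ω

theorem exists_unit_divProd (hv : v.IsDiscreteCocompact) (Y Y' : v.Lattice r) :
    ∃ k : (v.Hol r)ˣ, ∀ ω, v.value k ω = v.divProd Y Y' ω := by
  have h : ∀ c ∈ (v.cosets Y Y').erase 0,
      ∃ k : (v.Hol r)ˣ, ∀ ω, v.value k ω = v.divFun (Quotient.out c) Y ω := fun c hc => by
    obtain ⟨k, hk, -⟩ := exists_unit_divFun hv 1 (u := Quotient.out c) (Y := Y)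
      (by rw [out_mem_iff]; exact Finset.ne_of_mem_erase hc)
    exact ⟨k, fun ω => by rw [hk, pow_one]⟩
  choose! k hk using h
  exact ⟨∏ c ∈ (v.cosets Y Y').erase 0, k c, fun ω => by
    rw [value_prod]
    exact Finset.prod_congr rfl fun c hc => hk c hc ω⟩

theorem exists_unit_divDisc (hv : v.IsDiscreteCocompact) {a : K} (ha : a ≠ 0)
    (Y : v.Lattice r) : ∃ k : (v.Hol r)ˣ, ∀ ω, v.value k ω = divDisc a ha Y ω := by
  obtain ⟨k, hk⟩ := exists_unit_divProd hv Y (v.divLattice a ha Y)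
  obtain ⟨k', hk'⟩ := exists_unit_const (v := v) (r := r) (toCinf_ne_zero ha)
  exact ⟨k' / k, fun ω => by rw [value_div, hk, hk', divDisc]⟩

variable {F : Type*} [Field F] [Algebra F K]

/-- One sign pair works for all `ω`, which exhibits the discriminant as a quotient built from
constants and finitely many division functions. -/
theorem exists_unit_discriminant (hK : IsGlobalFunctionField F K) (hr : 1 ≤ r)
    (Y : v.Lattice r) : ∃ k : (v.Hol r)ˣ, ∀ ω, v.value k ω = v.discriminant F Y ω := by
  have hv := v.isDiscreteCocompact hK
  obtain ⟨a, b, k, hab⟩ := hv.exists_isSignPair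
  obtain ⟨s, hs⟩ := exists_unit_divDisc hv (ne_zero_of_sgnEqOne hab.sgn_left) Y
  obtain ⟨t, ht⟩ := exists_unit_divDisc hv (ne_zero_of_sgnEqOne hab.sgn_right) Y
  exact ⟨t / s ^ v.qInf ^ r, fun ω => by
    rw [discriminant_eq_discQuot hK hr hab, value_div, value_pow, hs, ht, discQuot]⟩

theorem isDistribution_of_value (hK : IsGlobalFunctionField F K) (hr : 1 ≤ r)
    {f : v.Domain r → (v.Hol r)ˣ}
    (hf : ∀ (u : Fin r → K) (Y : v.Lattice r) (ω : v.Psi r),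
        (u ∉ Y.1 → v.value (f (u, Y)) ω = v.divFun u Y ω ^ v.w r * v.discriminant F Y ω) ∧
        (u ∈ Y.1 → v.value (f (u, Y)) ω = v.discriminant F Y ω)) : v.IsDistribution f := by
  have hv := v.isDiscreteCocompact hK
  refine ⟨fun u u' Y h => units_ext fun ω => ?_, fun Y Y' h x => units_ext fun ω => ?_⟩
  · by_cases hu : u ∈ Y.1
    · have hu' : u' ∈ Y.1 := by simpa using sub_mem hu h
      rw [(hf u Y ω).2 hu, (hf u' Y ω).2 hu']
    · have hu' : u' ∉ Y.1 := fun hu' => hu (by simpa using add_mem h hu')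
      rw [(hf u Y ω).1 hu, (hf u' Y ω).1 hu', divFun_congr hv ω h]
  · rw [fibreProd_eq hv h, value_prod]
    by_cases hx : x ∈ Y'.1
    -- The zero class contributes the discriminant alone, so the division functions of the other
    -- classes assemble exactly to `divProd`.
    · rw [fibre_of_mem hv h hx, (hf x Y' ω).2 hx, discriminant_eq_mul_divProd hK hr h,
        ← Finset.mul_prod_erase _ _ (hv.zero_mem_cosets h), (hf _ Y ω).2 ((out_mem_iff Y 0).2 rfl),
        Finset.prod_congr rfl fun c hc => (hf _ Y ω).1
          (by rw [out_mem_iff]; exact Finset.ne_of_mem_erase hc), Finset.prod_mul_distrib,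
        Finset.prod_const, Finset.prod_pow, ← Finset.card_erase_add_one (hv.zero_mem_cosets h),
        divProd, pow_succ]
      ring
    · have hc : ∀ c ∈ v.fibre Y Y' x, Quotient.out c ∉ Y.1 := fun c hc hcY => hx (by
        simpa using sub_mem (h hcY) ((hv.mem_fibre h x c).1 hc))
      rw [(hf x Y' ω).1 hx, Finset.prod_congr rfl fun c hc' => (hf _ Y ω).1 (hc c hc'),
        Finset.prod_mul_distrib, Finset.prod_pow, Finset.prod_const, card_fibre,
        prod_divFun_fibre hv h, discriminant_eq_mul_divProd hK hr h, mul_pow]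
      ring

end DiscriminantDistribution

/-! ### Motivation by linear forms, using the maximum norm. -/

section Motivation

theorem ballCoset_normSeminorm {q : ℕ} (hq : 1 < q) (u : Fin r → K) (Y : v.Lattice r) (N : ℝ) :
    v.ballCoset q (normSeminorm v.Kinf (Fin r → v.Kinf)) u Y N =
      v.cosetBall u Y ((q : ℝ) ^ N) := by
  ext x
  have e : normSeminorm v.Kinf (Fin r → v.Kinf) (fun i => v.toKinf (x.1 i)) = v.maxNorm x.1 := rfl
  refine and_congr_right fun _ => ?_
  rw [e, Real.logb_le_iff_le_rpow (by exact_mod_cast hq) (v.maxNorm_pos x.2)]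

theorem isMotivatedBy_of_value (hv : v.IsDiscreteCocompact) {q : ℕ} (hq : 1 < q)
    {g : v.Domain r → (v.Hol r)ˣ} {m : {x : Fin r → K // x ≠ 0} → (v.Hol r)ˣ} {e : ℕ}
    (hg : ∀ (u : Fin r → K) (Y : v.Lattice r) (ω : v.Psi r), u ∉ Y.1 →
      v.value (g (u, Y)) ω = v.divFun u Y ω ^ e) (hm : ∀ x, m x = v.lin x ^ e) :
    v.IsMotivatedBy q g m := by
  refine ⟨normSeminorm v.Kinf (Fin r → v.Kinf), fun x hx => norm_eq_zero.1 hx,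
    fun x y => IsUltrametricDist.norm_add_le_max x y, fun u Y N => ?_, fun u Y hu => ?_⟩
  · rw [ballCoset_normSeminorm hq]
    exact hv.finite_cosetBall u Y _
  · obtain ⟨k, hk, hlim⟩ := exists_unit_divFun hv e hu
    rw [units_ext fun ω => (hg u Y ω hu).trans (hk ω).symm]
    refine (hlim.comp (tendsto_rpow_atTop_of_base_gt_one q (by exact_mod_cast hq))).congr
      fun N => ?_
    simp only [ballCoset_normSeminorm hq, hm]
    rfl

end Motivation

end Place

end DrinfeldDist

end

open DrinfeldDist in
theorem mainTheorem4 (F K : Type*) [Field F] [Field K] [Algebra F K]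
    (hK : IsGlobalFunctionField F K) (v : Place K) (r : ℕ) (hr : 1 ≤ r) :
    (∀ (Y : v.Lattice r) (ω : v.Psi r),
      ∃! δ : v.Cinf, v.IsCanonicalDiscriminant F r (v.latticeImage Y ω) δ) ∧
    ∃ (f : v.Domain r → (v.Hol r)ˣ) (m : {x : Fin r → K // x ≠ 0} → (v.Hol r)ˣ),
      (∀ (u : Fin r → K) (Y : v.Lattice r) (ω : v.Psi r),
        (u ∉ Y.1 → v.value (f (u, Y)) ω =
          v.divFun u Y ω ^ v.w r * v.discriminant F Y ω) ∧
        (u ∈ Y.1 → v.value (f (u, Y)) ω = v.discriminant F Y ω)) ∧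
      v.IsDistribution f ∧
      (∀ (u : Fin r → K) (Y : v.Lattice r) (ω : v.Psi r), u ∉ Y.1 →
        v.value (v.derivative f (u, Y)) ω = v.divFun u Y ω ^ v.w r) ∧
      v.IsDerivedDistribution (v.derivative f) ∧
      (∀ (x : {x : Fin r → K // x ≠ 0}) (ω : v.Psi r),
        v.value (m x) ω = v.pair x.1 ω.1 ^ v.w r) ∧
      v.IsMotivatedBy (Nat.card F) (v.derivative f) m := by
  have hv := v.isDiscreteCocompact hK
  have hq : 1 < Nat.card F := have := hK.1; Finite.one_lt_card
  have hex : ∀ p : v.Domain r, ∃ k : (v.Hol r)ˣ, ∀ ω,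
      (p.1 ∉ p.2.1 → v.value k ω = v.divFun p.1 p.2 ω ^ v.w r * v.discriminant F p.2 ω) ∧
      (p.1 ∈ p.2.1 → v.value k ω = v.discriminant F p.2 ω) := by
    rintro ⟨u, Y⟩
    obtain ⟨D, hD⟩ := Place.exists_unit_discriminant hK hr Y
    by_cases hu : u ∈ Y.1
    · exact ⟨D, fun ω => ⟨fun h => absurd hu h, fun _ => hD ω⟩⟩
    · obtain ⟨d, hd, -⟩ := Place.exists_unit_divFun hv (v.w r) hu
      exact ⟨d * D, fun ω => ⟨fun _ => by rw [Place.value_mul, hd, hD], fun h => absurd h hu⟩⟩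
  choose f hf using hex
  have hf' := fun u Y ω => hf (u, Y) ω
  have hdist := Place.isDistribution_of_value hK hr hf'
  have hder := fun u Y ω hu => Place.value_derivative hf' (u := u) (Y := Y) ω hu
  refine ⟨Place.existsUnique_isCanonicalDiscriminant hK hr, f, fun x => v.lin x ^ v.w r, hf', hdist,
    hder, Place.isDerivedDistribution_derivative hv hdist, fun x ω => ?_,
    Place.isMotivatedBy_of_value hv hq hder fun _ => rfl⟩
  rw [Place.value_pow, Place.value_lin]
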